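/- All logarithms are natural. Let $G=(V,E)$ be a simple undirected graph with $|V|=n$, $|E|=m$ and no isolated vertices; write $d(v)$ for the degree of $v$ and $\delta(v)$ for the set of edges at $v$. For $\alpha\in(0,1)$, the PageRank vector $p_\alpha\in\mathbb R^V$ is the unique solution of $p_\alpha=\alpha\cdot\frac{\mathbf 1}{n}+(1-\alpha)Mp_\alpha$, where $M$ is the random walk transition matrix ($M_{uv}=1/d(v)$ if $uv\in E$ and $0$ otherwise), and $p_\alpha(T)=\sum_{u\in T}p_\alpha(u)$ for $T\subseteq V$. Stream. The edges of $G$ arrive in a uniformly random order. The order is thought of as generated by independent uniform timestamps $t_e\in[0,1]$, $e\in E$, with the edges presented in ascending order of timestamp. Algorithm $\mathrm{ApproxPageRank}(\alpha,T,\varepsilon)$, with constants $C,D>0$. Put $k=\lceil\frac2\alpha\log\frac1\varepsilon\rceil$, $b=\lceil D/\varepsilon^2\rceil$, $N=b(k+1)$, $\eta=\varepsilon^8 2^{-Ck}$ and $s=\lceil 100\,N\,\eta^{-k}\,k!\rceil$. (1) On the one common stream, make $s$ runs of the following procedure WalkFromTemplate, with independent uniformly random starting vertices $u_0\in V$ and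 independent uniformly random templates $\pi\in[1]\times[2]\times\dots\times[k]$. For $j=1,\dots,k$: if $\pi_j=j$, let $H_j$ be the set of edges in $\delta(u_{j-1})$ with timestamp in $[\eta(j-1),\eta j)$; fail if $H_j=\emptyset$; otherwise choose $f_j\in H_j$ uniformly at random and put $\gamma_j=\eta/|H_j|$. If $\pi_j<j$, fail if $f_{\pi_j}\notin\delta(u_{j-1})$; otherwise put $f_j=f_{\pi_j}$ and $\gamma_j=1$. In both cases let $u_j$ be the other endpoint of $f_j$. After round $k$, fail unless $\pi_j=\min\{i:f_i=f_j\}$ for all $j$. Let $\hat d_{j-1}$ be the degree of $u_{j-1}$ in $\{f_1,\dots,f_k\}\cup\{e:t_e\in[\eta k,1]\}$. Return $(u_0,\dots,u_k)$ with probability $\prod_{j=1}^k\min\bigl(\frac{\eta}{\gamma_j\hat d_{j-1}},1\bigr)$, and fail otherwise. (2) If fewer than $N$ runs succeed, the whole algorithm fails. Otherwise keep the first $N$ successful walks and split them, in order, into consecutive groups $W(0),\dots,W(k)$ of $b$ walks each. (3) Start with $\hat p=0$. For $i=1,\dots,b$ draw an independent $J$ with $\Pr[J=j]=\alpha(1-\alpha)^j$,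 $j\ge0$; if $J\le k$ and the vertex reached after $J$ steps by the $i$-th walk of $W(J)$ lies in $T$ (membership oracle), add $1/b$ to $\hat p$. Output $\hat p$. Claim. For every sufficiently large constant $C$ and every constant $D$ that is sufficiently large in terms of $C$, there are constants $c',K>0$, depending only on $C$ and $D$, such that in each of the following two cases assertion (*) below holds: (a) $n\ge1$, $\alpha\in(0,1)$ and $\varepsilon\in(0,1/2)$ are arbitrary with $\frac1\alpha\le\frac{\sqrt{c'\log n}}{4\log(1/\varepsilon)}$; (b) $\alpha\in(0,1)$ is a constant, $g(n)=o(\sqrt{\log n})$, $n\ge n_0(\alpha,g,C,D)$, and $\varepsilon\in(2^{-g(n)},1/2)$ satisfies $\frac1\alpha\le\frac{\sqrt{\log n}}{4\log(1/\varepsilon)}$. (*) For every $m$ there is a randomized one-pass streaming algorithm (knowing $n$, $m$, $\alpha$, $\varepsilon$, and given a membership oracle for $T$ after the pass) that uses at most $$(1/\varepsilon)^{\frac K\alpha\log(1/\varepsilon)}\cdot 2^{\frac{K}{\alpha^2}\log^2(1/\varepsilon)}$$ words of $\lceil\log_2 n\rceil$ bits of memory between consecutive edges and such that, for every $n$-vertex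 graph $G$ without isolated vertices and with $m$ edges and every $T\subseteq V$: on the stream of the edges of $G$ in uniformly random order (without timestamps) its output has the same distribution as the output of $\mathrm{ApproxPageRank}(\alpha,T,\varepsilon)$ under independent uniform timestamps; and with probability at least $9/10$ over the order of the stream and the internal randomness, $\mathrm{ApproxPageRank}(\alpha,T,\varepsilon)$ outputs a number $\hat p$ with $|\hat p-p_\alpha(T)|\le\varepsilon$. -/

import Mathlib

open MeasureTheory Filter

noncomputable section

namespace RandomOrderStream

/-! ### Elementary random choices -/

/-- A coin that shows `true` with probability `a` (clamped to `[0, 1]`). -/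
def coin (a : ℝ) : PMF Bool :=
  PMF.ofFintype
    (fun b => cond b (min (ENNReal.ofReal a) 1) (1 - min (ENNReal.ofReal a) 1)) (by simp)

/-- The geometric law: the value `j` has probability `α (1 - α) ^ j`, for `j = 0, 1, 2, …`. -/
def geom (α : ℝ) (h₀ : 0 < α) (h₁ : α < 1) : PMF ℕ :=
  ⟨fun j => ENNReal.ofReal (α * (1 - α) ^ j), by
    have h : HasSum (fun j : ℕ => α * (1 - α) ^ j) 1 := by
      have h2 := (hasSum_geometric_of_lt_one (r := 1 - α) (by linarith) (by linarith)).mul_left α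
      rwa [sub_sub_cancel, mul_inv_cancel₀ h₀.ne'] at h2
    have h3 : ∀ j : ℕ, 0 ≤ α * (1 - α) ^ j := fun j =>
      mul_nonneg h₀.le (pow_nonneg (by linarith) j)
    have h4 := ENNReal.ofReal_tsum_of_nonneg h3 h.summable
    rw [h.tsum_eq, ENNReal.ofReal_one] at h4
    rw [h4]
    exact ENNReal.summable.hasSum⟩

/-- A list of `s` independent samples from `μ`. -/
def iid {β : Type} (μ : PMF β) : ℕ → PMF (List β)
  | 0 => PMF.pure []
  | s + 1 => μ.bind fun x => (iid μ s).bind fun l => PMF.pure (x :: l)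

/-! ### Streaming algorithms on randomly ordered streams -/

/-- A randomized one-pass streaming algorithm on graphs with vertex set `Fin n`.  Whatever it
remembers between two edges of the stream is an element of the finite set `State`.  Fresh
random bits are available at every step.  After the pass it gets oracle access to the target set
and outputs a real number or `none` (failure). -/
structure StreamAlg (n : ℕ) where
  State : Type
  fintype : Fintype State
  init : PMF State
  step : Sym2 (Fin n) → State → PMF State
  output : (Fin n → Bool) → State → PMF (Option ℝ)

namespace StreamAlg

variable {n : ℕ}

/-- The output law of the algorithm on a stream, with the target set given by its oracle. -/
def run (A : StreamAlg n) (s : List (Sym2 (Fin n))) (inT : Fin n → Bool) :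
    PMF (Option ℝ) :=
  (s.foldl (fun μ x => μ.bind (A.step x)) A.init).bind (A.output inT)

/-- The output law when the edges of `G` arrive in a uniformly random order. -/
def runRandomOrder (A : StreamAlg n) (G : SimpleGraph (Fin n)) (inT : Fin n → Bool) :
    PMF (Option ℝ) := by
  classical
  exact (PMF.uniformOfFintype (Equiv.Perm G.edgeSet)).bind fun σ =>
    A.run ((Finset.univ : Finset G.edgeSet).toList.map
      fun (e : G.edgeSet) => (σ e : Sym2 (Fin n))) inT

/-- The number of bits of memory: `⌈log₂ (number of states)⌉`. -/
def bits (A : StreamAlg n) : ℕ := Nat.clog 2 (@Fintype.card A.State A.fintype)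

/-- The memory consists of at most `w` words, a word being `⌈log₂ n⌉` bits. -/
def UsesAtMostWords (A : StreamAlg n) (w : ℝ) : Prop :=
  (A.bits : ℝ) ≤ w * (Nat.clog 2 n : ℝ)

end StreamAlg

/-! ### Generating one walk -/

/-- Walk templates of length `k`: the `j`-th entry (`j = 0, …, k - 1`) is one of `0, …, j`. -/
abbrev Template (k : ℕ) : Type := (j : Fin k) → Fin (j.val + 1)

/-- A sequence of edges conforms with a template if the `j`-th entry of the template is the first
position at which the `j`-th edge occurs in the sequence. -/
def Conforms {E : Type} {k : ℕ} (π : Template k) (f : List E) : Prop :=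
  ∀ j : Fin k, f[(π j).val]? = f[j.val]? ∧ ∀ i < (π j).val, f[i]? ≠ f[j.val]?

/-- The endpoint of the edge `e` other than `u` (only used if `u` is an endpoint of `e`). -/
def otherEnd {n : ℕ} (e : Sym2 (Fin n)) (u : Fin n) : Fin n := by
  classical
  exact if h : u ∈ e then Sym2.Mem.other h else u

section Walk

variable {n : ℕ} (G : SimpleGraph (Fin n)) (t : G.edgeSet → unitInterval)

/-- One traversed edge `f_j`, with the vertex `u_{j-1}` at which it was entered and the
quantity `γ_j`. -/
structure WalkStep where
  vertex : Fin n
  edge : G.edgeSet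
  gamma : ℝ

/-- A partial walk: the steps made so far and the vertex reached. -/
structure Trace where
  steps : List (WalkStep G)
  current : Fin n

variable {G}

/-- The edges at `u` with timestamp in `[a, b)`. -/
def incidentEdges (u : Fin n) (a b : ℝ) : Finset G.edgeSet := by
  classical
  exact Finset.univ.filter fun e =>
    u ∈ (e : Sym2 (Fin n)) ∧ a ≤ (t e : ℝ) ∧ (t e : ℝ) < b

/-- Append an edge (and its `γ`) to a partial walk. -/
def Trace.push (w : Trace G) (f : G.edgeSet) (γ : ℝ) : Trace G :=
  { steps := w.steps ++ [⟨w.current, f, γ⟩], current := otherEnd f w.current }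

/-- Round `j` (`j = 0, …, k - 1`).  If `r = j`, a uniformly random edge at the current
vertex is chosen from the part `[η j, η (j + 1))` of the stream; otherwise the edge of round `r`
is taken again.  The value `none` is failure. -/
def walkRound (η : ℝ) (j r : ℕ) (w : Trace G) : PMF (Option (Trace G)) := by
  classical
  exact
    if r = j then
      let H := incidentEdges t w.current (η * j) (η * (j + 1))
      if h : H.Nonempty then
        (PMF.uniformOfFinset H h).bind fun f =>
          PMF.pure (some (w.push f (1 / (H.card : ℝ) * η)))
      else PMF.pure none
    else
      match w.steps[r]? with
      | none => PMF.pure none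
      | some s =>
          if w.current ∈ (s.edge : Sym2 (Fin n)) then PMF.pure (some (w.push s.edge 1))
          else PMF.pure none

/-- The estimate `d̂` for the degree of `u`: its degree in the set of the edges of the walk
together with the edges with timestamp in `[η k, 1]`. -/
def degreeEstimate (η : ℝ) (k : ℕ) (w : Trace G) (u : Fin n) : ℕ := by
  classical
  exact (Finset.univ.filter fun e : G.edgeSet =>
    u ∈ (e : Sym2 (Fin n)) ∧ (e ∈ w.steps.map WalkStep.edge ∨ η * k ≤ (t e : ℝ))).card

/-- The probability with which a collected walk is kept. -/
def acceptProb (η : ℝ) (k : ℕ) (w : Trace G) : ℝ :=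
  (w.steps.map fun s => min (η / (s.gamma * degreeEstimate t η k w s.vertex)) 1).prod

/-- `WalkFromTemplate`: the walk `[u₀, …, u_k]`, or `none` on failure. -/
def walkFromTemplate (η : ℝ) {k : ℕ} (u₀ : Fin n) (π : Template k) :
    PMF (Option (List (Fin n))) := by
  classical
  exact
    ((List.finRange k).foldl
      (fun (μ : PMF (Option (Trace G))) (j : Fin k) => μ.bind fun o =>
        match o with
        | none => PMF.pure none
        | some w => walkRound t η j.val (π j).val w)
      (PMF.pure (some ⟨[], u₀⟩))).bind fun o =>
    match o with
    | none => PMF.pure none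
    | some w =>
        if Conforms π (w.steps.map WalkStep.edge) then
          (coin (acceptProb t η k w)).bind fun keep =>
            PMF.pure (if keep then some (w.steps.map WalkStep.vertex ++ [w.current]) else none)
        else PMF.pure none

/-! ### Generating many walks on the same stream -/

/-- The fraction `η = ε ^ 8 * 2 ^ (-C k)` of the stream used for one step of a walk. -/
def stepFraction (C ε : ℝ) (k : ℕ) : ℝ := ε ^ 8 * (2 : ℝ) ^ (-(C * k))

/-- `SamplesWithReset`: `s` runs of `WalkFromTemplate` on the stream, with independent uniformly
random starting vertices and templates. -/
def samplesWithReset [NeZero n] (C : ℝ) (k : ℕ) (ε : ℝ) (s : ℕ) :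
    PMF (List (Option (List (Fin n)))) :=
  iid ((PMF.uniformOfFintype (Fin n)).bind fun u₀ =>
    (PMF.uniformOfFintype (Template k)).bind fun π =>
      walkFromTemplate t (stepFraction C ε k) u₀ π) s

/-- `SimulateWalks`: the first `N` successful walks among `N * 100 * η⁻ᵏ * k!` runs, or `none` if
fewer than `N` runs succeed. -/
def simulateWalks [NeZero n] (C : ℝ) (k : ℕ) (ε : ℝ) (N : ℕ) :
    PMF (Option (List (List (Fin n)))) :=
  (samplesWithReset t C k ε
    ⌈(N : ℝ) * 100 * (stepFraction C ε k ^ k)⁻¹ * (k.factorial : ℝ)⌉₊).bind fun l =>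
      PMF.pure (if N ≤ l.reduceOption.length then some (l.reduceOption.take N) else none)

/-! ### Estimating PageRank -/

/-- The truncation length `⌈(2 / α) log (1 / ε)⌉`. -/
def walkLength (α ε : ℝ) : ℕ := ⌈2 / α * Real.log (1 / ε)⌉₊

/-- `ApproxPageRank`, run on the graph with timestamps `t`.  With `k` the truncation length and
`b = ⌈D / ε ^ 2⌉`, it generates `b (k + 1)` walks of length `k`, of which the walks
`b j, …, b j + b - 1` form the group `W(j)`, for `j = 0, …, k`.  For every `i < b` it draws
`J` from the geometric law and, if `J ≤ k` and the vertex reached after `J` steps by the `i`-th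
walk of `W(J)` lies in the target set, adds `1 / b` to the estimate. -/
def approxPageRank [NeZero n] (C D α ε : ℝ) (h₀ : 0 < α) (h₁ : α < 1) (inT : Fin n → Bool) :
    PMF (Option ℝ) := by
  classical
  exact
    let k := walkLength α ε
    let b := ⌈D / ε ^ 2⌉₊
    (simulateWalks t C k ε (b * (k + 1))).bind fun o =>
    match o with
    | none => PMF.pure none
    | some walks =>
        (iid (geom α h₀ h₁) b).bind fun Js =>
          PMF.pure (some ((Js.zipIdx.map fun (Ji : ℕ × ℕ) =>
            if Ji.1 ≤ k ∧ ∃ v, walks[b * Ji.1 + Ji.2]?.bind (fun w => w[Ji.1]?) = some v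
                ∧ inT v = true
            then 1 / (b : ℝ) else 0).sum))

end Walk

/-- The random walk transition matrix, acting on column vectors: the entry `(u, v)` is the
probability `1 / d(v)` of a step from `v` to `u`. -/
def transitionMatrix {n : ℕ} (G : SimpleGraph (Fin n)) : Matrix (Fin n) (Fin n) ℝ := by
  classical
  exact Matrix.of fun u v => if G.Adj v u then 1 / (G.degree v : ℝ) else 0

/-- `p = α 𝟙 / n + (1 - α) M p`: the vector `p` is the PageRank vector with reset
probability `α`. -/
def IsPageRank {n : ℕ} (G : SimpleGraph (Fin n)) (α : ℝ) (p : Fin n → ℝ) : Prop :=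
  p = (fun _ => α * (1 / (n : ℝ))) + (1 - α) • (transitionMatrix G).mulVec p

/-- On a graph without isolated vertices the PageRank vector exists and is unique. -/
theorem existsUnique_isPageRank {n : ℕ} (G : SimpleGraph (Fin n)) (hG : ∀ v, ∃ w, G.Adj v w)
    {α : ℝ} (h₀ : 0 < α) (h₁ : α < 1) : ∃! p, IsPageRank G α p := by
  classical
  set M := transitionMatrix G with hM
  have hMe : ∀ u v, M u v = if G.Adj v u then 1 / (G.degree v : ℝ) else 0 := by
    intro u v
    simp only [hM, transitionMatrix, Matrix.of_apply]
  have hnn : ∀ u v, 0 ≤ M u v := by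
    intro u v; rw [hMe]; split_ifs <;> positivity
  have hdiag : ∀ v, M v v = 0 := by intro v; rw [hMe]; simp
  have hsum : ∀ v, ∑ u, M u v = 1 := by
    intro v
    have hd : 0 < G.degree v := (G.degree_pos_iff_exists_adj v).2 (hG v)
    simp_rw [hMe]
    rw [Finset.sum_ite, Finset.sum_const_zero, add_zero, Finset.sum_const, nsmul_eq_mul]
    have : (Finset.univ.filter fun u => G.Adj v u) = G.neighborFinset v := by
      ext u; simp
    rw [this, G.card_neighborFinset_eq_degree]
    field_simp
  have hdet : (1 - (1 - α) • M).det ≠ 0 := by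
    refine det_ne_zero_of_sum_col_lt_diag (fun v => ?_)
    have e1 : ∑ i ∈ Finset.univ.erase v, ‖(1 - (1 - α) • M) i v‖
        = ∑ i ∈ Finset.univ.erase v, (1 - α) * M i v := by
      refine Finset.sum_congr rfl (fun i hi => ?_)
      have hi' : i ≠ v := Finset.ne_of_mem_erase hi
      simp only [Matrix.sub_apply, Matrix.one_apply_ne hi', Matrix.smul_apply, smul_eq_mul,
        zero_sub, norm_neg, Real.norm_eq_abs]
      exact abs_of_nonneg (mul_nonneg (by linarith) (hnn i v))
    have e2 : ∑ i ∈ Finset.univ.erase v, M i v = 1 := by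
      rw [← hsum v]; exact Finset.sum_erase _ (hdiag v)
    rw [e1, ← Finset.mul_sum, e2]
    simp only [Matrix.sub_apply, Matrix.one_apply_eq, Matrix.smul_apply, hdiag, smul_zero,
      sub_zero, norm_one]
    linarith
  have hunit : IsUnit (1 - (1 - α) • M) := by
    rw [Matrix.isUnit_iff_isUnit_det]; exact hdet.isUnit
  have hiff : ∀ p, IsPageRank G α p ↔
      (1 - (1 - α) • M).mulVec p = fun _ => α * (1 / (n : ℝ)) := by
    intro p
    unfold IsPageRank
    rw [Matrix.sub_mulVec, Matrix.one_mulVec, Matrix.smul_mulVec, ← hM]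
    constructor
    · intro h; nth_rewrite 1 [h]; simp
    · intro h; rw [← h]; simp
  simp_rw [hiff]
  exact (Function.Bijective.existsUnique ⟨Matrix.mulVec_injective_iff_isUnit.2 hunit,
    Matrix.mulVec_surjective_iff_isUnit.2 hunit⟩ _)

/-- The probability that the output of `ApproxPageRank` lies in `S`, over the independent uniform
timestamps of the edges (so over the random order of the stream) and over the internal
randomness. -/
def approxPageRankProb {n : ℕ} [NeZero n] (C D α ε : ℝ) (h₀ : 0 < α) (h₁ : α < 1)
    (G : SimpleGraph (Fin n)) (inT : Fin n → Bool) (S : Set (Option ℝ)) : ENNReal := by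
  classical
  exact ∫⁻ t : G.edgeSet → unitInterval,
    (approxPageRank t C D α ε h₀ h₁ inT).toOuterMeasure S

/-- The claim about `ApproxPageRank` (with constants `C`, `D` in the algorithm) on `n`-vertex
graphs without isolated vertices, the number `m` of edges being known.  It is carried out by a
one-pass streaming algorithm with at most
`(1/ε) ^ ((K/α) log (1/ε)) * 2 ^ ((K/α²) log² (1/ε))` words of memory: on a uniformly random order
of the edges (without timestamps) this algorithm has the output law of `ApproxPageRank`.  And for
every graph and every target set, `ApproxPageRank` estimates the PageRank mass of the set up to an
additive `ε` with probability at least `9/10`. -/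
def Guarantee (C D K : ℝ) (n : ℕ) [NeZero n] (α ε : ℝ) (h₀ : 0 < α) (h₁ : α < 1) : Prop :=
  ∀ m : ℕ, ∃ A : StreamAlg n,
    A.UsesAtMostWords
      ((1 / ε) ^ (K * (1 / α * Real.log (1 / ε))) *
        (2 : ℝ) ^ (K * (1 / α ^ 2 * Real.log (1 / ε) ^ 2))) ∧
    ∀ G : SimpleGraph (Fin n), (∀ v, ∃ w, G.Adj v w) → Nat.card G.edgeSet = m →
      ∀ T : Finset (Fin n),
        (∀ S : Set (Option ℝ),
          (A.runRandomOrder G fun v => decide (v ∈ T)).toOuterMeasure S =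
            approxPageRankProb C D α ε h₀ h₁ G (fun v => decide (v ∈ T)) S) ∧
        ∀ p : Fin n → ℝ, IsPageRank G α p →
          9 / 10 ≤ approxPageRankProb C D α ε h₀ h₁ G (fun v => decide (v ∈ T))
            {o | ∃ y, o = some y ∧ |y - ∑ u ∈ T, p u| ≤ ε}

end RandomOrderStream

end

open RandomOrderStream

noncomputable section

namespace RandomOrderStream

open scoped Classical ENNReal

/-! ### Expectations with respect to probability mass functions -/

/-! Timestamps matter only through labels: which of the `k` windows of length `η`, or the remaining
part `[η k, 1]`, contains each edge. The labels are independent, with weights `η` (`k` times) and `1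
- η k`, so every probability over timestamps becomes a finite weighted sum
(`approxPageRankProb_eq`).

Accuracy. Fix the labels. An edge sequence `f` from `u` conforms with exactly one of the `k!`
templates, and the probability that a run returns it is `1/(n k!)` times a product over its steps.
Up to the factor `η ^ k`, this product is the random walk probability of `f` times `matchWeight`,
the indicator that every distinct edge of `f` carries the position of its first occurrence as label,
rescaled to mean 1. The only other distortion is a factor between 1 and `degreeRatio`, caused by the
degree estimates (`HasLabels.runWeight_bounds`). Hence the scaled probability of collecting walks of
a given kind lies between `matchedSum` and a quantity controlled by `overestimate`.

`matchedSum` is unbiased for the random walk average. Two edge-disjoint walks have independent match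
weights. Two independent random walks share an edge with probability at most `2 k ^ 2 / n`, because
from a uniform start the mass at `v` never exceeds `d(v)/n`. As a match weight is at most `η⁻ᵏ`, the
variance is at most `η⁻ᵏ * 2 k ^ 2 / n` (`labelSum_matchedSum_variance_le`). This is small when `k ^
2` is a small multiple of `log n`, which is the content of the hypothesis relating `α`, `ε` and `n`.
The mean of `overestimate` is close to 1, since few edges at a vertex fall outside the last part and
walk edges are always counted (`labelSum_overestimate_le`). Chebyshev and Markov make both errors
small for most label assignments.

For such an assignment, a run succeeds with probability at least `0.98 η ^ k / k!`, so the
prescribed number of runs suffices. Conditional on success, the probability that the walk hits `T`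
at a geometric time is within `ε/8` of PageRank truncated after step `k`, whose truncation error is
at most `ε/2`. The first successes are dominated by independent conditional samples, and a Chernoff
bound over the `b` draws finishes (`expect_estimate_failure_le`).

Streaming. As `m` is known, `m` independent labels can be drawn in advance, sorted, and attached to
the arriving edges. Because the order is uniformly random, this gives independent labels
(`expect_sorted_labels`). Sorted labels are described by `k` cut points. A run needs one reservoir
sample with a counter per round and one tail counter per vertex for the degree estimates
(`HasLabels.initRun_bind`). That is `O(k ^ 2)` words per run, and the number of runs is `D exp(O(k
log (1/ε) + C k ^ 2))`, which is the claimed space. -/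

/-- The expectation of a nonnegative function. -/
def expect {β : Type} (μ : PMF β) (φ : β → ℝ≥0∞) : ℝ≥0∞ := ∑' x, μ x * φ x

section Expect

variable {β γ : Type}

theorem expect_pure (x : β) (φ : β → ℝ≥0∞) : expect (PMF.pure x) φ = φ x := by
  unfold expect
  rw [tsum_eq_single x]
  · simp
  · intro y hy; simp [PMF.pure_apply, hy]

theorem expect_bind (μ : PMF β) (f : β → PMF γ) (φ : γ → ℝ≥0∞) :
    expect (μ.bind f) φ = expect μ fun x => expect (f x) φ := by
  unfold expect
  simp_rw [PMF.bind_apply, ← ENNReal.tsum_mul_right, ← ENNReal.tsum_mul_left]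
  rw [ENNReal.tsum_comm]
  simp_rw [mul_assoc]

theorem expect_mono {μ : PMF β} {φ ψ : β → ℝ≥0∞} (h : ∀ x, φ x ≤ ψ x) :
    expect μ φ ≤ expect μ ψ :=
  ENNReal.tsum_le_tsum fun x => mul_le_mul_right (h x) _

theorem expect_add (μ : PMF β) (φ ψ : β → ℝ≥0∞) :
    expect μ (fun x => φ x + ψ x) = expect μ φ + expect μ ψ := by
  unfold expect
  simp_rw [mul_add]
  exact ENNReal.tsum_add

theorem expect_const_mul (μ : PMF β) (c : ℝ≥0∞) (φ : β → ℝ≥0∞) :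
    expect μ (fun x => c * φ x) = c * expect μ φ := by
  unfold expect
  simp_rw [mul_left_comm _ c]
  exact ENNReal.tsum_mul_left

theorem expect_const (μ : PMF β) (c : ℝ≥0∞) : expect μ (fun _ => c) = c := by
  unfold expect
  rw [ENNReal.tsum_mul_right, μ.tsum_coe, one_mul]

theorem expect_mul_const (μ : PMF β) (c : ℝ≥0∞) (φ : β → ℝ≥0∞) :
    expect μ (fun x => φ x * c) = expect μ φ * c := by
  simp_rw [mul_comm _ c]
  exact expect_const_mul μ c φ

theorem expect_finset_sum {ι : Type} (μ : PMF β) (s : Finset ι) (φ : ι → β → ℝ≥0∞) :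
    expect μ (fun x => ∑ i ∈ s, φ i x) = ∑ i ∈ s, expect μ (φ i) := by
  induction s using Finset.induction_on with
  | empty => simp [expect]
  | insert a s ha ih => simp_rw [Finset.sum_insert ha, expect_add, ih]

theorem expect_eq_sum [Fintype β] (μ : PMF β) (φ : β → ℝ≥0∞) :
    expect μ φ = ∑ x, μ x * φ x := tsum_fintype _

theorem toOuterMeasure_eq_expect (μ : PMF β) (S : Set β) :
    μ.toOuterMeasure S = expect μ fun x => if x ∈ S then 1 else 0 := by
  rw [PMF.toOuterMeasure_apply]
  unfold expect
  refine tsum_congr fun x => ?_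
  by_cases hx : x ∈ S <;> simp [hx]

theorem expect_option (μ : PMF (Option β)) (φ : Option β → ℝ≥0∞) :
    expect μ φ = μ none * φ none + ∑' x, μ (some x) * φ (some x) := by
  unfold expect
  rw [← (Equiv.optionEquivSumPUnit.{0} β).symm.tsum_eq, ENNReal.summable.tsum_sum ENNReal.summable,
    add_comm]
  simp

theorem apply_eq_expect (μ : PMF β) (y : β) : μ y = expect μ fun x => if x = y then 1 else 0 := by
  unfold expect
  rw [tsum_eq_single y]
  · simp
  · intro x hx; simp [hx]

theorem expect_ite_not (μ : PMF β) (p : β → Prop) :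
    expect μ (fun x => if p x then 1 else 0) = 1 - expect μ (fun x => if p x then 0 else 1) := by
  have h : expect μ (fun x => if p x then 1 else 0) + expect μ (fun x => if p x then 0 else 1)
      = 1 := by
    rw [← expect_add]
    refine Eq.trans (congrArg (expect μ) (funext fun x => ?_)) (expect_const μ 1)
    by_cases hx : p x <;> simp [hx]
  refine ENNReal.eq_sub_of_add_eq ?_ h
  exact ne_top_of_le_ne_top ENNReal.one_ne_top (le_of_le_of_eq le_add_self h)

end Expect

/-! ### Independent samples -/

section Iid

variable {β : Type}

theorem expect_iid_succ (μ : PMF β) (s : ℕ) (φ : List β → ℝ≥0∞) :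
    expect (iid μ (s + 1)) φ = expect μ fun x => expect (iid μ s) fun l => φ (x :: l) := by
  simp only [iid, expect_bind, expect_pure]

theorem expect_iid_congr (μ : PMF β) (s : ℕ) {φ ψ : List β → ℝ≥0∞}
    (h : ∀ l, l.length = s → φ l = ψ l) : expect (iid μ s) φ = expect (iid μ s) ψ := by
  induction s generalizing φ ψ with
  | zero => simpa only [iid, expect_pure] using h [] rfl
  | succ s ih =>
    rw [expect_iid_succ, expect_iid_succ]
    congr 1
    funext x
    exact ih fun l hl => h _ (by simp [hl])

/-- Independence factorizes the product. Letting the factors take an `Option` avoids carrying the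
length of `l`; at positions below `N` the argument is always `some`. -/
theorem expect_iid_prod (μ : PMF β) (N : ℕ) (g : ℕ → Option β → ℝ≥0∞) :
    expect (iid μ N) (fun l => ∏ p ∈ Finset.range N, g p l[p]?) =
      ∏ p ∈ Finset.range N, expect μ fun x => g p (some x) := by
  induction N generalizing g with
  | zero => simp [expect_const]
  | succ N ih =>
    rw [expect_iid_succ, Finset.prod_range_succ']
    simp_rw [Finset.prod_range_succ' _ N]
    simp only [List.getElem?_cons_succ, List.getElem?_cons_zero]
    simp_rw [expect_mul_const]
    rw [ih fun p => g (p + 1), expect_const_mul]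

/-- The first `N` successes among independent trials are dominated by independent samples from
the conditional law of a success. -/
theorem expect_first_successes_le (μ : PMF (Option β)) (ν : PMF β) (q : ℝ≥0∞)
    (h : ∀ w, μ (some w) = q * ν w) (s N : ℕ) (Φ : List β → ℝ≥0∞) :
    expect (iid μ s) (fun l => if N ≤ l.reduceOption.length then Φ (l.reduceOption.take N) else 0)
      ≤ expect (iid ν N) Φ := by
  have hsplit : ∀ φ : Option β → ℝ≥0∞,
      expect μ φ = μ none * φ none + q * expect ν fun w => φ (some w) := by
    intro φ
    rw [expect_option]
    unfold expect
    rw [← ENNReal.tsum_mul_left]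
    simp_rw [h, mul_assoc]
  have hone : μ none + q = 1 := by
    have := hsplit fun _ => 1
    rw [expect_const, expect_const] at this
    simpa using this.symm
  induction s generalizing N Φ with
  | zero =>
    cases N with
    | zero => simp [iid, expect_pure]
    | succ N => simp [iid, expect_pure]
  | succ s ih =>
    cases N with
    | zero => simp [iid, expect_pure, expect_const]
    | succ N =>
      rw [expect_iid_succ, hsplit]
      -- A failed trial leaves the task unchanged with one trial fewer; a successful one fixes the
      -- head of the list and leaves `N` successes to collect. Only an inequality results, since
      -- realizations with too few successes contribute 0.
      have h1 := ih (N + 1) Φ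
      have h2 : (expect ν fun w => expect (iid μ s) fun l =>
          if N + 1 ≤ (some w :: l).reduceOption.length then
            Φ ((some w :: l).reduceOption.take (N + 1)) else 0) ≤ expect (iid ν (N + 1)) Φ := by
        rw [expect_iid_succ]
        refine expect_mono fun w => ?_
        have := ih N fun l => Φ (w :: l)
        simpa [List.reduceOption_cons_of_some] using this
      calc _ ≤ μ none * expect (iid ν (N + 1)) Φ + q * expect (iid ν (N + 1)) Φ :=
            add_le_add (mul_le_mul_right (by simpa using h1) _) (mul_le_mul_right h2 _)
        _ = expect (iid ν (N + 1)) Φ := by rw [← add_mul, hone, one_mul]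

/-- The probability generating function of the number of successes, evaluated at `1/2`; it feeds the
lower tail bound below. -/
theorem expect_half_pow_successes (μ : PMF (Option β)) (s : ℕ) :
    expect (iid μ s) (fun l => (2⁻¹ : ℝ≥0∞) ^ l.reduceOption.length) =
      (expect μ fun o => if o.isSome then 2⁻¹ else 1) ^ s := by
  induction s with
  | zero => simp [iid, expect_pure]
  | succ s ih =>
    rw [expect_iid_succ, pow_succ', ← ih, ← expect_mul_const]
    congr 1
    funext o
    cases o with
    | none => simp
    | some w =>
      simp only [List.reduceOption_cons_of_some, List.length_cons, pow_succ', expect_const_mul,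
        Option.isSome_some, if_true]

/-- Too few successes are unlikely. -/
theorem expect_few_successes_le (μ : PMF (Option β)) (s N : ℕ) {q : ℝ} (hq : q ≤ 1) (hq0 : 0 ≤ q)
    (h : ENNReal.ofReal q ≤ expect μ fun o => if o.isSome then 1 else 0) :
    expect (iid μ s) (fun l => if N ≤ l.reduceOption.length then 0 else 1) ≤
      ENNReal.ofReal (2 ^ N * Real.exp (-(s * q / 2))) := by
  -- Exponential Markov inequality: fewer than `N` successes forces `2 ^ N * 2⁻¹ ^ (successes)` to
  -- be at least 1.
  have h1 : ∀ l : List (Option β), (if N ≤ l.reduceOption.length then (0 : ℝ≥0∞) else 1) ≤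
      2 ^ N * (2⁻¹ : ℝ≥0∞) ^ l.reduceOption.length := by
    intro l
    split_ifs with hl
    · exact zero_le
    · push Not at hl
      calc (1 : ℝ≥0∞) = 2 ^ N * (2⁻¹) ^ N := by
            rw [← mul_pow, ENNReal.mul_inv_cancel (by norm_num) (by norm_num), one_pow]
        _ ≤ _ := mul_le_mul_right (pow_le_pow_of_le_one zero_le (by simp) hl.le) _
  have h2 : (expect μ fun o => if o.isSome then (2⁻¹ : ℝ≥0∞) else 1) ≤
      ENNReal.ofReal (1 - q / 2) := by
    have e : expect μ (fun o => if o.isSome then (2⁻¹ : ℝ≥0∞) else 1)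
        + 2⁻¹ * expect μ (fun o => if o.isSome then 1 else 0) = 1 := by
      rw [← expect_const_mul, ← expect_add]
      refine Eq.trans (congrArg (expect μ) (funext fun o => ?_)) (expect_const μ 1)
      cases o <;> simp [ENNReal.inv_two_add_inv_two]
    have e2 : expect μ (fun o => if o.isSome then (2⁻¹ : ℝ≥0∞) else 1)
        + 2⁻¹ * ENNReal.ofReal q ≤ 1 :=
      le_of_le_of_eq (add_le_add_right (mul_le_mul_right h _) _) e
    have e3 : (2⁻¹ : ℝ≥0∞) * ENNReal.ofReal q = ENNReal.ofReal (q / 2) := by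
      rw [div_eq_inv_mul, ENNReal.ofReal_mul (by norm_num), ENNReal.ofReal_inv_of_pos (by norm_num)]
      simp
    rw [e3] at e2
    rw [ENNReal.ofReal_sub _ (by linarith), ENNReal.ofReal_one]
    exact ENNReal.le_sub_of_add_le_right ENNReal.ofReal_ne_top e2
  calc _ ≤ expect (iid μ s) (fun l => 2 ^ N * (2⁻¹ : ℝ≥0∞) ^ l.reduceOption.length) :=
        expect_mono h1
    _ = 2 ^ N * (expect μ fun o => if o.isSome then (2⁻¹ : ℝ≥0∞) else 1) ^ s := by
        rw [expect_const_mul, expect_half_pow_successes]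
    _ ≤ 2 ^ N * ENNReal.ofReal (1 - q / 2) ^ s := by gcongr
    _ ≤ _ := by
        rw [← ENNReal.ofReal_pow (by linarith), ENNReal.ofReal_mul (by positivity),
          ENNReal.ofReal_pow (by norm_num) N]
        simp only [ENNReal.ofReal_ofNat]
        gcongr
        calc (1 - q / 2) ^ s ≤ Real.exp (-(q / 2)) ^ s :=
              pow_le_pow_left₀ (by linarith) (by linarith [Real.add_one_le_exp (-(q / 2))]) s
          _ = _ := by rw [← Real.exp_nat_mul]; ring_nf

end Iid

/-! ### Estimating a probability from groups of samples -/

section Sampling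

variable {β : Type}

/-- Draw `i` with index `j ≤ k` looks at position `b * j + i`, so different draws look at different
positions. Writing the product over positions `p`, with `j = p / b` and `i = p % b`, lets
`expect_iid_prod` apply; indices beyond `k` have no group and stay in the second factor. -/
theorem prod_group_eq (b k : ℕ) (J : ℕ → ℕ) (H : ℕ → ℕ → ℝ≥0∞) :
    ∏ i ∈ Finset.range b, H (J i) (b * J i + i) =
      (∏ p ∈ Finset.range (b * (k + 1)), if J (p % b) = p / b then H (p / b) p else 1) *
        ∏ i ∈ Finset.range b, if k < J i then H (J i) (b * J i + i) else 1 := by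
  have key : ∀ k : ℕ,
      (∏ p ∈ Finset.range (b * k), if J (p % b) = p / b then H (p / b) p else 1) =
        ∏ i ∈ Finset.range b, if J i < k then H (J i) (b * J i + i) else 1 := by
    intro k
    induction k with
    | zero => simp
    | succ k ih =>
      rw [Nat.mul_succ, Finset.prod_range_add, ih, ← Finset.prod_mul_distrib]
      refine Finset.prod_congr rfl fun i hi => ?_
      have hi' : i < b := Finset.mem_range.1 hi
      have e1 : (b * k + i) % b = i := by rw [Nat.mul_add_mod, Nat.mod_eq_of_lt hi']
      have e2 : (b * k + i) / b = k := by
        rw [Nat.mul_add_div (by omega), Nat.div_eq_of_lt hi', add_zero]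
      rw [e1, e2]
      rcases lt_trichotomy (J i) k with h | h | h
      · simp [h, h.ne, Nat.lt_succ_of_lt h]
      · simp [h]
      · simp [h.ne', h.not_gt, show ¬ J i < k + 1 by omega]
  rw [key, ← Finset.prod_mul_distrib]
  refine Finset.prod_congr rfl fun i _ => ?_
  by_cases h : J i < k + 1
  · simp [h, show ¬ k < J i by omega]
  · simp [h, show k < J i by omega]

/-- For fixed indices the `b` picks read distinct, hence independent, samples. The resulting product
has one factor per index, so averaging over the independent indices factorizes again. -/
theorem expect_groups (ν : PMF β) (γ : PMF ℕ) (b k : ℕ) (h : ℕ → Option β → ℝ≥0∞)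
    (hk : ∀ j, k < j → ∀ o, h j o = 1) :
    expect (iid ν (b * (k + 1))) (fun W => expect (iid γ b) fun Js =>
      ∏ i ∈ Finset.range b, h (Js.getD i 0) W[b * Js.getD i 0 + i]?) =
      (expect γ fun j => expect ν fun w => h j (some w)) ^ b := by
  have swap : expect (iid ν (b * (k + 1))) (fun W => expect (iid γ b) fun Js =>
      ∏ i ∈ Finset.range b, h (Js.getD i 0) W[b * Js.getD i 0 + i]?) =
      expect (iid γ b) fun Js => expect (iid ν (b * (k + 1))) fun W =>
        ∏ i ∈ Finset.range b, h (Js.getD i 0) W[b * Js.getD i 0 + i]? := by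
    unfold expect
    simp_rw [← ENNReal.tsum_mul_left]
    rw [ENNReal.tsum_comm]
    simp_rw [mul_left_comm]
  have fixed : ∀ J : ℕ → ℕ, expect (iid ν (b * (k + 1))) (fun W =>
        ∏ i ∈ Finset.range b, h (J i) W[b * J i + i]?) =
      ∏ i ∈ Finset.range b, expect ν fun w => h (J i) (some w) := by
    intro J
    rw [prod_group_eq b k J fun j _ => expect ν fun w => h j (some w)]
    simp_rw [fun W : List β => prod_group_eq b k J fun j p => h j W[p]?]
    rw [Finset.prod_eq_one (s := Finset.range b) (f := fun i => if k < J i then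
      expect ν (fun w => h (J i) (some w)) else 1)]
    · simp_rw [fun W : List β => Finset.prod_eq_one (s := Finset.range b)
        (f := fun i => if k < J i then h (J i) W[b * J i + i]? else 1) (by
          intro i _; split_ifs with hh
          · exact hk _ hh _
          · rfl), mul_one]
      rw [expect_iid_prod ν _ fun p o => if J (p % b) = p / b then h (p / b) o else 1]
      refine Finset.prod_congr rfl fun p _ => ?_
      split_ifs
      · rfl
      · rw [expect_const]
    · intro i _
      split_ifs with hh
      · simp_rw [hk _ hh, expect_const]
      · rfl
  rw [swap]
  simp_rw [fun Js : List ℕ => fixed fun i => Js.getD i 0]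
  have := expect_iid_prod γ b fun _ o => expect ν fun w => h (o.getD 0) (some w)
  simp only [Option.getD_some, Finset.prod_const, Finset.card_range] at this
  simpa [List.getD_eq_getElem?_getD] using this

theorem sum_zipIdx_eq {M : Type} [AddCommMonoid M] (Js : List ℕ) (F : ℕ → ℕ → M) :
    (Js.zipIdx.map fun Ji : ℕ × ℕ => F Ji.1 Ji.2).sum =
      ∑ i ∈ Finset.range Js.length, F (Js.getD i 0) i := by
  induction Js using List.reverseRecOn with
  | nil => simp
  | append_singleton l a ih =>
    rw [List.zipIdx_append, List.map_append, List.sum_append, ih, List.length_append,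
      List.length_singleton, Finset.sum_range_succ]
    congr 1
    · refine Finset.sum_congr rfl fun i hi => ?_
      rw [List.getD_append _ _ _ _ (Finset.mem_range.1 hi)]
    · simp

/-- Positive `l` gives the upper tail and negative `l` the lower one. The input is `exp l ≤ 1 + l +
l ^ 2` for `|l| ≤ 1`. -/
theorem chernoff_bound {θ l τ : ℝ} {b : ℕ} (hθ0 : 0 ≤ θ) (hθ1 : θ ≤ 1) (hl : |l| ≤ 1) :
    Real.exp (-(b * (l * θ + |l| * τ))) * (Real.exp l * θ + (1 - θ)) ^ b ≤
      Real.exp (b * (l ^ 2 - |l| * τ)) := by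
  have h1 : Real.exp l ≤ 1 + l + l ^ 2 := by
    have := (abs_le.1 (Real.abs_exp_sub_one_sub_id_le hl)).2
    linarith
  have h2 : Real.exp l * θ + (1 - θ) ≤ Real.exp (l * θ + l ^ 2) := by
    have := Real.add_one_le_exp (l * θ + l ^ 2)
    nlinarith [mul_le_mul_of_nonneg_right h1 hθ0, sq_nonneg l]
  have h3 : 0 ≤ Real.exp l * θ + (1 - θ) := add_nonneg (by positivity) (by linarith)
  calc _ ≤ Real.exp (-(b * (l * θ + |l| * τ))) * Real.exp (l * θ + l ^ 2) ^ b := by gcongr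
    _ = _ := by rw [← Real.exp_nat_mul, ← Real.exp_add]; ring_nf

/-- The fraction of the groups in which the sample picked by a random index is a hit is close to
the probability of a hit. -/
theorem expect_sampling_error_le (ν : PMF β) (γ : PMF ℕ) {b : ℕ} (k : ℕ) (hb : 0 < b)
    (A : ℕ → Option β → Prop) (hA : ∀ j, k < j → ∀ o, ¬ A j o) {θ τ : ℝ} (hθ0 : 0 ≤ θ)
    (hθ1 : θ ≤ 1) (hτ0 : 0 < τ) (hτ1 : τ ≤ 1)
    (hθ : (expect γ fun j => expect ν fun w => if A j (some w) then 1 else 0) = ENNReal.ofReal θ) :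
    (expect (iid ν (b * (k + 1))) fun W => expect (iid γ b) fun Js =>
      if τ < |(Js.zipIdx.map fun Ji : ℕ × ℕ =>
        if A Ji.1 W[b * Ji.1 + Ji.2]? then 1 / (b : ℝ) else 0).sum - θ| then 1 else 0) ≤
      ENNReal.ofReal (2 * Real.exp (-(b * τ ^ 2 / 4))) := by
  have hb' : (0 : ℝ) < b := by exact_mod_cast hb
  have mgf : ∀ l : ℝ, (expect (iid ν (b * (k + 1))) fun W => expect (iid γ b) fun Js =>
      ∏ i ∈ Finset.range b, if A (Js.getD i 0) W[b * Js.getD i 0 + i]? then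
        ENNReal.ofReal (Real.exp l) else 1) =
      ENNReal.ofReal ((Real.exp l * θ + (1 - θ)) ^ b) := by
    intro l
    rw [expect_groups ν γ b k (fun j o => if A j o then ENNReal.ofReal (Real.exp l) else 1)
      fun j hj o => if_neg (hA j hj o),
      ENNReal.ofReal_pow (add_nonneg (by positivity) (by linarith))]
    congr 1
    have e1 : (expect γ fun j => expect ν fun w => if A j (some w) then (0 : ℝ≥0∞) else 1) =
        ENNReal.ofReal (1 - θ) := by
      have h1 : (expect γ fun j => expect ν fun w => if A j (some w) then (0 : ℝ≥0∞) else 1) +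
          ENNReal.ofReal θ = 1 := by
        rw [← hθ, ← expect_add]
        simp_rw [← expect_add]
        refine Eq.trans (congrArg (expect γ) (funext fun j => ?_)) (expect_const γ 1)
        refine Eq.trans (congrArg (expect ν) (funext fun w => ?_)) (expect_const ν 1)
        split_ifs <;> simp
      rw [ENNReal.ofReal_sub _ hθ0, ENNReal.ofReal_one]
      exact ENNReal.eq_sub_of_add_eq ENNReal.ofReal_ne_top h1
    rw [ENNReal.ofReal_add (by positivity) (by linarith), ENNReal.ofReal_mul (by positivity), ← hθ,
      ← e1, ← expect_const_mul, ← expect_add]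
    congr 1
    funext j
    rw [← expect_const_mul, ← expect_add]
    congr 1
    funext w
    split_ifs <;> simp
  -- The choice `|l| = τ / 2` minimizes `l ^ 2 - |l| τ`, with value `-τ ^ 2 / 4`.
  have tail : ∀ l : ℝ, |l| = τ / 2 → (expect (iid ν (b * (k + 1))) fun W =>
      expect (iid γ b) fun Js => ENNReal.ofReal (Real.exp (-(b * (l * θ + |l| * τ)))) *
        ∏ i ∈ Finset.range b, if A (Js.getD i 0) W[b * Js.getD i 0 + i]? then
        ENNReal.ofReal (Real.exp l) else 1) ≤ ENNReal.ofReal (Real.exp (-(b * τ ^ 2 / 4))) := by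
    intro l hl
    simp_rw [expect_const_mul]
    rw [mgf, ← ENNReal.ofReal_mul (by positivity)]
    refine ENNReal.ofReal_le_ofReal ((chernoff_bound hθ0 hθ1 (by linarith)).trans ?_)
    rw [← sq_abs l, hl]
    exact Real.exp_le_exp.2 (by nlinarith)
  have hsum := add_le_add (tail (τ / 2) (abs_of_pos (by linarith)))
    (tail (-(τ / 2)) (by rw [abs_neg]; exact abs_of_pos (by linarith)))
  rw [← expect_add, ← ENNReal.ofReal_add (by positivity) (by positivity), ← two_mul] at hsum
  simp_rw [← expect_add] at hsum
  refine le_trans (expect_mono fun W => ?_) hsum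
  have hc : ∀ Js : List ℕ, Js.length = b →
      (if τ < |(Js.zipIdx.map fun Ji : ℕ × ℕ =>
        if A Ji.1 W[b * Ji.1 + Ji.2]? then 1 / (b : ℝ) else 0).sum - θ| then 1 else 0) =
      if τ < |(∑ i ∈ Finset.range b, if A (Js.getD i 0) W[b * Js.getD i 0 + i]? then
        (1 : ℝ) else 0) / b - θ| then (1 : ℝ≥0∞) else 0 := by
    intro Js hJs
    rw [sum_zipIdx_eq Js fun j i => if A j W[b * j + i]? then 1 / (b : ℝ) else 0, hJs,
      Finset.sum_div]
    have : ∀ i, (if A (Js.getD i 0) W[b * Js.getD i 0 + i]? then 1 / (b : ℝ) else 0) =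
        (if A (Js.getD i 0) W[b * Js.getD i 0 + i]? then (1 : ℝ) else 0) / b := by
      intro i; split_ifs <;> simp
    simp_rw [this]
  rw [expect_iid_congr γ b hc]
  refine expect_mono fun Js => ?_
  have hprod : ∀ l : ℝ, (∏ i ∈ Finset.range b, if A (Js.getD i 0) W[b * Js.getD i 0 + i]? then
        ENNReal.ofReal (Real.exp l) else 1) = ENNReal.ofReal (Real.exp (l *
        ∑ i ∈ Finset.range b, if A (Js.getD i 0) W[b * Js.getD i 0 + i]? then (1 : ℝ) else 0)) := by
    intro l
    rw [Finset.mul_sum, Real.exp_sum, ENNReal.ofReal_prod_of_nonneg fun _ _ => (Real.exp_pos _).le]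
    refine Finset.prod_congr rfl fun i _ => ?_
    split_ifs <;> simp
  rw [hprod, hprod, ← ENNReal.ofReal_mul (Real.exp_pos _).le,
    ← ENNReal.ofReal_mul (Real.exp_pos _).le, ← Real.exp_add, ← Real.exp_add]
  set X := ∑ i ∈ Finset.range b, if A (Js.getD i 0) W[b * Js.getD i 0 + i]? then
    (1 : ℝ) else 0
  rw [abs_neg, abs_of_pos (show 0 < τ / 2 by linarith)]
  split_ifs with h
  · have hone : ∀ x : ℝ, 0 ≤ x → 1 ≤ ENNReal.ofReal (Real.exp x) := fun x hx => by
      rw [← ENNReal.ofReal_one]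
      exact ENNReal.ofReal_le_ofReal (Real.one_le_exp hx)
    -- A deviation beyond `τ` makes one of the two exponentials at least 1, according to its sign.
    rcases lt_abs.1 h with h | h
    · refine (hone _ ?_).trans le_self_add
      have : b * (τ + θ) < X := by
        rw [← lt_div_iff₀' hb']; linarith
      nlinarith
    · refine (hone _ ?_).trans le_add_self
      have : X < b * (θ - τ) := by
        rw [← div_lt_iff₀' hb']; linarith
      nlinarith
  · exact zero_le

end Sampling

/-! ### The random walk -/

section RandomWalk

variable {n : ℕ} {G : SimpleGraph (Fin n)}

theorem mk_otherEnd {e : Sym2 (Fin n)} {u : Fin n} (h : u ∈ e) : s(u, otherEnd e u) = e := by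
  unfold otherEnd
  rw [dif_pos h]
  exact Sym2.other_spec h

/-- The vertices visited by a walk that starts at `u` and traverses the edges `f`. -/
def vtx {k : ℕ} (u : Fin n) (f : Fin k → G.edgeSet) : Fin (k + 1) → Fin n :=
  Fin.induction (motive := fun _ => Fin n) u fun j v => otherEnd (f j : Sym2 (Fin n)) v

@[simp] theorem vtx_zero {k : ℕ} (u : Fin n) (f : Fin k → G.edgeSet) : vtx u f 0 = u := rfl

@[simp] theorem vtx_succ {k : ℕ} (u : Fin n) (f : Fin k → G.edgeSet) (j : Fin k) :
    vtx u f j.succ = otherEnd (f j : Sym2 (Fin n)) (vtx u f j.castSucc) := by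
  unfold vtx
  exact Fin.induction_succ _ _ _

theorem vtx_snoc_castSucc {k : ℕ} (u : Fin n) (f : Fin k → G.edgeSet) (e : G.edgeSet)
    (j : Fin (k + 1)) :
    vtx u (Fin.snoc f e : Fin (k + 1) → G.edgeSet) j.castSucc = vtx u f j := by
  induction j using Fin.induction with
  | zero => rfl
  | succ i ih =>
    rw [← Fin.succ_castSucc, vtx_succ, vtx_succ, ih, Fin.snoc_castSucc]

theorem vtx_snoc_last {k : ℕ} (u : Fin n) (f : Fin k → G.edgeSet) (e : G.edgeSet) :
    vtx u (Fin.snoc f e : Fin (k + 1) → G.edgeSet) (Fin.last (k + 1)) =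
      otherEnd (e : Sym2 (Fin n)) (vtx u f (Fin.last k)) := by
  rw [← Fin.succ_last, vtx_succ, vtx_snoc_castSucc, Fin.snoc_last]

theorem sum_snoc {k : ℕ} {E M : Type} [Fintype E] [AddCommMonoid M]
    (φ : (Fin (k + 1) → E) → M) :
    ∑ f, φ f = ∑ f : Fin k → E, ∑ e, φ (Fin.snoc f e) := by
  rw [← (Fin.snocEquiv fun _ : Fin (k + 1) => E).sum_comp, Fintype.sum_prod_type,
    Finset.sum_comm]
  rfl

/-- The probability that the random walk at `u` traverses the edge `e`. -/
def stepProb (u : Fin n) (e : G.edgeSet) : ℝ :=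
  if u ∈ (e : Sym2 (Fin n)) then 1 / (G.degree u : ℝ) else 0

theorem stepProb_nonneg (u : Fin n) (e : G.edgeSet) : 0 ≤ stepProb u e := by
  unfold stepProb
  split_ifs <;> positivity

theorem sum_incident (u : Fin n) (g : Fin n → ℝ) :
    ∑ e : G.edgeSet, (if u ∈ (e : Sym2 (Fin n)) then g (otherEnd e u) else 0) =
      ∑ v, if G.Adj u v then g v else 0 := by
  rw [← Finset.sum_filter, ← Finset.sum_filter]
  refine Finset.sum_bij (fun e _ => otherEnd (e : Sym2 (Fin n)) u) ?_ ?_ ?_ fun _ _ => rfl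
  · intro e he
    have h := mk_otherEnd (Finset.mem_filter.1 he).2
    simp only [Finset.mem_filter, Finset.mem_univ, true_and]
    rw [← SimpleGraph.mem_edgeSet, h]
    exact e.2
  · intro e he e' he' h
    have h1 := mk_otherEnd (Finset.mem_filter.1 he).2
    have h2 := mk_otherEnd (Finset.mem_filter.1 he').2
    rw [h] at h1
    exact Subtype.ext (h1.symm.trans h2)
  · intro v hv
    have hv' : G.Adj u v := (Finset.mem_filter.1 hv).2
    refine ⟨⟨s(u, v), hv'⟩, by simp, ?_⟩
    have h := mk_otherEnd (e := s(u, v)) (u := u) (by simp)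
    rcases Sym2.eq_iff.1 h with h | h
    · exact h.2
    · exact absurd h.1 hv'.ne

theorem card_incident (u : Fin n) :
    (Finset.univ.filter fun e : G.edgeSet => u ∈ (e : Sym2 (Fin n))).card = G.degree u := by
  have h := sum_incident (G := G) u fun _ => 1
  rw [← Finset.sum_filter, ← Finset.sum_filter, Finset.sum_const, Finset.sum_const] at h
  simp only [nsmul_eq_mul, mul_one, Nat.cast_inj] at h
  rw [h, ← SimpleGraph.card_neighborFinset_eq_degree]
  congr 1
  ext v
  simp

theorem sum_stepProb_mul (u : Fin n) (g : Fin n → ℝ) :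
    ∑ e : G.edgeSet, stepProb u e * g (otherEnd e u) = ∑ v, transitionMatrix G v u * g v := by
  have h := sum_incident (G := G) u fun v => 1 / (G.degree u : ℝ) * g v
  calc _ = ∑ e : G.edgeSet, (if u ∈ (e : Sym2 (Fin n)) then
        1 / (G.degree u : ℝ) * g (otherEnd e u) else 0) := by
        refine Finset.sum_congr rfl fun e _ => ?_
        unfold stepProb
        split_ifs <;> simp
    _ = _ := by
        rw [h]
        refine Finset.sum_congr rfl fun v _ => ?_
        simp only [transitionMatrix, Matrix.of_apply]
        split_ifs <;> simp

theorem sum_stepProb {u : Fin n} (hu : ∃ w, G.Adj u w) : ∑ e : G.edgeSet, stepProb u e = 1 := by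
  have hd : 0 < G.degree u := (G.degree_pos_iff_exists_adj u).2 hu
  unfold stepProb
  rw [← Finset.sum_filter, Finset.sum_const, card_incident, nsmul_eq_mul]
  field_simp

/-- The probability that the random walk starting at a uniformly random vertex starts at `u` and
traverses the edges `f`. -/
def walkProb {k : ℕ} (u : Fin n) (f : Fin k → G.edgeSet) : ℝ :=
  1 / (n : ℝ) * ∏ j, stepProb (vtx u f j.castSucc) (f j)

theorem walkProb_nonneg {k : ℕ} (u : Fin n) (f : Fin k → G.edgeSet) : 0 ≤ walkProb u f :=
  mul_nonneg (by positivity) (Finset.prod_nonneg fun _ _ => stepProb_nonneg _ _)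

theorem walkProb_snoc {k : ℕ} (u : Fin n) (f : Fin k → G.edgeSet) (e : G.edgeSet) :
    walkProb u (Fin.snoc f e : Fin (k + 1) → G.edgeSet) =
      walkProb u f * stepProb (vtx u f (Fin.last k)) e := by
  unfold walkProb
  rw [Fin.prod_univ_castSucc]
  simp only [vtx_snoc_castSucc, Fin.snoc_castSucc, Fin.snoc_last]
  rw [mul_assoc]

/-- The expectation over the `k`-step random walk starting at a uniformly random vertex. -/
def walkSum (k : ℕ) (φ : Fin n → (Fin k → G.edgeSet) → ℝ) : ℝ :=
  ∑ u, ∑ f, walkProb u f * φ u f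

theorem walkSum_succ (k : ℕ) (φ : Fin n → (Fin (k + 1) → G.edgeSet) → ℝ) :
    walkSum (k + 1) φ = walkSum k fun u f =>
      ∑ e, stepProb (vtx u f (Fin.last k)) e * φ u (Fin.snoc f e) := by
  unfold walkSum
  refine Finset.sum_congr rfl fun u _ => ?_
  rw [sum_snoc]
  refine Finset.sum_congr rfl fun f _ => ?_
  rw [Finset.mul_sum]
  refine Finset.sum_congr rfl fun e _ => ?_
  rw [walkProb_snoc, mul_assoc]

theorem walkSum_mono {k : ℕ} {φ ψ : Fin n → (Fin k → G.edgeSet) → ℝ} (h : ∀ u f, φ u f ≤ ψ u f) :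
    walkSum k φ ≤ walkSum k ψ :=
  Finset.sum_le_sum fun _ _ => Finset.sum_le_sum fun _ _ =>
    mul_le_mul_of_nonneg_left (h _ _) (walkProb_nonneg _ _)

theorem walkSum_nonneg {k : ℕ} {φ : Fin n → (Fin k → G.edgeSet) → ℝ} (h : ∀ u f, 0 ≤ φ u f) :
    0 ≤ walkSum k φ :=
  Finset.sum_nonneg fun _ _ => Finset.sum_nonneg fun _ _ => mul_nonneg (walkProb_nonneg _ _) (h _ _)

theorem walkSum_add {k : ℕ} (φ ψ : Fin n → (Fin k → G.edgeSet) → ℝ) :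
    walkSum k (fun u f => φ u f + ψ u f) = walkSum k φ + walkSum k ψ := by
  unfold walkSum
  simp only [mul_add, Finset.sum_add_distrib]

theorem walkSum_const_mul {k : ℕ} (c : ℝ) (φ : Fin n → (Fin k → G.edgeSet) → ℝ) :
    walkSum k (fun u f => c * φ u f) = c * walkSum k φ := by
  unfold walkSum
  simp only [Finset.mul_sum, mul_left_comm c]

theorem walkSum_finset_sum {k : ℕ} {ι : Type} (s : Finset ι)
    (φ : ι → Fin n → (Fin k → G.edgeSet) → ℝ) :
    walkSum k (fun u f => ∑ i ∈ s, φ i u f) = ∑ i ∈ s, walkSum k (φ i) := by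
  induction s using Finset.induction_on with
  | empty => simp [walkSum]
  | insert a s ha ih => simp_rw [Finset.sum_insert ha, walkSum_add, ih]

/-- The law of the random walk after `j` steps, starting at a uniformly random vertex. -/
def occupation (G : SimpleGraph (Fin n)) (j : ℕ) : Fin n → ℝ :=
  (transitionMatrix G ^ j).mulVec fun _ => 1 / (n : ℝ)

theorem occupation_succ (j : ℕ) (v : Fin n) :
    occupation G (j + 1) v = ∑ u, transitionMatrix G v u * occupation G j u := by
  unfold occupation
  rw [pow_succ', ← Matrix.mulVec_mulVec]
  rfl

theorem walkSum_vtx_last (k : ℕ) (g : Fin n → ℝ) :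
    (walkSum k fun u (f : Fin k → G.edgeSet) => g (vtx u f (Fin.last k))) =
      ∑ v, occupation G k v * g v := by
  induction k generalizing g with
  | zero =>
    simp only [walkSum, occupation, walkProb, pow_zero, Matrix.one_mulVec]
    refine Finset.sum_congr rfl fun u _ => ?_
    simp
  | succ k ih =>
    rw [walkSum_succ]
    simp_rw [vtx_snoc_last, sum_stepProb_mul]
    rw [ih fun u => ∑ v, transitionMatrix G v u * g v]
    simp_rw [Finset.mul_sum, occupation_succ, Finset.sum_mul]
    rw [Finset.sum_comm]
    refine Finset.sum_congr rfl fun u _ => Finset.sum_congr rfl fun v _ => by ring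

variable (hG : ∀ v, ∃ w, G.Adj v w)
include hG

/-- The steps after time `j` sum to probability one, because no vertex is isolated. -/
theorem walkSum_vtx {k : ℕ} (j : Fin (k + 1)) (g : Fin n → ℝ) :
    (walkSum k fun u (f : Fin k → G.edgeSet) => g (vtx u f j)) =
      ∑ v, occupation G j v * g v := by
  induction k with
  | zero =>
    obtain rfl : j = Fin.last 0 := Fin.ext (by omega)
    exact walkSum_vtx_last 0 g
  | succ k ih =>
    induction j using Fin.lastCases with
    | last => exact walkSum_vtx_last _ g
    | cast i =>
      rw [walkSum_succ]
      simp_rw [vtx_snoc_castSucc, ← Finset.sum_mul, sum_stepProb (hG _), one_mul]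
      exact ih i

theorem walkSum_one [NeZero n] (k : ℕ) : walkSum k (fun _ (_ : Fin k → G.edgeSet) => 1) = 1 := by
  have h := walkSum_vtx hG (0 : Fin (k + 1)) fun _ => 1
  rw [h]
  simp [occupation, NeZero.ne n]

/-- The measure `d(v)/n` is invariant: mass `d(u)/n` at `u` sends exactly `1/n` along each of its
edges. It dominates the uniform start because every degree is at least 1, and domination is
preserved by each step. -/
theorem occupation_le (j : ℕ) (v : Fin n) : occupation G j v ≤ G.degree v / n := by
  have hd : ∀ v, (1 : ℝ) ≤ G.degree v := fun v => by
    exact_mod_cast (G.degree_pos_iff_exists_adj v).2 (hG v)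
  induction j generalizing v with
  | zero =>
    simp only [occupation, pow_zero, Matrix.one_mulVec]
    exact div_le_div_of_nonneg_right (hd v) (by positivity)
  | succ j ih =>
    rw [occupation_succ]
    calc ∑ u, transitionMatrix G v u * occupation G j u
        ≤ ∑ u, if G.Adj v u then 1 / (n : ℝ) else 0 := by
          refine Finset.sum_le_sum fun u _ => ?_
          simp only [transitionMatrix, Matrix.of_apply, G.adj_comm u v]
          split_ifs
          · calc _ ≤ 1 / (G.degree u : ℝ) * (G.degree u / n) :=
                  mul_le_mul_of_nonneg_left (ih u) (by positivity)
              _ = 1 / (n : ℝ) := by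
                  have := (zero_lt_one.trans_le (hd u)).ne'
                  field_simp
          · simp
      _ = G.degree v / n := by
          rw [← Finset.sum_filter, Finset.sum_const, ← SimpleGraph.card_neighborFinset_eq_degree,
            nsmul_eq_mul, mul_one_div]
          congr 3
          ext u
          simp

/-- Each of the two endpoints `v` of `e` carries mass at most `d(v)/n` and sends a fraction `1/d(v)`
of it along `e`. -/
theorem walkSum_edge_le {k : ℕ} (j : Fin k) (e : G.edgeSet) :
    (walkSum k fun _ (f : Fin k → G.edgeSet) => if f j = e then 1 else 0) ≤ 2 / n := by
  induction k with
  | zero => exact j.elim0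
  | succ k ih =>
    rw [walkSum_succ]
    induction j using Fin.lastCases with
    | cast i =>
      simp_rw [Fin.snoc_castSucc, ← Finset.sum_mul, sum_stepProb (hG _), one_mul]
      exact ih i
    | last =>
      simp_rw [Fin.snoc_last, mul_ite, mul_one, mul_zero, Finset.sum_ite_eq' Finset.univ,
        Finset.mem_univ, if_true]
      rw [walkSum_vtx_last k fun v => stepProb v e]
      calc _ ≤ ∑ v, if v ∈ (e : Sym2 (Fin n)) then 1 / (n : ℝ) else 0 := by
            refine Finset.sum_le_sum fun v _ => ?_
            unfold stepProb
            split_ifs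
            · have hd : (0 : ℝ) < G.degree v := by
                exact_mod_cast (G.degree_pos_iff_exists_adj v).2 (hG v)
              calc _ ≤ (G.degree v / n : ℝ) * (1 / G.degree v) :=
                    mul_le_mul_of_nonneg_right (occupation_le hG k v) (by positivity)
                _ = _ := by field_simp
            · simp
        _ ≤ _ := by
            rw [← Finset.sum_filter, Finset.sum_const, nsmul_eq_mul, mul_one_div]
            refine div_le_div_of_nonneg_right ?_ (by positivity)
            have : (Finset.univ.filter fun v => v ∈ (e : Sym2 (Fin n))).card ≤ 2 := by
              obtain ⟨e, he⟩ := e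
              induction e using Sym2.ind with
              | _ a b =>
                refine le_trans (Finset.card_le_card (t := {a, b}) ?_) Finset.card_le_two
                intro v hv
                simpa using hv
            exact_mod_cast this

/-- Two independent random walks rarely share an edge. -/
theorem walkSum_share_edge_le [NeZero n] (k : ℕ) :
    (walkSum k fun _ (f : Fin k → G.edgeSet) => walkSum k fun _ (f' : Fin k → G.edgeSet) =>
      if ∃ i j, f i = f' j then 1 else 0) ≤ 2 * k ^ 2 / n := by
  -- The bound holds for every fixed first walk, by a union bound over the `k ^ 2` pairs of
  -- positions.
  have h1 : ∀ f : Fin k → G.edgeSet, (walkSum k fun _ (f' : Fin k → G.edgeSet) =>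
      if ∃ i j, f i = f' j then 1 else 0) ≤ 2 * k ^ 2 / n := by
    intro f
    calc _ ≤ walkSum k fun _ (f' : Fin k → G.edgeSet) =>
          ∑ i, ∑ j, if f' j = f i then (1 : ℝ) else 0 := by
          refine walkSum_mono fun u f' => ?_
          have nn : ∀ i j, (0 : ℝ) ≤ if f' j = f i then 1 else 0 := fun i j => by
            split_ifs <;> norm_num
          split_ifs with h
          · obtain ⟨i, j, h⟩ := h
            calc (1 : ℝ) = if f' j = f i then 1 else 0 := by simp [h]
              _ ≤ ∑ j, if f' j = f i then (1 : ℝ) else 0 :=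
                  Finset.single_le_sum (fun j _ => nn i j) (Finset.mem_univ j)
              _ ≤ _ := Finset.single_le_sum (f := fun i => ∑ j, if f' j = f i then (1 : ℝ) else 0)
                  (fun i _ => Finset.sum_nonneg fun j _ => nn i j) (Finset.mem_univ i)
          · exact Finset.sum_nonneg fun i _ => Finset.sum_nonneg fun j _ => nn i j
      _ = ∑ i, ∑ j, walkSum k fun _ (f' : Fin k → G.edgeSet) =>
          if f' j = f i then (1 : ℝ) else 0 := by
          rw [walkSum_finset_sum]
          refine Finset.sum_congr rfl fun i _ => ?_
          rw [walkSum_finset_sum]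
      _ ≤ ∑ i : Fin k, ∑ j : Fin k, (2 / n : ℝ) :=
          Finset.sum_le_sum fun i _ => Finset.sum_le_sum fun j _ => walkSum_edge_le hG j (f i)
      _ = _ := by simp; ring
  calc _ ≤ walkSum k fun _ (_ : Fin k → G.edgeSet) => 2 * (k : ℝ) ^ 2 / n * 1 :=
        walkSum_mono fun u f => by rw [mul_one]; exact h1 f
    _ = _ := by rw [walkSum_const_mul, walkSum_one hG, mul_one]

/-! ### Truncation of PageRank -/

/-- The entries are nonnegative and the columns sum to 1, so the transition matrix does not increase
the `ℓ¹` norm. -/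
theorem sum_abs_mulVec_le (p : Fin n → ℝ) :
    ∑ v, |(transitionMatrix G).mulVec p v| ≤ ∑ v, |p v| := by
  calc _ ≤ ∑ v, ∑ u, transitionMatrix G v u * |p u| := by
        refine Finset.sum_le_sum fun v _ => ?_
        change |∑ u, transitionMatrix G v u * p u| ≤ _
        refine (Finset.abs_sum_le_sum_abs _ _).trans
          (Finset.sum_le_sum fun u _ => ?_)
        rw [abs_mul, abs_of_nonneg]
        simp only [transitionMatrix, Matrix.of_apply]
        split_ifs <;> positivity
    _ = _ := by
        rw [Finset.sum_comm]
        refine Finset.sum_congr rfl fun u _ => ?_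
        have h := sum_stepProb_mul (G := G) u fun _ => |p u|
        rw [← h, ← Finset.sum_mul, sum_stepProb (hG u), one_mul]

theorem sum_abs_mulVec_pow_le (p : Fin n → ℝ) (j : ℕ) :
    ∑ v, |(transitionMatrix G ^ j).mulVec p v| ≤ ∑ v, |p v| := by
  induction j with
  | zero => simp
  | succ j ih =>
    rw [pow_succ', ← Matrix.mulVec_mulVec]
    exact (sum_abs_mulVec_le hG _).trans ih

/-- The defining equation and the `ℓ¹` contraction give `S ≤ α + (1 - α) S` for the norm `S`. This
bounds the truncation remainder without knowing that `p` is nonnegative. -/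
theorem IsPageRank.sum_abs_le [NeZero n] {α : ℝ} (h₀ : 0 < α) (h₁ : α < 1) {p : Fin n → ℝ}
    (hp : IsPageRank G α p) : ∑ v, |p v| ≤ 1 := by
  have hn : (n : ℝ) ≠ 0 := by exact_mod_cast NeZero.ne n
  have h : ∑ v, |p v| ≤ α + (1 - α) * ∑ v, |p v| := by
    calc ∑ v, |p v| ≤ ∑ v, (α * (1 / (n : ℝ)) +
          (1 - α) * |(transitionMatrix G).mulVec p v|) := by
          refine Finset.sum_le_sum fun v _ => ?_
          conv_lhs => rw [hp]
          simp only [Pi.add_apply, Pi.smul_apply, smul_eq_mul]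
          refine (abs_add_le _ _).trans (le_of_eq ?_)
          rw [abs_of_nonneg (by positivity), abs_mul, abs_of_nonneg (by linarith : 0 ≤ 1 - α)]
      _ = α + (1 - α) * ∑ v, |(transitionMatrix G).mulVec p v| := by
          rw [Finset.sum_add_distrib, Finset.mul_sum Finset.univ _ (1 - α), Finset.sum_const,
            Finset.card_univ, Fintype.card_fin, nsmul_eq_mul]
          field_simp
      _ ≤ _ := by
          have := mul_le_mul_of_nonneg_left (sum_abs_mulVec_le hG p) (by linarith : 0 ≤ 1 - α)
          linarith
  nlinarith

omit hG in
-- The defining equation is substituted into its own remainder term `k` times.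
theorem IsPageRank.eq_truncation {α : ℝ} {p : Fin n → ℝ} (hp : IsPageRank G α p) (k : ℕ)
    (v : Fin n) :
    p v = ∑ j ∈ Finset.range k, α * (1 - α) ^ j * occupation G j v +
      (1 - α) ^ k * (transitionMatrix G ^ k).mulVec p v := by
  induction k with
  | zero => simp
  | succ k ih =>
    rw [Finset.sum_range_succ]
    conv_lhs => rw [ih]
    have : (transitionMatrix G ^ k).mulVec p v = α * occupation G k v +
        (1 - α) * (transitionMatrix G ^ (k + 1)).mulVec p v := by
      conv_lhs => rw [hp]
      have e : (fun _ : Fin n => α * (1 / (n : ℝ))) = α • fun _ => 1 / (n : ℝ) := rfl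
      rw [Matrix.mulVec_add, e, Matrix.mulVec_smul, Matrix.mulVec_smul, Matrix.mulVec_mulVec,
        ← pow_succ]
      rfl
    rw [this]
    ring

theorem IsPageRank.abs_truncation_le [NeZero n] {α : ℝ} (h₀ : 0 < α) (h₁ : α < 1)
    {p : Fin n → ℝ} (hp : IsPageRank G α p) (k : ℕ) (T : Finset (Fin n)) :
    |∑ j ∈ Finset.range k, α * (1 - α) ^ j * ∑ v ∈ T, occupation G j v - ∑ v ∈ T, p v| ≤
      (1 - α) ^ k := by
  have e : ∑ j ∈ Finset.range k, α * (1 - α) ^ j * ∑ v ∈ T, occupation G j v - ∑ v ∈ T, p v =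
      -((1 - α) ^ k * ∑ v ∈ T, (transitionMatrix G ^ k).mulVec p v) := by
    rw [Finset.sum_congr rfl fun v _ => hp.eq_truncation k v, Finset.sum_add_distrib,
      Finset.sum_comm (s := T), ← Finset.mul_sum]
    simp_rw [Finset.mul_sum]
    ring
  have hα : 0 ≤ (1 - α) ^ k := pow_nonneg (by linarith) k
  rw [e, abs_neg, abs_mul, abs_of_nonneg hα]
  refine mul_le_of_le_one_right hα ?_
  calc _ ≤ ∑ v ∈ T, |(transitionMatrix G ^ k).mulVec p v| := Finset.abs_sum_le_sum_abs _ _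
    _ ≤ ∑ v, |(transitionMatrix G ^ k).mulVec p v| :=
        Finset.sum_le_sum_of_subset_of_nonneg (Finset.subset_univ _) fun _ _ _ => abs_nonneg _
    _ ≤ 1 := (sum_abs_mulVec_pow_le hG p k).trans (hp.sum_abs_le hG h₀ h₁)

end RandomWalk

/-! ### Independent labels -/

section Labels

variable {E L : Type} [Fintype E] [Fintype L]

/-- The expectation over independent labels of the elements of `E` with the distribution `wt`. -/
def labelSum (wt : L → ℝ) (φ : (E → L) → ℝ) : ℝ := ∑ ℓ : E → L, (∏ e, wt (ℓ e)) * φ ℓ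

variable {wt : L → ℝ}

theorem labelSum_prod (g : E → L → ℝ) :
    labelSum wt (fun ℓ => ∏ e, g e (ℓ e)) = ∏ e, ∑ c, wt c * g e c := by
  unfold labelSum
  simp_rw [← Finset.prod_mul_distrib]
  exact (Fintype.prod_sum fun e c => wt c * g e c).symm

theorem labelSum_const (hwt : ∑ c, wt c = 1) (a : ℝ) :
    labelSum wt (fun _ : E → L => a) = a := by
  have h := labelSum_prod (wt := wt) fun (_ : E) _ => 1
  simp only [Finset.prod_const_one, mul_one, hwt] at h
  unfold labelSum at h ⊢
  simp only [mul_one] at h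
  rw [← Finset.sum_mul, h, one_mul]

theorem labelSum_mono (hwt : ∀ c, 0 ≤ wt c) {φ ψ : (E → L) → ℝ} (h : ∀ ℓ, φ ℓ ≤ ψ ℓ) :
    labelSum wt φ ≤ labelSum wt ψ :=
  Finset.sum_le_sum fun ℓ _ =>
    mul_le_mul_of_nonneg_left (h ℓ) (Finset.prod_nonneg fun _ _ => hwt _)

theorem labelSum_add (φ ψ : (E → L) → ℝ) :
    labelSum wt (fun ℓ => φ ℓ + ψ ℓ) = labelSum wt φ + labelSum wt ψ := by
  unfold labelSum
  simp only [mul_add, Finset.sum_add_distrib]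

theorem labelSum_const_mul (a : ℝ) (φ : (E → L) → ℝ) :
    labelSum wt (fun ℓ => a * φ ℓ) = a * labelSum wt φ := by
  unfold labelSum
  simp only [Finset.mul_sum, mul_left_comm a]

theorem labelSum_sub (φ ψ : (E → L) → ℝ) :
    labelSum wt (fun ℓ => φ ℓ - ψ ℓ) = labelSum wt φ - labelSum wt ψ := by
  unfold labelSum
  simp only [mul_sub, Finset.sum_sub_distrib]

theorem labelSum_finset_sum {ι : Type} (s : Finset ι) (φ : ι → (E → L) → ℝ) :
    labelSum wt (fun ℓ => ∑ i ∈ s, φ i ℓ) = ∑ i ∈ s, labelSum wt (φ i) := by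
  unfold labelSum
  simp only [Finset.mul_sum]
  exact Finset.sum_comm

/-- Markov's inequality. -/
theorem labelSum_markov (hwt : ∀ c, 0 ≤ wt c) {φ : (E → L) → ℝ} (hφ : ∀ ℓ, 0 ≤ φ ℓ) {a : ℝ}
    (ha : 0 < a) : labelSum wt (fun ℓ => if a ≤ φ ℓ then 1 else 0) ≤ labelSum wt φ / a := by
  rw [div_eq_inv_mul, ← labelSum_const_mul]
  refine labelSum_mono hwt fun ℓ => ?_
  rw [← div_eq_inv_mul]
  split_ifs with h
  · rwa [one_le_div ha]
  · exact div_nonneg (hφ ℓ) ha.le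

/-- Functions of disjoint sets of labels are independent. -/
theorem labelSum_mul_of_dependsOn (hwt : ∑ c, wt c = 1) (s : Set E) {A B : (E → L) → ℝ}
    (hA : DependsOn A s) (hB : DependsOn B sᶜ) :
    labelSum wt (fun ℓ => A ℓ * B ℓ) = labelSum wt A * labelSum wt B := by
  -- Two independent labelings are taken and their values exchanged outside `s`. This
  -- weight-preserving involution turns `A * B` on the first labeling into `A` on the first times
  -- `B` on the second.
  let sw : (E → L) × (E → L) → (E → L) × (E → L) := fun q =>
    (fun e => if e ∈ s then q.1 e else q.2 e, fun e => if e ∈ s then q.2 e else q.1 e)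
  have hsw : Function.Involutive sw := by
    rintro ⟨a, b⟩
    refine Prod.ext (funext fun e => ?_) (funext fun e => ?_) <;>
    by_cases he : e ∈ s <;> simp [sw, he]
  have h1 : ∑ q : (E → L) × (E → L),
      ((∏ e, wt (q.1 e)) * (∏ e, wt (q.2 e))) * (A q.1 * B q.2) =
      labelSum wt A * labelSum wt B := by
    unfold labelSum
    rw [Fintype.sum_prod_type, Finset.sum_mul_sum]
    exact Finset.sum_congr rfl fun _ _ => Finset.sum_congr rfl fun _ _ => by ring
  have h2 : ∑ q : (E → L) × (E → L),
      ((∏ e, wt (q.1 e)) * (∏ e, wt (q.2 e))) * (A q.1 * B q.1) =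
      labelSum wt fun ℓ => A ℓ * B ℓ := by
    have h3 := labelSum_const (E := E) hwt 1
    unfold labelSum at h3 ⊢
    simp only [mul_one] at h3
    rw [Fintype.sum_prod_type]
    refine Finset.sum_congr rfl fun ℓ _ => ?_
    simp only
    rw [← Finset.sum_mul, ← Finset.mul_sum, h3, mul_one]
  rw [← h1, ← h2, ← hsw.bijective.sum_comp]
  refine Finset.sum_congr rfl fun q _ => ?_
  have e1 : A (sw q).1 = A q.1 := hA fun e he => if_pos he
  have e2 : B (sw q).1 = B q.2 := hB fun e he => if_neg he
  rw [e1, e2]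
  congr 1
  rw [← Finset.prod_mul_distrib, ← Finset.prod_mul_distrib]
  refine Finset.prod_congr rfl fun e _ => ?_
  by_cases he : e ∈ s
  · simp [sw, he]
  · simp [sw, he, mul_comm]

end Labels

/-! ### Labels matching a walk -/

/-- The probability of the label `c`: the first `k` labels have probability `η`. -/
def labelWeight (η : ℝ) (k : ℕ) (c : Fin (k + 1)) : ℝ := if c = Fin.last k then 1 - η * k else η

theorem labelWeight_nonneg {η : ℝ} {k : ℕ} (hη : 0 ≤ η) (hk : η * k ≤ 1) (c : Fin (k + 1)) :
    0 ≤ labelWeight η k c := by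
  unfold labelWeight
  split_ifs <;> linarith

theorem labelWeight_castSucc (η : ℝ) {k : ℕ} (j : Fin k) : labelWeight η k j.castSucc = η :=
  if_neg (Fin.castSucc_lt_last j).ne

theorem labelWeight_last (η : ℝ) (k : ℕ) : labelWeight η k (Fin.last k) = 1 - η * k := if_pos rfl

theorem sum_labelWeight (η : ℝ) (k : ℕ) : ∑ c, labelWeight η k c = 1 := by
  simp_rw [Fin.sum_univ_castSucc, labelWeight_castSucc, labelWeight_last]
  simp
  ring

section Match

variable {E : Type} {k : ℕ} {η : ℝ}

/-- The `j`-th edge of the sequence does not occur earlier. -/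
def IsNew (f : Fin k → E) (j : Fin k) : Prop := ∀ i, i < j → f i ≠ f j

theorem IsNew.eq_of_eq {f : Fin k → E} {i j : Fin k} (hi : IsNew f i) (hj : IsNew f j)
    (h : f i = f j) : i = j := by
  rcases lt_trichotomy i j with h' | h' | h'
  · exact absurd h (hj i h')
  · exact h'
  · exact absurd h.symm (hi j h')

theorem exists_isNew_eq (f : Fin k → E) (j : Fin k) : ∃ i, IsNew f i ∧ f i = f j := by
  obtain ⟨i, hi, hmin⟩ := (Set.toFinite {i | f i = f j}).exists_minimal ⟨j, rfl⟩
  refine ⟨i, fun i' hlt he => ?_, hi⟩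
  exact absurd (hmin (show f i' = f j from he.trans hi) hlt.le) (not_le.2 hlt)

/-- The indicator, scaled to expectation `1`, of the event that every edge of the sequence has the
position of its first occurrence as its label. -/
def matchWeight (η : ℝ) (f : Fin k → E) (ℓ : E → Fin (k + 1)) : ℝ :=
  ∏ j, if IsNew f j then (if ℓ (f j) = j.castSucc then 1 / η else 0) else 1

theorem matchWeight_nonneg (hη : 0 ≤ η) (f : Fin k → E) (ℓ : E → Fin (k + 1)) :
    0 ≤ matchWeight η f ℓ :=
  Finset.prod_nonneg fun j _ => by split_ifs <;> positivity

theorem matchWeight_le (hη : 0 < η) (hη1 : η ≤ 1) (f : Fin k → E) (ℓ : E → Fin (k + 1)) :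
    matchWeight η f ℓ ≤ (η ^ k)⁻¹ := by
  have h1 : 1 ≤ 1 / η := by rwa [one_le_div hη]
  calc _ ≤ ∏ _j : Fin k, 1 / η := by
        refine Finset.prod_le_prod (fun j _ => ?_) fun j _ => ?_ <;> split_ifs <;>
          first | positivity | linarith
    _ = _ := by simp

theorem matchWeight_dependsOn (f : Fin k → E) : DependsOn (matchWeight η f) (Set.range f) := by
  intro ℓ ℓ' h
  unfold matchWeight
  refine Finset.prod_congr rfl fun j _ => ?_
  rw [h (f j) ⟨j, rfl⟩]

variable [Fintype E]

/-- Only first occurrences impose a condition, and these are distinct edges. The conditions are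
therefore independent, each with probability `η` and weight `1 / η`. -/
theorem labelSum_matchWeight (hη : 0 < η) (f : Fin k → E) :
    labelSum (labelWeight η k) (matchWeight η f) = 1 := by
  -- The product over positions is rewritten as a product over edges, so that `labelSum_prod`
  -- applies. The chosen position is the unique new one by `IsNew.eq_of_eq`.
  let g : E → Fin (k + 1) → ℝ := fun e c =>
    if h : ∃ j, IsNew f j ∧ f j = e then (if c = h.choose.castSucc then 1 / η else 0) else 1
  have hg : ∀ ℓ, matchWeight η f ℓ = ∏ e, g e (ℓ e) := by
    intro ℓ
    have e1 : matchWeight η f ℓ = ∏ j ∈ Finset.univ.filter (IsNew f), g (f j) (ℓ (f j)) := by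
      unfold matchWeight
      rw [Finset.prod_filter]
      refine Finset.prod_congr rfl fun j _ => ?_
      split_ifs with hj
      · have h : ∃ i, IsNew f i ∧ f i = f j := ⟨j, hj, rfl⟩
        simp only [g]
        rw [dif_pos h, h.choose_spec.1.eq_of_eq hj h.choose_spec.2]
        simp only [*, if_true]
      · have h : ∃ i, IsNew f i ∧ f i = f j := ⟨j, hj, rfl⟩
        simp only [g]
        rw [dif_pos h, h.choose_spec.1.eq_of_eq hj h.choose_spec.2]
        simp only [*, if_false]
      · rfl
    rw [e1, ← Finset.prod_image (f := fun e => g e (ℓ e)) fun i hi j hj h =>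
      (Finset.mem_filter.1 hi).2.eq_of_eq (Finset.mem_filter.1 hj).2 h]
    refine Finset.prod_subset (Finset.subset_univ _) fun e _ he => ?_
    simp only [g]
    rw [dif_neg]
    rintro ⟨j, hj, rfl⟩
    exact he (Finset.mem_image_of_mem _ (by simpa using hj))
  rw [funext hg, labelSum_prod]
  refine Finset.prod_eq_one fun e _ => ?_
  by_cases h : ∃ j, IsNew f j ∧ f j = e
  · simp only [g, dif_pos h, mul_ite, mul_zero, Finset.sum_ite_eq', Finset.mem_univ, if_true,
      labelWeight_castSucc]
    field_simp
  · simp only [g, dif_neg h, mul_one, sum_labelWeight]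

/-- If the sequences share no edge, the weights depend on disjoint sets of labels and the mean is
exactly 1. Otherwise one weight is bounded by `η⁻ᵏ` and the other has mean 1. -/
theorem labelSum_matchWeight_mul_le [DecidableEq E] (hη : 0 < η) (hη1 : η ≤ 1) (hk : η * k ≤ 1)
    (f f' : Fin k → E) :
    labelSum (labelWeight η k) (fun ℓ => matchWeight η f ℓ * matchWeight η f' ℓ) ≤
      1 + (η ^ k)⁻¹ * if ∃ i j, f i = f' j then 1 else 0 := by
  split_ifs with h
  · calc _ ≤ labelSum (labelWeight η k) (fun ℓ => (η ^ k)⁻¹ * matchWeight η f' ℓ) :=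
          labelSum_mono (labelWeight_nonneg hη.le hk) fun ℓ =>
            mul_le_mul_of_nonneg_right (matchWeight_le hη hη1 f ℓ) (matchWeight_nonneg hη.le f' ℓ)
      _ ≤ _ := by rw [labelSum_const_mul, labelSum_matchWeight hη]; linarith
  · rw [labelSum_mul_of_dependsOn (sum_labelWeight η k) (Set.range f) (matchWeight_dependsOn f),
      labelSum_matchWeight hη, labelSum_matchWeight hη]
    · simp
    · refine DependsOn.mono ?_ (matchWeight_dependsOn f')
      rintro _ ⟨j, rfl⟩ ⟨i, hi⟩
      exact h ⟨i, j, hi⟩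

/-! ### Accuracy of the degree estimates -/

theorem one_add_pow_le {t : ℝ} (h0 : 0 ≤ t) (h1 : t ≤ 1) (k : ℕ) :
    (1 + t) ^ k ≤ 1 + t * (2 ^ k - 1) := by
  induction k with
  | zero => simp
  | succ k ih =>
    have h2 : (1 : ℝ) ≤ 2 ^ k := one_le_pow₀ (by norm_num)
    calc (1 + t) ^ (k + 1) ≤ (1 + t * (2 ^ k - 1)) * (1 + t) := by
          rw [pow_succ]; exact mul_le_mul_of_nonneg_right ih (by linarith)
      _ ≤ _ := by
          rw [pow_succ]
          nlinarith [mul_nonneg (mul_nonneg h0 (sub_nonneg.2 h2)) (sub_nonneg.2 h1)]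

/-- Here `r` of `d` edges are missed. If at most half are missed, the ratio is at most `1 + 2 r /
d`, and a chord bound linearizes the power. Otherwise the ratio is at most `d ≤ 2 ^ d`, and `z ^ (2
r) ≥ z ^ d` pays for it. Both resulting terms, linear and exponential in `r`, have easily computed
expectations. -/
theorem degree_ratio_pow_le {d r : ℕ} (h : r < d) (k : ℕ) {z : ℝ} (hz : 1 ≤ z) :
    ((d : ℝ) / (d - r : ℕ)) ^ k ≤ 1 + 2 ^ (k + 1) * (r / d) + (2 ^ k / z) ^ d * (z ^ 2) ^ r := by
  have hd : (0 : ℝ) < d := by exact_mod_cast (Nat.zero_le r).trans_lt h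
  have hdr : (1 : ℝ) ≤ (d - r : ℕ) := by exact_mod_cast Nat.sub_pos_of_lt h
  have hz0 : 0 < z := by linarith
  rcases le_or_gt (2 * r) d with h2 | h2
  · have h2' : (2 : ℝ) * r ≤ d := by exact_mod_cast h2
    have e1 : (d : ℝ) / (d - r : ℕ) ≤ 1 + 2 * (r / d) := by
      rw [div_le_iff₀ (by linarith), Nat.cast_sub h.le]
      have : (1 + 2 * ((r : ℝ) / d)) * (d - r) = d + (r / d) * (d - 2 * r) := by
        field_simp; ring
      rw [this]
      have := mul_nonneg (show (0 : ℝ) ≤ r / d by positivity) (sub_nonneg.2 h2')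
      linarith
    have e2 : 2 * ((r : ℝ) / d) ≤ 1 := by
      rw [← mul_div_assoc, div_le_one hd]; exact h2'
    calc _ ≤ (1 + 2 * ((r : ℝ) / d)) ^ k := pow_le_pow_left₀ (by positivity) e1 k
      _ ≤ 1 + 2 * (r / d) * (2 ^ k - 1) := one_add_pow_le (by positivity) e2 k
      _ ≤ 1 + 2 ^ (k + 1) * (r / d) := by
          rw [pow_succ]
          have : (0 : ℝ) ≤ r / d := by positivity
          nlinarith
      _ ≤ _ := le_add_of_nonneg_right (by positivity)
  · calc _ ≤ (d : ℝ) ^ k := pow_le_pow_left₀ (by positivity) (div_le_self hd.le hdr) k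
      _ ≤ (2 ^ d) ^ k := by
          refine pow_le_pow_left₀ hd.le ?_ k
          exact_mod_cast (Nat.lt_two_pow_self (n := d)).le
      _ = (2 ^ k / z) ^ d * z ^ d := by
          rw [div_pow, div_mul_cancel₀ _ (by positivity), ← pow_mul, ← pow_mul, mul_comm]
      _ ≤ (2 ^ k / z) ^ d * (z ^ 2) ^ r := by
          rw [← pow_mul]
          exact mul_le_mul_of_nonneg_left (pow_le_pow_right₀ hz h2.le) (by positivity)
      _ ≤ _ := le_add_of_nonneg_left (by positivity)

/-- The product is at most the `k`-th power of its largest factor. This handles the estimates along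
a walk, which are dependent, through their individual moments. -/
theorem prod_le_one_add_sum_pow {k : ℕ} (hk : 0 < k) (y : Fin k → ℝ) (hy : ∀ j, 1 ≤ y j) :
    ∏ j, y j ≤ 1 + ∑ j, (y j ^ k - 1) := by
  obtain ⟨i, -, hi⟩ := Finset.exists_max_image (Finset.univ : Finset (Fin k)) y
    ⟨⟨0, hk⟩, Finset.mem_univ _⟩
  calc ∏ j, y j ≤ ∏ _j : Fin k, y i :=
        Finset.prod_le_prod (fun j _ => by linarith [hy j]) fun j hj => hi j hj
    _ = 1 + (y i ^ k - 1) := by simp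
    _ ≤ _ := by
        refine add_le_add_right (Finset.single_le_sum (f := fun j => y j ^ k - 1)
          (fun j _ => ?_) (Finset.mem_univ i)) 1
        have := one_le_pow₀ (n := k) (hy j)
        linarith

/-- The expectation of a power of the reciprocal of the relative degree estimate. -/
theorem labelSum_degree_ratio_pow_le (hη : 0 ≤ η) (hk : η * k ≤ 1) {κ : ℝ} (hκ0 : 0 < κ)
    (hκ1 : κ ≤ 1) (hz : η * k * (2 ^ (k + 1) / κ) ^ 2 ≤ 1) (δ : Finset E) (P : E → Prop)
    [DecidablePred P] (hP : ∃ e ∈ δ, P e) :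
    labelSum (labelWeight η k) (fun ℓ => ((δ.card : ℝ) /
      (δ.filter fun e => P e ∨ ℓ e = Fin.last k).card) ^ k) ≤ 1 + (2 ^ (k + 1) * (η * k) + κ) := by
  obtain ⟨e₀, he₀, hPe₀⟩ := hP
  have hd : 0 < δ.card := Finset.card_pos.2 ⟨e₀, he₀⟩
  have hd' : (0 : ℝ) < δ.card := by exact_mod_cast hd
  set p := η * k with hp
  have hp0 : 0 ≤ p := by positivity
  -- Chosen so that `2 ^ k / z * 2 = κ`: the exponential term then contributes `κ ^ d ≤ κ`.
  set z : ℝ := 2 ^ (k + 1) / κ with hzdef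
  have hz1 : 1 ≤ z := by
    rw [hzdef, one_le_div hκ0]
    exact hκ1.trans (one_le_pow₀ (by norm_num))
  -- Edges with `P` are counted regardless of their label, so only edges of `S` can be missed; `r`
  -- is the number missed. As some edge of `δ` satisfies `P`, always `r < d`.
  set S := δ.filter fun e => ¬ P e with hS
  have hwt := labelWeight_nonneg hη hk
  let r : (E → Fin (k + 1)) → ℕ := fun ℓ => (S.filter fun e => ℓ e ≠ Fin.last k).card
  have hsplit : ∀ ℓ : E → Fin (k + 1),
      (δ.filter fun e => P e ∨ ℓ e = Fin.last k).card + r ℓ = δ.card := by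
    intro ℓ
    rw [← Finset.card_filter_add_card_filter_not (s := δ) fun e => P e ∨ ℓ e = Fin.last k]
    congr 1
    change Finset.card _ = Finset.card _
    congr 1
    ext e
    simp [hS, and_assoc]
  have hpos : ∀ ℓ : E → Fin (k + 1), 0 < (δ.filter fun e => P e ∨ ℓ e = Fin.last k).card :=
    fun ℓ => Finset.card_pos.2 ⟨e₀, by simp [he₀, hPe₀]⟩
  have hr1 : labelSum (labelWeight η k) (fun ℓ => (r ℓ : ℝ)) ≤ δ.card * p := by
    have e1 : ∀ ℓ, (r ℓ : ℝ) = ∑ e ∈ S, if ℓ e ≠ Fin.last k then (1 : ℝ) else 0 := by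
      intro ℓ; rw [← Finset.sum_filter]; simp [r]
    simp_rw [e1]
    rw [labelSum_finset_sum]
    have e2 : ∀ e ∈ S, labelSum (labelWeight η k)
        (fun ℓ => if ℓ e ≠ Fin.last k then (1 : ℝ) else 0) = p := by
      intro e _
      have h := labelSum_prod (wt := labelWeight η k) fun (e' : E) c =>
        if e' = e then (if c ≠ Fin.last k then (1 : ℝ) else 0) else 1
      simp_rw [Finset.prod_ite_eq' Finset.univ, Finset.mem_univ, if_true] at h
      rw [h, Finset.prod_eq_single e]
      · simp_rw [Fin.sum_univ_castSucc]
        simp [labelWeight_castSucc, (Fin.castSucc_lt_last _).ne, hp, mul_comm]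
      · intro e' _ he'
        simp [he', sum_labelWeight]
      · simp
    rw [Finset.sum_congr rfl e2, Finset.sum_const, nsmul_eq_mul]
    refine mul_le_mul_of_nonneg_right ?_ hp0
    exact_mod_cast Finset.card_le_card (Finset.filter_subset _ _)
  -- Exponential moment: by independence each edge of `S` contributes the factor `p z ^ 2 + (1 -
  -- p)`, which `hz` bounds by 2.
  have hr2 : labelSum (labelWeight η k) (fun ℓ => (z ^ 2) ^ r ℓ) ≤ 2 ^ δ.card := by
    have e1 : ∀ ℓ, (z ^ 2) ^ r ℓ =
        ∏ e, if e ∈ S then (if ℓ e ≠ Fin.last k then z ^ 2 else 1) else 1 := by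
      intro ℓ
      rw [Finset.prod_ite_mem, Finset.univ_inter, ← Finset.prod_filter, Finset.prod_const]
    simp_rw [e1]
    rw [labelSum_prod fun (e : E) c => if e ∈ S then (if c ≠ Fin.last k then z ^ 2 else 1) else 1]
    have e2 : ∀ e, ∑ c, labelWeight η k c *
        (if e ∈ S then (if c ≠ Fin.last k then z ^ 2 else 1) else 1) =
        if e ∈ S then p * z ^ 2 + (1 - p) else 1 := by
      intro e
      split_ifs
      · simp_rw [Fin.sum_univ_castSucc]
        simp [labelWeight_castSucc, labelWeight_last, (Fin.castSucc_lt_last _).ne, hp]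
        ring
      · simp [sum_labelWeight]
    simp_rw [e2]
    rw [Finset.prod_ite_mem, Finset.univ_inter, Finset.prod_const]
    calc _ ≤ (2 : ℝ) ^ S.card :=
          pow_le_pow_left₀ (add_nonneg (by positivity) (by linarith)) (by linarith) _
      _ ≤ _ := pow_le_pow_right₀ (by norm_num) (Finset.card_le_card (Finset.filter_subset _ _))
  calc _ ≤ labelSum (labelWeight η k) (fun ℓ => 1 + 2 ^ (k + 1) / δ.card * (r ℓ : ℝ) +
        (2 ^ k / z) ^ δ.card * (z ^ 2) ^ r ℓ) := by
        refine labelSum_mono hwt fun ℓ => ?_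
        have h1 := hsplit ℓ
        have h2 := hpos ℓ
        have h3 := degree_ratio_pow_le (d := δ.card) (r := r ℓ) (by omega) k hz1
        rw [show δ.card - r ℓ = (δ.filter fun e => P e ∨ ℓ e = Fin.last k).card by omega] at h3
        refine h3.trans (le_of_eq ?_)
        ring
    _ = 1 + 2 ^ (k + 1) / δ.card * labelSum (labelWeight η k) (fun ℓ => (r ℓ : ℝ)) +
        (2 ^ k / z) ^ δ.card * labelSum (labelWeight η k) (fun ℓ => (z ^ 2) ^ r ℓ) := by
        rw [labelSum_add, labelSum_add, labelSum_const (sum_labelWeight η k), labelSum_const_mul,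
          labelSum_const_mul]
    _ ≤ 1 + 2 ^ (k + 1) / δ.card * (δ.card * p) + (2 ^ k / z) ^ δ.card * 2 ^ δ.card := by
        gcongr
    _ = 1 + (2 ^ (k + 1) * p + κ ^ δ.card) := by
        rw [← mul_pow]
        have : 2 ^ k / z * 2 = κ := by
          rw [hzdef, pow_succ]; field_simp
        rw [this]
        field_simp
        ring
    _ ≤ _ := by
        have : κ ^ δ.card ≤ κ := pow_le_of_le_one hκ0.le hκ1 hd.ne'
        linarith

/-- Since the estimates count the walk edges unconditionally, they depend only on labels off the
walk, while the match weight depends only on labels on it. The two factors are independent, so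
conditioning on a match does not bias the estimates. -/
theorem labelSum_matchWeight_mul_degree_ratio_le [DecidableEq E] (hk0 : 0 < k) (hη : 0 < η) (hk : η * k ≤ 1)
    {κ : ℝ} (hκ0 : 0 < κ) (hκ1 : κ ≤ 1) (hz : η * k * (2 ^ (k + 1) / κ) ^ 2 ≤ 1) (f : Fin k → E)
    (δ : Fin k → Finset E) (hδ : ∀ j, f j ∈ δ j) :
    labelSum (labelWeight η k) (fun ℓ => matchWeight η f ℓ * ∏ j, (((δ j).card : ℝ) /
      ((δ j).filter fun e => (∃ i, f i = e) ∨ ℓ e = Fin.last k).card)) ≤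
      1 + k * (2 ^ (k + 1) * (η * k) + κ) := by
  rw [labelSum_mul_of_dependsOn (sum_labelWeight η k) (Set.range f) (matchWeight_dependsOn f),
    labelSum_matchWeight hη, one_mul]
  · calc _ ≤ labelSum (labelWeight η k) (fun ℓ => 1 + ∑ j, ((((δ j).card : ℝ) /
          ((δ j).filter fun e => (∃ i, f i = e) ∨ ℓ e = Fin.last k).card) ^ k - 1)) := by
          refine labelSum_mono (labelWeight_nonneg hη.le hk) fun ℓ =>
            prod_le_one_add_sum_pow hk0 _ fun j => ?_
          rw [one_le_div]
          · exact_mod_cast Finset.card_le_card (Finset.filter_subset _ _)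
          · exact_mod_cast Finset.card_pos.2 ⟨f j, by simp [hδ j]⟩
      _ = 1 + ∑ j, (labelSum (labelWeight η k) (fun ℓ => (((δ j).card : ℝ) /
          ((δ j).filter fun e => (∃ i, f i = e) ∨ ℓ e = Fin.last k).card) ^ k) - 1) := by
          rw [labelSum_add, labelSum_const (sum_labelWeight η k), labelSum_finset_sum]
          congr 1
          refine Finset.sum_congr rfl fun j _ => ?_
          rw [labelSum_sub, labelSum_const (sum_labelWeight η k)]
      _ ≤ 1 + ∑ _j : Fin k, (2 ^ (k + 1) * (η * k) + κ) := by
          refine add_le_add_right (Finset.sum_le_sum fun j _ => ?_) 1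
          have := labelSum_degree_ratio_pow_le hη.le hk hκ0 hκ1 hz (δ j) (fun e => ∃ i, f i = e)
            ⟨f j, hδ j, j, rfl⟩
          linarith
      _ = _ := by rw [Finset.sum_const, Finset.card_univ, Fintype.card_fin, nsmul_eq_mul]
  · intro ℓ ℓ' h
    refine Finset.prod_congr rfl fun j _ => ?_
    congr 3
    ext e
    by_cases he : ∃ i, f i = e
    · simp [he]
    · simp [he, h e he]

end Match

/-! ### The law of a run of `WalkFromTemplate` -/

section Run

variable {n : ℕ} {G : SimpleGraph (Fin n)} (t : G.edgeSet → unitInterval) (η : ℝ)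

/-- One round on a possibly failed partial walk. -/
def optionRound (j r : ℕ) (o : Option (Trace G)) : PMF (Option (Trace G)) :=
  match o with
  | none => PMF.pure none
  | some w => walkRound t η j r w

/-- The partial walk after the first `j` rounds, `r i` being the template entry of round `i`. -/
def roundsLaw (r : ℕ → ℕ) (u : Fin n) (j : ℕ) : PMF (Option (Trace G)) :=
  (List.range j).foldl (fun μ i => μ.bind (optionRound t η i (r i))) (PMF.pure (some ⟨[], u⟩))

theorem roundsLaw_succ (r : ℕ → ℕ) (u : Fin n) (j : ℕ) :
    roundsLaw t η r u (j + 1) = (roundsLaw t η r u j).bind (optionRound t η j (r j)) := by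
  simp [roundsLaw, List.range_succ]

/-- The entries of a template as natural numbers. -/
def templateEntry {k : ℕ} (π : Template k) (i : ℕ) : ℕ := if h : i < k then (π ⟨i, h⟩).val else 0

theorem templateEntry_val {k : ℕ} (π : Template k) (j : Fin k) : templateEntry π j = (π j).val := by
  simp [templateEntry]

/-- The last part of `WalkFromTemplate`: rejection of the collected walk. -/
def finishWalk {k : ℕ} (π : Template k) (o : Option (Trace G)) : PMF (Option (List (Fin n))) :=
  match o with
  | none => PMF.pure none
  | some w =>
      if Conforms π (w.steps.map WalkStep.edge) then
        (coin (acceptProb t η k w)).bind fun keep =>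
          PMF.pure (if keep then some (w.steps.map WalkStep.vertex ++ [w.current]) else none)
      else PMF.pure none

theorem walkFromTemplate_eq {k : ℕ} (u : Fin n) (π : Template k) :
    walkFromTemplate t η u π = (roundsLaw t η (templateEntry π) u k).bind (finishWalk t η π) := by
  unfold walkFromTemplate roundsLaw
  congr 1
  rw [← List.map_coe_finRange_eq_range, List.foldl_map]
  congr 1
  funext μ j
  congr 1
  funext o
  cases o with
  | none => rfl
  | some w => simp only [optionRound, templateEntry_val]

/-- The edges at the current vertex from which round `i` of the walk chooses. -/
def candidates {j : ℕ} (u : Fin n) (f : Fin j → G.edgeSet) (i : Fin j) : Finset G.edgeSet :=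
  incidentEdges t (vtx u f i.castSucc) (η * (i : ℕ)) (η * ((i : ℕ) + 1))

/-- The trace of the walk from `u` along the edges `f`. -/
def traceOf (r : ℕ → ℕ) {j : ℕ} (u : Fin n) (f : Fin j → G.edgeSet) : Trace G where
  steps := List.ofFn fun i : Fin j =>
    ⟨vtx u f i.castSucc, f i,
      if r i = i then 1 / ((candidates t η u f i).card : ℝ) * η else 1⟩
  current := vtx u f (Fin.last j)

theorem candidates_snoc_castSucc {j : ℕ} (u : Fin n) (f : Fin j → G.edgeSet) (e : G.edgeSet)
    (i : Fin j) : candidates t η u (Fin.snoc f e : Fin (j + 1) → G.edgeSet) i.castSucc =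
      candidates t η u f i := by
  unfold candidates
  rw [vtx_snoc_castSucc]
  rfl

theorem candidates_snoc_last {j : ℕ} (u : Fin n) (f : Fin j → G.edgeSet) (e : G.edgeSet) :
    candidates t η u (Fin.snoc f e : Fin (j + 1) → G.edgeSet) (Fin.last j) =
      incidentEdges t (vtx u f (Fin.last j)) (η * j) (η * (j + 1)) := by
  unfold candidates
  rw [vtx_snoc_castSucc]
  rfl

theorem traceOf_snoc (r : ℕ → ℕ) {j : ℕ} (u : Fin n) (f : Fin j → G.edgeSet) (e : G.edgeSet) :
    traceOf t η r u (Fin.snoc f e : Fin (j + 1) → G.edgeSet) =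
      (traceOf t η r u f).push e (if r j = j then
        1 / ((incidentEdges t (vtx u f (Fin.last j)) (η * j) (η * (j + 1))).card : ℝ) * η
        else 1) := by
  unfold traceOf Trace.push
  rw [vtx_snoc_last, List.ofFn_succ_last]
  simp only [vtx_snoc_castSucc, candidates_snoc_castSucc, Fin.snoc_castSucc, Fin.snoc_last,
    candidates_snoc_last, Fin.val_castSucc, Fin.val_last]

/-- The probability that round `i` traverses `f i`, given that the previous rounds traversed the
previous edges of `f`. -/
def roundProb (r : ℕ → ℕ) {j : ℕ} (u : Fin n) (f : Fin j → G.edgeSet) (i : Fin j) : ℝ :=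
  if r i = i then (if f i ∈ candidates t η u f i then 1 / ((candidates t η u f i).card : ℝ) else 0)
  else if (∃ i' : Fin j, i'.val = r i ∧ i' < i ∧ f i' = f i) ∧
    vtx u f i.castSucc ∈ (f i : Sym2 (Fin n)) then 1 else 0

theorem roundProb_nonneg (r : ℕ → ℕ) {j : ℕ} (u : Fin n) (f : Fin j → G.edgeSet) (i : Fin j) :
    0 ≤ roundProb t η r u f i := by
  unfold roundProb
  split_ifs <;> positivity

theorem roundProb_snoc_castSucc (r : ℕ → ℕ) {j : ℕ} (u : Fin n) (f : Fin j → G.edgeSet)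
    (e : G.edgeSet) (i : Fin j) :
    roundProb t η r u (Fin.snoc f e : Fin (j + 1) → G.edgeSet) i.castSucc =
      roundProb t η r u f i := by
  unfold roundProb
  rw [candidates_snoc_castSucc, vtx_snoc_castSucc, Fin.snoc_castSucc]
  have : (∃ i' : Fin (j + 1), i'.val = r i.castSucc ∧ i' < i.castSucc ∧
      (Fin.snoc f e : Fin (j + 1) → G.edgeSet) i' = f i) ↔
      ∃ i' : Fin j, i'.val = r i ∧ i' < i ∧ f i' = f i := by
    constructor
    · rintro ⟨i', h1, h2, h3⟩
      induction i' using Fin.lastCases with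
      | last => exact absurd h2 (Fin.castSucc_lt_last i).not_gt
      | cast i' => exact ⟨i', h1, h2, by rwa [Fin.snoc_castSucc] at h3⟩
    · rintro ⟨i', h1, h2, h3⟩
      exact ⟨i'.castSucc, h1, h2, by rwa [Fin.snoc_castSucc]⟩
  simp only [Fin.val_castSucc] at this ⊢
  simp only [this]

theorem roundProb_snoc_last (r : ℕ → ℕ) {j : ℕ} (u : Fin n) (f : Fin j → G.edgeSet)
    (e : G.edgeSet) :
    roundProb t η r u (Fin.snoc f e : Fin (j + 1) → G.edgeSet) (Fin.last j) =
      if r j = j then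
        (if e ∈ incidentEdges t (vtx u f (Fin.last j)) (η * j) (η * (j + 1)) then
          1 / ((incidentEdges t (vtx u f (Fin.last j)) (η * j) (η * (j + 1))).card : ℝ) else 0)
      else if (∃ i : Fin j, i.val = r j ∧ f i = e) ∧
        vtx u f (Fin.last j) ∈ (e : Sym2 (Fin n)) then 1 else 0 := by
  unfold roundProb
  rw [candidates_snoc_last, vtx_snoc_castSucc, Fin.snoc_last]
  have : (∃ i' : Fin (j + 1), i'.val = r j ∧ i' < Fin.last j ∧
      (Fin.snoc f e : Fin (j + 1) → G.edgeSet) i' = e) ↔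
      ∃ i' : Fin j, i'.val = r j ∧ f i' = e := by
    constructor
    · rintro ⟨i', h1, h2, h3⟩
      induction i' using Fin.lastCases with
      | last => exact absurd h2 (lt_irrefl _)
      | cast i' => exact ⟨i', h1, by rwa [Fin.snoc_castSucc] at h3⟩
    · rintro ⟨i', h1, h3⟩
      exact ⟨i'.castSucc, h1, Fin.castSucc_lt_last i', by rwa [Fin.snoc_castSucc]⟩
  simp only [Fin.val_last, this]

theorem expect_uniformOfFinset {β : Type} [Fintype β] [DecidableEq β] (H : Finset β) (h : H.Nonempty)
    (φ : β → ℝ≥0∞) : expect (PMF.uniformOfFinset H h) φ =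
      ∑ x, ENNReal.ofReal (if x ∈ H then 1 / (H.card : ℝ) else 0) * φ x := by
  rw [expect_eq_sum]
  refine Finset.sum_congr rfl fun x _ => ?_
  rw [PMF.uniformOfFinset_apply]
  by_cases hx : x ∈ H
  · rw [if_pos hx, if_pos hx, one_div,
      ENNReal.ofReal_inv_of_pos (by exact_mod_cast Finset.card_pos.2 h), ENNReal.ofReal_natCast]
  · simp [hx]

theorem expect_walkRound (r : ℕ → ℕ) {j : ℕ} (u : Fin n) (f : Fin j → G.edgeSet)
    (φ : Option (Trace G) → ℝ≥0∞) (hφ : φ none = 0) :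
    expect (walkRound t η j (r j) (traceOf t η r u f)) φ =
      ∑ e, ENNReal.ofReal (roundProb t η r u (Fin.snoc f e : Fin (j + 1) → G.edgeSet)
        (Fin.last j)) * φ (some (traceOf t η r u (Fin.snoc f e : Fin (j + 1) → G.edgeSet))) := by
  simp_rw [roundProb_snoc_last, traceOf_snoc]
  unfold walkRound
  by_cases hr : r j = j
  · simp only [hr, if_true]
    by_cases h : (incidentEdges t (vtx u f (Fin.last j)) (η * j) (η * (j + 1))).Nonempty
    · have h' : (incidentEdges t (traceOf t η r u f).current (η * j) (η * (j + 1))).Nonempty := h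
      rw [dif_pos h', expect_bind, expect_uniformOfFinset]
      simp_rw [expect_pure]
      rfl
    · have h' : ¬ (incidentEdges t (traceOf t η r u f).current (η * j) (η * (j + 1))).Nonempty := h
      rw [dif_neg h', expect_pure, hφ]
      rw [Finset.not_nonempty_iff_eq_empty] at h
      simp [h]
  · simp only [hr, if_false]
    by_cases hlt : r j < j
    · have hs : (traceOf t η r u f).steps[r j]? = some
          ⟨vtx u f (Fin.castSucc ⟨r j, hlt⟩), f ⟨r j, hlt⟩, if r (r j) = r j then
            1 / ((candidates t η u f ⟨r j, hlt⟩).card : ℝ) * η else 1⟩ := by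
        simp [traceOf, hlt]
      rw [hs]
      simp only
      rw [Finset.sum_eq_single (f ⟨r j, hlt⟩)]
      · have hex : ∃ i : Fin j, i.val = r j ∧ f i = f ⟨r j, hlt⟩ := ⟨⟨r j, hlt⟩, rfl, rfl⟩
        simp only [hex, true_and]
        change expect (if vtx u f (Fin.last j) ∈ (f ⟨r j, hlt⟩ : Sym2 (Fin n)) then _ else _) φ = _
        split_ifs
        · simp [expect_pure]
        · simp [expect_pure, hφ]
      · intro e _ he
        rw [if_neg, ENNReal.ofReal_zero, zero_mul]
        rintro ⟨⟨i, h1, h2⟩, -⟩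
        obtain rfl : i = ⟨r j, hlt⟩ := Fin.ext h1
        exact he h2.symm
      · simp
    · have hs : (traceOf t η r u f).steps[r j]? = none := by
        simp [traceOf, hlt]
      rw [hs]
      simp only [expect_pure, hφ]
      refine (Finset.sum_eq_zero fun e _ => ?_).symm
      rw [if_neg, ENNReal.ofReal_zero, zero_mul]
      rintro ⟨⟨i, h1, -⟩, -⟩
      have := i.2
      omega

/-- Chain rule. As failure is given value 0, only surviving walks contribute, and these are indexed
by their edge sequences. -/
theorem expect_roundsLaw (r : ℕ → ℕ) (u : Fin n) (j : ℕ) (φ : Option (Trace G) → ℝ≥0∞)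
    (hφ : φ none = 0) :
    expect (roundsLaw t η r u j) φ = ∑ f : Fin j → G.edgeSet,
      ENNReal.ofReal (∏ i, roundProb t η r u f i) * φ (some (traceOf t η r u f)) := by
  induction j generalizing φ with
  | zero =>
    simp only [roundsLaw, List.range_zero, List.foldl_nil, expect_pure]
    rw [Fintype.sum_unique]
    simp [traceOf]
  | succ j ih =>
    rw [roundsLaw_succ, expect_bind, ih _ (by simp [optionRound, expect_pure, hφ]), sum_snoc]
    refine Finset.sum_congr rfl fun f _ => ?_
    simp only [optionRound]
    rw [expect_walkRound t η r u f φ hφ, Finset.mul_sum]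
    refine Finset.sum_congr rfl fun e _ => ?_
    rw [Fin.prod_univ_castSucc]
    simp_rw [roundProb_snoc_castSucc]
    rw [ENNReal.ofReal_mul (Finset.prod_nonneg fun i _ => roundProb_nonneg t η r u f i), mul_assoc]

/-- The degree estimate at the `i`-th vertex of the walk from `u` along `f`. -/
def walkDegreeEstimate {k : ℕ} (u : Fin n) (f : Fin k → G.edgeSet) (i : Fin k) : ℕ :=
  ((Finset.univ.filter fun e : G.edgeSet => vtx u f i.castSucc ∈ (e : Sym2 (Fin n))).filter
    fun e => (∃ i', f i' = e) ∨ η * k ≤ (t e : ℝ)).card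

theorem degreeEstimate_traceOf (r : ℕ → ℕ) {k : ℕ} (u : Fin n) (f : Fin k → G.edgeSet)
    (i : Fin k) : degreeEstimate t η k (traceOf t η r u f) (vtx u f i.castSucc) =
      walkDegreeEstimate t η u f i := by
  unfold degreeEstimate walkDegreeEstimate
  rw [Finset.filter_filter]
  congr 1
  ext e
  simp [traceOf, List.mem_ofFn]

theorem acceptProb_traceOf (r : ℕ → ℕ) {k : ℕ} (u : Fin n) (f : Fin k → G.edgeSet) :
    acceptProb t η k (traceOf t η r u f) = ∏ i : Fin k,
      min (η / ((if r i = i then 1 / ((candidates t η u f i).card : ℝ) * η else 1) *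
        walkDegreeEstimate t η u f i)) 1 := by
  unfold acceptProb
  rw [show (traceOf t η r u f).steps = List.ofFn fun i : Fin k => (⟨vtx u f i.castSucc, f i,
      if r i = i then 1 / ((candidates t η u f i).card : ℝ) * η else 1⟩ : WalkStep G) from rfl,
    List.map_ofFn, List.prod_ofFn]
  refine Finset.prod_congr rfl fun i _ => ?_
  simp only [Function.comp, degreeEstimate_traceOf]

theorem expect_coin {a : ℝ} (h1 : a ≤ 1) (x : ℝ≥0∞) :
    expect (coin a) (fun b => if b then x else 0) = ENNReal.ofReal a * x := by
  rw [expect_eq_sum, Fintype.sum_bool]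
  simp only [coin, PMF.ofFintype_apply, cond_true, if_true, Bool.false_eq_true, if_false, mul_zero,
    add_zero]
  rw [min_eq_left]
  rw [← ENNReal.ofReal_one]
  exact ENNReal.ofReal_le_ofReal h1

theorem expect_finishWalk {η : ℝ} (hη : 0 ≤ η) {k : ℕ} (r : ℕ → ℕ) (u : Fin n) (π : Template k)
    (f : Fin k → G.edgeSet) (φ : List (Fin n) → ℝ≥0∞) :
    expect (finishWalk t η π (some (traceOf t η r u f))) (fun o => o.elim 0 φ) =
      if Conforms π (List.ofFn f) then
        ENNReal.ofReal (acceptProb t η k (traceOf t η r u f)) * φ (List.ofFn (vtx u f)) else 0 := by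
  have e1 : (traceOf t η r u f).steps.map WalkStep.edge = List.ofFn f := by
    simp [traceOf, List.map_ofFn, Function.comp_def]
  have e2 : (traceOf t η r u f).steps.map WalkStep.vertex ++ [(traceOf t η r u f).current] =
      List.ofFn (vtx u f) := by
    rw [List.ofFn_succ_last]
    simp [traceOf, List.map_ofFn, Function.comp_def]
  unfold finishWalk
  simp only
  rw [e1, e2]
  split_ifs
  · rw [expect_bind]
    simp_rw [expect_pure]
    rw [← expect_coin]
    · congr 1
      funext b
      cases b <;> simp
    · rw [acceptProb_traceOf]
      refine Finset.prod_le_one (fun i _ => le_min (div_nonneg hη (mul_nonneg ?_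
        (Nat.cast_nonneg _))) zero_le_one) fun i _ => min_le_right _ _
      split_ifs <;> positivity
  · rw [expect_pure]; rfl

theorem conforms_ofFn {E : Type} {k : ℕ} (π : Template k) (f : Fin k → E) :
    Conforms π (List.ofFn f) ↔ ∀ j : Fin k, f ⟨π j, by omega⟩ = f j ∧
      ∀ i : Fin k, i.val < (π j).val → f i ≠ f j := by
  unfold Conforms
  refine forall_congr' fun j => ?_
  have h1 : (π j).val < k := by omega
  refine and_congr (by simp [h1]) ⟨fun h i hi => ?_, fun h i hi => ?_⟩
  · have := h i hi
    simpa using this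
  · have h2 : i < k := by omega
    simpa [h2] using h ⟨i, h2⟩ hi

/-- The template with which a sequence of edges conforms. -/
theorem existsUnique_conforms {E : Type} {k : ℕ} (f : Fin k → E) :
    ∃! π : Template k, Conforms π (List.ofFn f) := by
  choose g hg using exists_isNew_eq f
  have hle : ∀ j, g j ≤ j := fun j => by
    by_contra h
    exact (hg j).1 j (not_le.1 h) (hg j).2.symm
  refine ⟨fun j => ⟨(g j).val, Nat.lt_succ_of_le (hle j)⟩, ?_, fun π hπ => ?_⟩
  · refine (conforms_ofFn _ f).2 ?_
    refine fun j => ⟨(hg j).2, fun i hi h => (hg j).1 i hi (h.trans (hg j).2.symm)⟩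
  · replace hπ := (conforms_ofFn _ f).1 hπ
    funext j
    have h2 : IsNew f ⟨π j, by omega⟩ := fun i hi h => (hπ j).2 i hi (h.trans (hπ j).1)
    have := (hg j).1.eq_of_eq h2 ((hg j).2.trans (hπ j).1.symm)
    exact Fin.ext (congrArg Fin.val this).symm

theorem Conforms.eq_iff_isNew {E : Type} {k : ℕ} {π : Template k} {f : Fin k → E}
    (h : Conforms π (List.ofFn f)) (j : Fin k) : (π j).val = j ↔ IsNew f j := by
  rw [conforms_ofFn] at h
  constructor
  · intro hj i hi
    exact (h j).2 i (by rw [hj]; exact hi)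
  · intro hj
    by_contra hne
    exact hj ⟨π j, by omega⟩ (by have := (π j).2; simp only [Fin.lt_def]; omega) (h j).1

/-- The probability that a run with a conforming template collects and keeps the walk from `u`
along `f`. -/
def runWeight {k : ℕ} (u : Fin n) (f : Fin k → G.edgeSet) : ℝ :=
  ∏ i, if IsNew f i then
      (if f i ∈ candidates t η u f i then 1 / ((candidates t η u f i).card : ℝ) *
        min ((candidates t η u f i).card / walkDegreeEstimate t η u f i : ℝ) 1 else 0)
    else if vtx u f i.castSucc ∈ (f i : Sym2 (Fin n)) then
      min (η / walkDegreeEstimate t η u f i) 1 else 0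

/-- At a new edge `γ = η / |H|`, so choosing from `H` and keeping gives `1 / |H| * min (|H| / d̂)
1`. At a repeated edge `γ = 1` and the choice is forced, which leaves `min (η / d̂) 1`. -/
theorem roundProb_mul_acceptProb {η : ℝ} (hη : 0 < η) {k : ℕ} {π : Template k} (u : Fin n)
    {f : Fin k → G.edgeSet} (h : Conforms π (List.ofFn f)) :
    (∏ i, roundProb t η (templateEntry π) u f i) *
      acceptProb t η k (traceOf t η (templateEntry π) u f) = runWeight t η u f := by
  rw [acceptProb_traceOf, ← Finset.prod_mul_distrib]
  refine Finset.prod_congr rfl fun i _ => ?_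
  unfold roundProb
  rw [templateEntry_val]
  by_cases hi : IsNew f i
  · rw [if_pos ((h.eq_iff_isNew i).2 hi), if_pos ((h.eq_iff_isNew i).2 hi), if_pos hi]
    split_ifs with hc
    · congr 2
      have : (0 : ℝ) < (candidates t η u f i).card := by
        exact_mod_cast Finset.card_pos.2 ⟨_, hc⟩
      by_cases hd : (walkDegreeEstimate t η u f i : ℝ) = 0
      · simp [hd]
      · field_simp
    · rw [zero_mul]
  · have hi' := mt (h.eq_iff_isNew i).1 hi
    rw [if_neg hi', if_neg hi', if_neg hi]
    have hex : ∃ i' : Fin k, i'.val = (π i).val ∧ i' < i ∧ f i' = f i :=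
      ⟨⟨π i, by omega⟩, rfl, by have := (π i).2; simp only [Fin.lt_def]; omega,
        (((conforms_ofFn π f).1 h) i).1⟩
    simp only [hex, true_and, one_mul]
    split_ifs <;> simp

theorem expect_walkFromTemplate {η : ℝ} (hη : 0 < η) {k : ℕ} (u : Fin n) (π : Template k)
    (φ : List (Fin n) → ℝ≥0∞) :
    expect (walkFromTemplate t η u π) (fun o => o.elim 0 φ) = ∑ f : Fin k → G.edgeSet,
      if Conforms π (List.ofFn f) then
        ENNReal.ofReal (runWeight t η u f) * φ (List.ofFn (vtx u f)) else 0 := by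
  rw [walkFromTemplate_eq, expect_bind, expect_roundsLaw]
  · refine Finset.sum_congr rfl fun f _ => ?_
    rw [expect_finishWalk t hη.le]
    split_ifs with h
    · rw [← mul_assoc, ← ENNReal.ofReal_mul (Finset.prod_nonneg fun i _ =>
        roundProb_nonneg t η _ u f i), roundProb_mul_acceptProb t hη u h]
    · rw [mul_zero]
  · simp [finishWalk, expect_pure]

theorem card_template (k : ℕ) : Fintype.card (Template k) = k.factorial := by
  rw [Fintype.card_pi]
  simp only [Fintype.card_fin]
  exact Fin.prod_univ_eq_prod_range (fun i => i + 1) k |>.trans (Finset.prod_range_add_one_eq_factorial k)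

/-- The law of one run, with a uniformly random starting vertex and template. -/
def runLaw [NeZero n] (k : ℕ) : PMF (Option (List (Fin n))) :=
  (PMF.uniformOfFintype (Fin n)).bind fun u₀ =>
    (PMF.uniformOfFintype (Template k)).bind fun π => walkFromTemplate t η u₀ π

theorem expect_uniformOfFintype {β : Type} [Fintype β] [Nonempty β] (φ : β → ℝ≥0∞) :
    expect (PMF.uniformOfFintype β) φ =
      ENNReal.ofReal (1 / (Fintype.card β : ℝ)) * ∑ x, φ x := by
  rw [expect_eq_sum, Finset.mul_sum]
  refine Finset.sum_congr rfl fun x _ => ?_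
  rw [PMF.uniformOfFintype_apply, one_div,
    ENNReal.ofReal_inv_of_pos (by exact_mod_cast Fintype.card_pos), ENNReal.ofReal_natCast]

theorem runWeight_nonneg {η : ℝ} (hη : 0 ≤ η) {k : ℕ} (u : Fin n) (f : Fin k → G.edgeSet) :
    0 ≤ runWeight t η u f := by
  refine Finset.prod_nonneg fun i _ => ?_
  split_ifs
  · exact mul_nonneg (by positivity) (le_min (by positivity) zero_le_one)
  · exact le_rfl
  · exact le_min (by positivity) zero_le_one
  · exact le_rfl

/-- Every edge sequence conforms with exactly one template. Averaging over templates therefore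
counts each walk once, with the factor `1 / k!` independent of the walk. -/
theorem expect_runLaw [NeZero n] {η : ℝ} (hη : 0 < η) (k : ℕ) (φ : List (Fin n) → ℝ)
    (hφ : ∀ l, 0 ≤ φ l) :
    expect (runLaw t η k) (fun o => o.elim 0 fun l => ENNReal.ofReal (φ l)) =
      ENNReal.ofReal (1 / n * (1 / k.factorial) * ∑ u, ∑ f : Fin k → G.edgeSet,
        runWeight t η u f * φ (List.ofFn (vtx u f))) := by
  unfold runLaw
  rw [expect_bind, expect_uniformOfFintype, mul_assoc, ENNReal.ofReal_mul (by positivity),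
    Fintype.card_fin]
  congr 1
  rw [Finset.mul_sum, ENNReal.ofReal_sum_of_nonneg fun u _ => mul_nonneg
      (by positivity) (Finset.sum_nonneg fun f _ =>
        mul_nonneg (runWeight_nonneg t hη.le u f) (hφ _))]
  refine Finset.sum_congr rfl fun u _ => ?_
  rw [expect_bind, expect_uniformOfFintype, card_template, ENNReal.ofReal_mul (by positivity)]
  congr 1
  simp_rw [expect_walkFromTemplate t hη]
  rw [Finset.sum_comm, ENNReal.ofReal_sum_of_nonneg fun f _ =>
    mul_nonneg (runWeight_nonneg t hη.le u f) (hφ _)]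
  refine Finset.sum_congr rfl fun f _ => ?_
  obtain ⟨π, hπ, huniq⟩ := existsUnique_conforms f
  rw [Finset.sum_eq_single π, if_pos hπ, ENNReal.ofReal_mul (runWeight_nonneg t hη.le u f)]
  · intro π' _ hne
    exact if_neg fun h => hne (huniq π' h)
  · simp

end Run

/-! ### Comparison with the random walk -/

section Compare

variable {n : ℕ} {G : SimpleGraph (Fin n)}

/-- The part of the stream to which each edge belongs. -/
def HasLabels {k : ℕ} (η : ℝ) (t : G.edgeSet → unitInterval) (ℓ : G.edgeSet → Fin (k + 1)) :
    Prop :=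
  (∀ e (j : Fin k), (η * (j : ℕ) ≤ (t e : ℝ) ∧ (t e : ℝ) < η * ((j : ℕ) + 1)) ↔
    ℓ e = j.castSucc) ∧ ∀ e, η * k ≤ (t e : ℝ) ↔ ℓ e = Fin.last k

variable {k : ℕ} {η : ℝ} {t : G.edgeSet → unitInterval} {ℓ : G.edgeSet → Fin (k + 1)}

theorem HasLabels.mem_candidates (h : HasLabels η t ℓ) (u : Fin n) (f : Fin k → G.edgeSet)
    (i : Fin k) (e : G.edgeSet) : e ∈ candidates t η u f i ↔
      vtx u f i.castSucc ∈ (e : Sym2 (Fin n)) ∧ ℓ e = i.castSucc := by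
  rw [← h.1 e i]
  simp [candidates, incidentEdges]

/-- The product of the degrees, relative to their estimates, along a walk. -/
def degreeRatio (u : Fin n) (f : Fin k → G.edgeSet) (ℓ : G.edgeSet → Fin (k + 1)) : ℝ :=
  ∏ j : Fin k, (((Finset.univ.filter fun e : G.edgeSet =>
      vtx u f j.castSucc ∈ (e : Sym2 (Fin n))).card : ℝ) /
    ((Finset.univ.filter fun e : G.edgeSet => vtx u f j.castSucc ∈ (e : Sym2 (Fin n))).filter
      fun e => (∃ i, f i = e) ∨ ℓ e = Fin.last k).card)

/-- The comparison is made step by step. A matching new step has weight `min (1 / d̂) (1 / |H|)`, a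
repeated one `min (η / d̂) 1`, to be compared with `1 / d` and `η / d`. Since `d̂ ≤ d`, `|H| ≤ d`
and `η ≤ 1`, clamping never goes below the random walk value; dropping it costs the factor `d / d̂`.
-/
theorem HasLabels.runWeight_bounds (h : HasLabels η t ℓ) (hη : 0 < η) (hη1 : η ≤ 1) (u : Fin n)
    (f : Fin k → G.edgeSet) :
    (∏ j, stepProb (vtx u f j.castSucc) (f j)) * matchWeight η f ℓ * η ^ k ≤ runWeight t η u f ∧
    runWeight t η u f ≤ (∏ j, stepProb (vtx u f j.castSucc) (f j)) * matchWeight η f ℓ *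
      η ^ k * degreeRatio u f ℓ := by
  have hpow : η ^ k = ∏ _j : Fin k, η := by simp
  unfold matchWeight degreeRatio runWeight
  rw [hpow]
  simp_rw [← Finset.prod_mul_distrib]
  have key : ∀ j : Fin k,
      0 ≤ stepProb (vtx u f j.castSucc) (f j) *
        (if IsNew f j then (if ℓ (f j) = j.castSucc then 1 / η else 0) else 1) * η ∧
      stepProb (vtx u f j.castSucc) (f j) *
        (if IsNew f j then (if ℓ (f j) = j.castSucc then 1 / η else 0) else 1) * η ≤
      (if IsNew f j then
        (if f j ∈ candidates t η u f j then 1 / ((candidates t η u f j).card : ℝ) *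
          min ((candidates t η u f j).card / walkDegreeEstimate t η u f j : ℝ) 1 else 0)
        else if vtx u f j.castSucc ∈ (f j : Sym2 (Fin n)) then
          min (η / walkDegreeEstimate t η u f j) 1 else 0) ∧
      (if IsNew f j then
        (if f j ∈ candidates t η u f j then 1 / ((candidates t η u f j).card : ℝ) *
          min ((candidates t η u f j).card / walkDegreeEstimate t η u f j : ℝ) 1 else 0)
        else if vtx u f j.castSucc ∈ (f j : Sym2 (Fin n)) then
          min (η / walkDegreeEstimate t η u f j) 1 else 0) ≤
      stepProb (vtx u f j.castSucc) (f j) *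
        (if IsNew f j then (if ℓ (f j) = j.castSucc then 1 / η else 0) else 1) * η *
        (((Finset.univ.filter fun e : G.edgeSet =>
            vtx u f j.castSucc ∈ (e : Sym2 (Fin n))).card : ℝ) /
          ((Finset.univ.filter fun e : G.edgeSet =>
            vtx u f j.castSucc ∈ (e : Sym2 (Fin n))).filter
            fun e => (∃ i, f i = e) ∨ ℓ e = Fin.last k).card) := by
    intro j
    simp only [h.mem_candidates]
    by_cases hv : vtx u f j.castSucc ∈ (f j : Sym2 (Fin n))
    · have hest : walkDegreeEstimate t η u f j = ((Finset.univ.filter fun e : G.edgeSet =>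
            vtx u f j.castSucc ∈ (e : Sym2 (Fin n))).filter
            fun e => (∃ i, f i = e) ∨ ℓ e = Fin.last k).card := by
        unfold walkDegreeEstimate
        simp only [h.2]
      rw [← hest]
      have hd1 : (1 : ℝ) ≤ walkDegreeEstimate t η u f j := by
        rw [hest]
        exact_mod_cast Finset.card_pos.2 ⟨f j, by simp [hv]⟩
      have hd2 : (walkDegreeEstimate t η u f j : ℝ) ≤ (Finset.univ.filter fun e : G.edgeSet =>
            vtx u f j.castSucc ∈ (e : Sym2 (Fin n))).card := by
        exact_mod_cast Finset.card_le_card (Finset.filter_subset _ _)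
      have hH : ((candidates t η u f j).card : ℝ) ≤ (Finset.univ.filter fun e : G.edgeSet =>
            vtx u f j.castSucc ∈ (e : Sym2 (Fin n))).card := by
        refine Nat.cast_le.2 (Finset.card_le_card fun e he => ?_)
        simpa using ((h.mem_candidates u f j e).1 he).1
      have hsp : stepProb (vtx u f j.castSucc) (f j) =
          1 / ((Finset.univ.filter fun e : G.edgeSet =>
            vtx u f j.castSucc ∈ (e : Sym2 (Fin n))).card : ℝ) := by
        unfold stepProb
        rw [if_pos hv, card_incident]
      rw [hsp]
      generalize ((Finset.univ.filter fun e : G.edgeSet =>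
            vtx u f j.castSucc ∈ (e : Sym2 (Fin n))).card : ℝ) = d at *
      generalize (walkDegreeEstimate t η u f j : ℝ) = d' at *
      have hd0 : 0 < d := by linarith
      have hd0' : 0 < d' := by linarith
      simp only [hv, true_and, if_true]
      by_cases hnew : IsNew f j
      · simp only [hnew, if_true]
        by_cases hl : ℓ (f j) = j.castSucc
        · have hHpos : (0 : ℝ) < (candidates t η u f j).card := by
            exact_mod_cast Finset.card_pos.2 ⟨f j, (h.mem_candidates u f j _).2 ⟨hv, hl⟩⟩
          generalize ((candidates t η u f j).card : ℝ) = H at *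
          simp only [hl, if_true]
          have e1 : 1 / d * (1 / η) * η = 1 / d := by field_simp
          have e2 : 1 / d * (d / d') = 1 / d' := by field_simp
          have e3 : 1 / H * (H / d') = 1 / d' := by field_simp
          rw [e1, e2]
          refine ⟨by positivity, ?_, ?_⟩
          · rw [mul_min_of_nonneg _ _ (by positivity), e3, mul_one]
            exact le_min (one_div_le_one_div_of_le hd0' hd2) (one_div_le_one_div_of_le hHpos hH)
          · rw [← e3]
            exact mul_le_mul_of_nonneg_left (min_le_left _ _) (by positivity)
        · simp [hl]
      · simp only [hnew, if_false, mul_one]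
        have e2 : 1 / d * η * (d / d') = η / d' := by field_simp
        rw [e2]
        refine ⟨by positivity, le_min ?_ ?_, min_le_left _ _⟩
        · rw [one_div_mul_eq_div]
          exact div_le_div_of_nonneg_left hη.le hd0' hd2
        · rw [one_div_mul_eq_div, div_le_one hd0]
          linarith
    · have hsp : stepProb (vtx u f j.castSucc) (f j) = 0 := if_neg hv
      simp [hv, hsp]
  exact ⟨Finset.prod_le_prod (fun j _ => (key j).1) fun j _ => (key j).2.1,
    Finset.prod_le_prod (fun j _ => (key j).1.trans (key j).2.1) fun j _ => (key j).2.2⟩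

end Compare

/-! ### From timestamps to labels -/

section Timestamps

variable {n : ℕ} {G : SimpleGraph (Fin n)} {k : ℕ} {η : ℝ}

/-- The index of the part of the stream that contains a timestamp. -/
def labelOf (η : ℝ) (k : ℕ) (x : unitInterval) : Fin (k + 1) :=
  ⟨min ⌊(x : ℝ) / η⌋₊ k, Nat.lt_succ_of_le (min_le_right _ _)⟩

theorem labelOf_eq_castSucc (hη : 0 < η) (x : unitInterval) (j : Fin k) :
    (η * (j : ℕ) ≤ (x : ℝ) ∧ (x : ℝ) < η * ((j : ℕ) + 1)) ↔ labelOf η k x = j.castSucc := by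
  have hx : 0 ≤ (x : ℝ) / η := div_nonneg x.2.1 hη.le
  have h1 : labelOf η k x = j.castSucc ↔ ⌊(x : ℝ) / η⌋₊ = j := by
    simp only [labelOf, Fin.ext_iff, Fin.val_castSucc]
    have := j.2
    omega
  rw [h1, Nat.floor_eq_iff hx, le_div_iff₀' hη, div_lt_iff₀' hη]

theorem labelOf_eq_last (hη : 0 < η) (x : unitInterval) :
    η * k ≤ (x : ℝ) ↔ labelOf η k x = Fin.last k := by
  have h1 : labelOf η k x = Fin.last k ↔ k ≤ ⌊(x : ℝ) / η⌋₊ := by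
    simp only [labelOf, Fin.ext_iff, Fin.val_last]
    omega
  rw [h1, Nat.le_floor_iff (div_nonneg x.2.1 hη.le), le_div_iff₀' hη]

theorem hasLabels_labelOf (hη : 0 < η) (t : G.edgeSet → unitInterval) :
    HasLabels η t fun e => labelOf η k (t e) :=
  ⟨fun e j => labelOf_eq_castSucc hη (t e) j, fun e => labelOf_eq_last hη (t e)⟩

/-- Timestamps with prescribed labels. -/
def stamp (η : ℝ) {k : ℕ} (ℓ : G.edgeSet → Fin (k + 1)) (e : G.edgeSet) : unitInterval :=
  Set.projIcc 0 1 zero_le_one (η * (ℓ e : ℕ))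

theorem hasLabels_stamp (hη : 0 < η) (hk : η * k ≤ 1) (ℓ : G.edgeSet → Fin (k + 1)) :
    HasLabels η (stamp η ℓ) ℓ := by
  have h : ∀ e, ((stamp η ℓ e : unitInterval) : ℝ) = η * (ℓ e : ℕ) := by
    intro e
    have h2 : ((ℓ e : ℕ) : ℝ) ≤ k := by exact_mod_cast Nat.lt_succ_iff.1 (ℓ e).2
    rw [stamp, Set.projIcc_of_mem zero_le_one
      ⟨by positivity, (mul_le_mul_of_nonneg_left h2 hη.le).trans hk⟩]
  refine ⟨fun e j => ?_, fun e => ?_⟩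
  · rw [h, mul_le_mul_iff_right₀ hη, mul_lt_mul_iff_right₀ hη, Fin.ext_iff, Fin.val_castSucc]
    norm_cast
    omega
  · rw [h, mul_le_mul_iff_right₀ hη, Fin.ext_iff, Fin.val_last]
    have := (ℓ e).2
    norm_cast
    omega

variable {t t' : G.edgeSet → unitInterval} {ℓ : G.edgeSet → Fin (k + 1)}

/-- A run reads timestamps only through membership in the `k` windows and in the last part, so
timestamps with equal labels give equal laws. -/
theorem HasLabels.walkFromTemplate_congr (h : HasLabels η t ℓ) (h' : HasLabels η t' ℓ)
    (u : Fin n) (π : Template k) : walkFromTemplate t η u π = walkFromTemplate t' η u π := by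
  have e1 : ∀ (j : ℕ), j < k → ∀ u, incidentEdges t u (η * j) (η * (j + 1)) =
      incidentEdges t' u (η * j) (η * (j + 1)) := by
    intro j hj u
    ext e
    have := h.1 e ⟨j, hj⟩
    have := h'.1 e ⟨j, hj⟩
    simp only [incidentEdges, Finset.mem_filter]
    simp_all
  have e2 : ∀ (w : Trace G) (u : Fin n),
      degreeEstimate t η k w u = degreeEstimate t' η k w u := by
    intro w u
    unfold degreeEstimate
    simp only [h.2, h'.2]
  have e3 : finishWalk t η π = finishWalk t' η π := by
    funext o
    cases o with
    | none => rfl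
    | some w => simp only [finishWalk, acceptProb, e2]
  have e4 : ∀ (j : ℕ), j ≤ k → roundsLaw t η (templateEntry π) u j =
      roundsLaw t' η (templateEntry π) u j := by
    intro j
    induction j with
    | zero => intro _; rfl
    | succ j ih =>
      intro hj
      rw [roundsLaw_succ, roundsLaw_succ, ih (by omega)]
      congr 1
      funext o
      cases o with
      | none => rfl
      | some w => simp only [optionRound, walkRound, e1 j (by omega)]
  rw [walkFromTemplate_eq, walkFromTemplate_eq, e3, e4 k le_rfl]

/-- The part of `ApproxPageRank` that comes after the collection of walks. -/
def estimate (D α ε : ℝ) (h₀ : 0 < α) (h₁ : α < 1) (inT : Fin n → Bool)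
    (l : List (Option (List (Fin n)))) : PMF (Option ℝ) :=
  let k := walkLength α ε
  let b := ⌈D / ε ^ 2⌉₊
  if b * (k + 1) ≤ l.reduceOption.length then
    (iid (geom α h₀ h₁) b).bind fun Js =>
      PMF.pure (some ((Js.zipIdx.map fun (Ji : ℕ × ℕ) =>
        if Ji.1 ≤ k ∧ ∃ v, (l.reduceOption.take (b * (k + 1)))[b * Ji.1 + Ji.2]?.bind
          (fun w => w[Ji.1]?) = some v ∧ inT v = true
        then 1 / (b : ℝ) else 0).sum))
  else PMF.pure none

/-- The number of runs made by `ApproxPageRank`. -/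
def runCount (C D α ε : ℝ) : ℕ :=
  ⌈((⌈D / ε ^ 2⌉₊ * (walkLength α ε + 1) : ℕ) : ℝ) * 100 *
    (stepFraction C ε (walkLength α ε) ^ walkLength α ε)⁻¹ * ((walkLength α ε).factorial : ℝ)⌉₊

theorem approxPageRank_eq [NeZero n] (t : G.edgeSet → unitInterval) (C D α ε : ℝ) (h₀ : 0 < α)
    (h₁ : α < 1) (inT : Fin n → Bool) :
    approxPageRank t C D α ε h₀ h₁ inT =
      (iid (runLaw t (stepFraction C ε (walkLength α ε)) (walkLength α ε))
        (runCount C D α ε)).bind (estimate D α ε h₀ h₁ inT) := by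
  unfold approxPageRank simulateWalks samplesWithReset runCount runLaw
  simp only [PMF.bind_bind, PMF.pure_bind]
  congr 1
  funext l
  unfold estimate
  simp only
  split_ifs <;> rfl

theorem HasLabels.approxPageRank_congr [NeZero n] {C D α ε : ℝ} {h₀ : 0 < α} {h₁ : α < 1}
    {inT : Fin n → Bool} {ℓ : G.edgeSet → Fin (walkLength α ε + 1)}
    (h : HasLabels (stepFraction C ε (walkLength α ε)) t ℓ)
    (h' : HasLabels (stepFraction C ε (walkLength α ε)) t' ℓ) :
    approxPageRank t C D α ε h₀ h₁ inT = approxPageRank t' C D α ε h₀ h₁ inT := by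
  rw [approxPageRank_eq, approxPageRank_eq]
  unfold runLaw
  simp only [h.walkFromTemplate_congr h']

theorem measurable_labelOf (η : ℝ) (k : ℕ) : Measurable (labelOf η k) := by
  have h : Measurable fun m : ℕ => (⟨min m k, Nat.lt_succ_of_le (min_le_right _ _)⟩ : Fin (k + 1)) :=
    Measurable.of_discrete
  exact h.comp (measurable_subtype_coe.div_const η).nat_floor

theorem volume_labelOf (hη : 0 < η) (hk : η * k ≤ 1) (c : Fin (k + 1)) :
    volume (labelOf η k ⁻¹' {c}) = ENNReal.ofReal (labelWeight η k c) := by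
  have hcomap : ∀ s : Set ℝ, s ⊆ Set.Icc 0 1 → volume ((Subtype.val : unitInterval → ℝ) ⁻¹' s) =
      volume s := by
    intro s hs
    rw [Measure.Subtype.volume_def, comap_subtype_coe_apply measurableSet_Icc,
      Subtype.image_preimage_coe, Set.inter_eq_right.2 hs]
  induction c using Fin.lastCases with
  | cast j =>
    have h : labelOf η k ⁻¹' {j.castSucc} = (Subtype.val : unitInterval → ℝ) ⁻¹'
        (Set.Ico (η * (j : ℕ)) (η * ((j : ℕ) + 1))) := by
      ext x
      simp only [Set.mem_preimage, Set.mem_singleton_iff, Set.mem_Ico]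
      exact (labelOf_eq_castSucc hη x j).symm
    rw [h, hcomap, Real.volume_Ico, labelWeight_castSucc]
    · congr 1; ring
    · rintro x ⟨hx1, hx2⟩
      have hj : ((j : ℕ) : ℝ) + 1 ≤ k := by exact_mod_cast j.2
      exact ⟨le_trans (by positivity) hx1,
        hx2.le.trans ((mul_le_mul_of_nonneg_left hj hη.le).trans hk)⟩
  | last =>
    have h : labelOf η k ⁻¹' {Fin.last k} = (Subtype.val : unitInterval → ℝ) ⁻¹'
        (Set.Icc (η * k) 1) := by
      ext x
      simp only [Set.mem_preimage, Set.mem_singleton_iff, Set.mem_Icc, x.2.2, and_true]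
      exact (labelOf_eq_last hη x).symm
    rw [h, hcomap, Real.volume_Icc, labelWeight_last]
    exact fun x hx => ⟨le_trans (by positivity) hx.1, hx.2⟩

/-- The expectation of a nonnegative function of the labels. -/
def labelExpect {E L : Type} [Fintype E] [Fintype L] (wt : L → ℝ) (F : (E → L) → ℝ≥0∞) : ℝ≥0∞ :=
  ∑ ℓ : E → L, ENNReal.ofReal (∏ e, wt (ℓ e)) * F ℓ

/-- The pushforward of the product measure under the labels lives on a finite space, and the
preimage of a single labeling is a box. -/
theorem lintegral_labelOf {E : Type} [Fintype E] (hη : 0 < η) (hk : η * k ≤ 1)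
    (F : (E → Fin (k + 1)) → ℝ≥0∞) :
    ∫⁻ t : E → unitInterval, F (fun e => labelOf η k (t e)) =
      labelExpect (labelWeight η k) F := by
  have hm : Measurable fun (t : E → unitInterval) e => labelOf η k (t e) :=
    measurable_pi_lambda _ fun e => (measurable_labelOf η k).comp (measurable_pi_apply e)
  rw [← lintegral_map (f := F) (measurable_of_finite F) hm, lintegral_fintype]
  unfold labelExpect
  refine Finset.sum_congr rfl fun ℓ _ => ?_
  rw [mul_comm, Measure.map_apply hm (measurableSet_singleton ℓ)]
  congr 1
  have : (fun (t : E → unitInterval) e => labelOf η k (t e)) ⁻¹' {ℓ} =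
      Set.univ.pi fun e => labelOf η k ⁻¹' {ℓ e} := by
    ext t
    simp [funext_iff]
  rw [this, volume_pi_pi, ENNReal.ofReal_prod_of_nonneg fun e _ => labelWeight_nonneg hη.le hk _]
  exact Finset.prod_congr rfl fun e _ => volume_labelOf hη hk (ℓ e)

/-- The law depends on the timestamps only through the labels, so they may be replaced by the
canonical timestamps `stamp η ℓ`. -/
theorem approxPageRankProb_eq [NeZero n] {C D α ε : ℝ} (h₀ : 0 < α) (h₁ : α < 1)
    (inT : Fin n → Bool) (S : Set (Option ℝ)) (hη : 0 < stepFraction C ε (walkLength α ε))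
    (hk : stepFraction C ε (walkLength α ε) * walkLength α ε ≤ 1) :
    approxPageRankProb C D α ε h₀ h₁ G inT S =
      labelExpect (labelWeight (stepFraction C ε (walkLength α ε)) (walkLength α ε)) fun ℓ =>
        (approxPageRank (stamp (G := G) (stepFraction C ε (walkLength α ε)) ℓ)
          C D α ε h₀ h₁ inT).toOuterMeasure S := by
  rw [← lintegral_labelOf hη hk]
  unfold approxPageRankProb
  refine lintegral_congr fun t => ?_
  rw [(hasLabels_labelOf hη t).approxPageRank_congr (hasLabels_stamp hη hk _)]

end Timestamps

/-! ### Concentration of the sampling probabilities -/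

section Concentration

variable {n : ℕ} {G : SimpleGraph (Fin n)} {k : ℕ} {η : ℝ}

theorem labelSum_walkSum {L : Type} [Fintype L] (wt : L → ℝ)
    (φ : (G.edgeSet → L) → Fin n → (Fin k → G.edgeSet) → ℝ) :
    labelSum wt (fun ℓ => walkSum k (φ ℓ)) = walkSum k fun u f => labelSum wt fun ℓ => φ ℓ u f := by
  unfold walkSum
  rw [labelSum_finset_sum]
  refine Finset.sum_congr rfl fun u _ => ?_
  rw [labelSum_finset_sum]
  refine Finset.sum_congr rfl fun f _ => ?_
  rw [labelSum_const_mul]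

/-- The unbiased approximation of a walk average by the walks that match the labels. -/
def matchedSum (η : ℝ) (a : Fin n → (Fin k → G.edgeSet) → ℝ) (ℓ : G.edgeSet → Fin (k + 1)) : ℝ :=
  walkSum k fun u f => a u f * matchWeight η f ℓ

/-- The scaled sum over the walks that a run collects and keeps. -/
def collectedSum (η : ℝ) (a : Fin n → (Fin k → G.edgeSet) → ℝ) (ℓ : G.edgeSet → Fin (k + 1)) :
    ℝ :=
  1 / n * (η ^ k)⁻¹ * ∑ u, ∑ f : Fin k → G.edgeSet, runWeight (stamp η ℓ) η u f * a u f

/-- The upper bound for the scaled probability that a run succeeds. -/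
def overestimate (η : ℝ) (ℓ : G.edgeSet → Fin (k + 1)) : ℝ :=
  walkSum k fun u f => matchWeight η f ℓ * degreeRatio u f ℓ

variable (hη : 0 < η) (hη1 : η ≤ 1) (hk : η * k ≤ 1)
include hη

theorem labelSum_matchedSum (a : Fin n → (Fin k → G.edgeSet) → ℝ) :
    labelSum (labelWeight η k) (matchedSum η a) = walkSum k a := by
  unfold matchedSum
  rw [labelSum_walkSum]
  simp_rw [labelSum_const_mul]
  congr 1
  funext u f
  rw [show labelSum (labelWeight η k) (fun ℓ => matchWeight η f ℓ) = 1 from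
    labelSum_matchWeight hη f, mul_one]

include hη1 hk

/-- The second moment is an average over pairs of walks. Edge-disjoint pairs contribute exactly the
square of the mean; the excess of the others is at most `η⁻ᵏ` times the probability of sharing an
edge. -/
theorem labelSum_matchedSum_variance_le [NeZero n] (hG : ∀ v, ∃ w, G.Adj v w)
    (a : Fin n → (Fin k → G.edgeSet) → ℝ) (ha0 : ∀ u f, 0 ≤ a u f) (ha1 : ∀ u f, a u f ≤ 1) :
    labelSum (labelWeight η k) (fun ℓ => (matchedSum η a ℓ - walkSum k a) ^ 2) ≤
      (η ^ k)⁻¹ * (2 * k ^ 2 / n) := by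
  have hsq : ∀ ℓ, matchedSum η a ℓ ^ 2 = walkSum k fun u f => walkSum k fun u' f' =>
      a u f * a u' f' * (matchWeight η f ℓ * matchWeight η f' ℓ) := by
    intro ℓ
    rw [sq]
    change _ * walkSum k (fun u f => a u f * matchWeight η f ℓ) = _
    rw [← walkSum_const_mul]
    congr 1
    funext u f
    rw [mul_comm]
    change _ * walkSum k (fun u f => a u f * matchWeight η f ℓ) = _
    rw [← walkSum_const_mul]
    congr 1
    funext u' f'
    ring
  have h2 : labelSum (labelWeight η k) (fun ℓ => matchedSum η a ℓ ^ 2) ≤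
      walkSum k a ^ 2 + (η ^ k)⁻¹ * (2 * k ^ 2 / n) := by
    simp_rw [hsq]
    rw [labelSum_walkSum]
    simp_rw [labelSum_walkSum, labelSum_const_mul]
    have hηk : 0 ≤ (η ^ k)⁻¹ := by positivity
    calc _ ≤ walkSum k fun u (f : Fin k → G.edgeSet) =>
          walkSum k fun u' (f' : Fin k → G.edgeSet) =>
          (a u f * a u' f' + (η ^ k)⁻¹ * if ∃ i j, f i = f' j then 1 else 0) := by
          refine walkSum_mono fun u f => walkSum_mono fun u' f' => ?_
          have h1 := labelSum_matchWeight_mul_le hη hη1 hk f f'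
          have h0 : 0 ≤ a u f * a u' f' := mul_nonneg (ha0 u f) (ha0 u' f')
          have h01 : a u f * a u' f' ≤ 1 := mul_le_one₀ (ha1 u f) (ha0 u' f') (ha1 u' f')
          have h3 : 0 ≤ (η ^ k)⁻¹ * if ∃ i j, f i = f' j then (1 : ℝ) else 0 :=
            mul_nonneg hηk (by split_ifs <;> norm_num)
          calc _ ≤ a u f * a u' f' * (1 + (η ^ k)⁻¹ * if ∃ i j, f i = f' j then 1 else 0) :=
                mul_le_mul_of_nonneg_left h1 h0
            _ ≤ _ := by
                have := mul_le_of_le_one_left h3 h01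
                linarith
      _ = walkSum k a ^ 2 + (η ^ k)⁻¹ * walkSum k fun _ (f : Fin k → G.edgeSet) =>
          walkSum k fun _ (f' : Fin k → G.edgeSet) => if ∃ i j, f i = f' j then 1 else 0 := by
          rw [← walkSum_const_mul]
          simp_rw [walkSum_add, walkSum_const_mul]
          congr 1
          rw [sq, ← walkSum_const_mul]
          congr 1
          funext u f
          exact mul_comm _ _
      _ ≤ _ := by
          have := mul_le_mul_of_nonneg_left (walkSum_share_edge_le hG k) hηk
          linarith
  have hexp : ∀ ℓ : G.edgeSet → Fin (k + 1), (matchedSum η a ℓ - walkSum k a) ^ 2 =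
      matchedSum η a ℓ ^ 2 + (-(2 * walkSum k a) * matchedSum η a ℓ + walkSum k a ^ 2) :=
    fun ℓ => by ring
  simp_rw [hexp]
  rw [labelSum_add, labelSum_add, labelSum_const_mul, labelSum_const (sum_labelWeight η k),
    show labelSum (labelWeight η k) (fun ℓ => matchedSum η a ℓ) = walkSum k a from
      labelSum_matchedSum hη a]
  nlinarith

/-- All comparisons are termwise over walks. As `0 ≤ a ≤ 1`, the excess of the collected over the
matched weight is largest for `a = 1`, so one error bound serves numerator and denominator alike. -/
theorem collectedSum_bounds (a : Fin n → (Fin k → G.edgeSet) → ℝ) (ha0 : ∀ u f, 0 ≤ a u f)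
    (ha1 : ∀ u f, a u f ≤ 1) (ℓ : G.edgeSet → Fin (k + 1)) :
    0 ≤ collectedSum η a ℓ - matchedSum η a ℓ ∧
    collectedSum η a ℓ - matchedSum η a ℓ ≤ overestimate η ℓ - matchedSum η (fun _ _ => 1) ℓ ∧
    collectedSum η a ℓ ≤ collectedSum η (fun _ _ => 1) ℓ := by
  have hb := fun u (f : Fin k → G.edgeSet) =>
    (hasLabels_stamp hη hk ℓ).runWeight_bounds hη hη1 u f
  have hηk : 0 < η ^ k := by positivity
  have hform : ∀ a : Fin n → (Fin k → G.edgeSet) → ℝ, collectedSum η a ℓ =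
      ∑ u, ∑ f : Fin k → G.edgeSet, 1 / n * (η ^ k)⁻¹ * (runWeight (stamp η ℓ) η u f * a u f) := by
    intro a
    unfold collectedSum
    simp_rw [Finset.mul_sum]
  have hlow : ∀ u (f : Fin k → G.edgeSet), walkProb u f * matchWeight η f ℓ ≤
      1 / n * (η ^ k)⁻¹ * runWeight (stamp η ℓ) η u f := by
    intro u f
    calc _ = 1 / n * (η ^ k)⁻¹ * ((∏ j, stepProb (vtx u f j.castSucc) (f j)) *
          matchWeight η f ℓ * η ^ k) := by
          unfold walkProb
          field_simp
      _ ≤ _ := mul_le_mul_of_nonneg_left (hb u f).1 (by positivity)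
  have hup : ∀ u (f : Fin k → G.edgeSet), 1 / n * (η ^ k)⁻¹ * runWeight (stamp η ℓ) η u f ≤
      walkProb u f * (matchWeight η f ℓ * degreeRatio u f ℓ) := by
    intro u f
    calc _ ≤ 1 / n * (η ^ k)⁻¹ * ((∏ j, stepProb (vtx u f j.castSucc) (f j)) *
          matchWeight η f ℓ * η ^ k * degreeRatio u f ℓ) :=
          mul_le_mul_of_nonneg_left (hb u f).2 (by positivity)
      _ = _ := by
          unfold walkProb
          field_simp
  have hdiff : collectedSum η a ℓ - matchedSum η a ℓ = ∑ u, ∑ f : Fin k → G.edgeSet,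
      a u f * (1 / n * (η ^ k)⁻¹ * runWeight (stamp η ℓ) η u f -
        walkProb u f * matchWeight η f ℓ) := by
    rw [hform]
    unfold matchedSum walkSum
    simp_rw [← Finset.sum_sub_distrib]
    exact Finset.sum_congr rfl fun u _ => Finset.sum_congr rfl fun f _ => by ring
  refine ⟨?_, ?_, ?_⟩
  · rw [hdiff]
    exact Finset.sum_nonneg fun u _ => Finset.sum_nonneg fun f _ =>
      mul_nonneg (ha0 u f) (sub_nonneg.2 (hlow u f))
  · rw [hdiff]
    unfold overestimate matchedSum walkSum
    simp_rw [← Finset.sum_sub_distrib]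
    refine Finset.sum_le_sum fun u _ => Finset.sum_le_sum fun f _ => ?_
    refine (mul_le_of_le_one_left (sub_nonneg.2 (hlow u f)) (ha1 u f)).trans ?_
    rw [one_mul]
    exact sub_le_sub_right (hup u f) _
  · rw [hform, hform]
    refine Finset.sum_le_sum fun u _ => Finset.sum_le_sum fun f _ => ?_
    exact mul_le_mul_of_nonneg_left (mul_le_mul_of_nonneg_left (ha1 u f)
      (runWeight_nonneg _ hη.le u f)) (by positivity)

omit hη1 in
theorem labelSum_overestimate_le [NeZero n] (hG : ∀ v, ∃ w, G.Adj v w) (hk0 : 0 < k) {κ : ℝ}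
    (hκ0 : 0 < κ) (hκ1 : κ ≤ 1) (hz : η * k * (2 ^ (k + 1) / κ) ^ 2 ≤ 1) :
    labelSum (labelWeight η k) (fun ℓ : G.edgeSet → Fin (k + 1) => overestimate η ℓ) ≤
      1 + k * (2 ^ (k + 1) * (η * k) + κ) := by
  unfold overestimate
  rw [labelSum_walkSum]
  calc _ ≤ walkSum k fun _ (_ : Fin k → G.edgeSet) =>
        (1 + k * (2 ^ (k + 1) * (η * k) + κ)) * 1 := by
        refine Finset.sum_le_sum fun u _ => Finset.sum_le_sum fun f _ => ?_
        -- Edge sequences that do not form a walk may violate the bound, but have probability 0.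
        by_cases hv : ∀ j : Fin k, vtx u f j.castSucc ∈ (f j : Sym2 (Fin n))
        · refine mul_le_mul_of_nonneg_left ?_ (walkProb_nonneg u f)
          rw [mul_one]
          exact labelSum_matchWeight_mul_degree_ratio_le hk0 hη hk hκ0 hκ1 hz f
            (fun j => Finset.univ.filter fun e : G.edgeSet =>
              vtx u f j.castSucc ∈ (e : Sym2 (Fin n))) fun j => by simpa using hv j
        · push Not at hv
          obtain ⟨j, hj⟩ := hv
          have : walkProb u f = 0 := by
            unfold walkProb
            rw [Finset.prod_eq_zero (Finset.mem_univ j) (if_neg hj), mul_zero]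
          rw [this, zero_mul, zero_mul]
    _ = _ := by rw [walkSum_const_mul, walkSum_one hG, mul_one]

end Concentration

/-! ### Success of one realization -/

section Success

variable {n : ℕ} [NeZero n] {G : SimpleGraph (Fin n)} {k : ℕ} {η : ℝ}

theorem expect_runLaw_eq (hη : 0 < η) (ℓ : G.edgeSet → Fin (k + 1))
    (φ : List (Fin n) → ℝ) (hφ : ∀ l, 0 ≤ φ l) :
    expect (runLaw (stamp η ℓ) η k) (fun o => o.elim 0 fun l => ENNReal.ofReal (φ l)) =
      ENNReal.ofReal (η ^ k / k.factorial *
        collectedSum η (fun u f => φ (List.ofFn (vtx u f))) ℓ) := by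
  rw [expect_runLaw _ hη k φ hφ]
  congr 1
  unfold collectedSum
  have : η ^ k ≠ 0 := by positivity
  field_simp

/-- The probability that a random walk with geometrically distributed length at most `k` ends in
the target set. -/
def hitWeight (k : ℕ) (α : ℝ) (inT : Fin n → Bool) (u : Fin n) (f : Fin k → G.edgeSet) : ℝ :=
  ∑ j : Fin (k + 1), α * (1 - α) ^ (j : ℕ) * if inT (vtx u f j) = true then 1 else 0

theorem sum_geom_le {α : ℝ} (h₀ : 0 < α) (h₁ : α < 1) (k : ℕ) :
    ∑ j : Fin (k + 1), α * (1 - α) ^ (j : ℕ) ≤ 1 := by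
  rw [Fin.sum_univ_eq_sum_range (fun j => α * (1 - α) ^ j), ← Finset.mul_sum,
    geom_sum_eq (by linarith)]
  have : 0 ≤ (1 - α) ^ (k + 1) := pow_nonneg (by linarith) _
  rw [show α * (((1 - α) ^ (k + 1) - 1) / (1 - α - 1)) = 1 - (1 - α) ^ (k + 1) by
    rw [show 1 - α - 1 = -α by ring]; field_simp; ring]
  linarith

omit [NeZero n] in
theorem hitWeight_nonneg {α : ℝ} (h₀ : 0 < α) (h₁ : α < 1) (inT : Fin n → Bool) (u : Fin n)
    (f : Fin k → G.edgeSet) : 0 ≤ hitWeight k α inT u f := by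
  have h₂ : 0 ≤ 1 - α := by linarith
  exact Finset.sum_nonneg fun j _ => mul_nonneg (by positivity) (by split_ifs <;> norm_num)

omit [NeZero n] in
theorem hitWeight_le_one {α : ℝ} (h₀ : 0 < α) (h₁ : α < 1) (inT : Fin n → Bool) (u : Fin n)
    (f : Fin k → G.edgeSet) : hitWeight k α inT u f ≤ 1 := by
  have h₂ : 0 ≤ 1 - α := by linarith
  refine le_trans (Finset.sum_le_sum fun j _ => ?_) (sum_geom_le h₀ h₁ k)
  exact mul_le_of_le_one_right (by positivity) (by split_ifs <;> norm_num)

omit [NeZero n] in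
theorem walkSum_hitWeight (hG : ∀ v, ∃ w, G.Adj v w) (k : ℕ) (α : ℝ) (T : Finset (Fin n)) :
    walkSum k (fun u (f : Fin k → G.edgeSet) => hitWeight k α (fun v => decide (v ∈ T)) u f) =
      ∑ j ∈ Finset.range (k + 1), α * (1 - α) ^ j * ∑ v ∈ T, occupation G j v := by
  unfold hitWeight
  rw [walkSum_finset_sum, ← Fin.sum_univ_eq_sum_range fun j =>
    α * (1 - α) ^ j * ∑ v ∈ T, occupation G j v]
  refine Finset.sum_congr rfl fun j _ => ?_
  rw [walkSum_const_mul, walkSum_vtx hG j fun v => if decide (v ∈ T) = true then 1 else 0]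
  congr 1
  simp

/-- After `j` steps the walk is in the target set. -/
def Hits (k : ℕ) (inT : Fin n → Bool) (j : ℕ) (o : Option (List (Fin n))) : Prop :=
  j ≤ k ∧ ∃ v, o.bind (fun w => w[j]?) = some v ∧ inT v = true

omit [NeZero n] in
theorem hits_ofFn_vtx (inT : Fin n → Bool) (u : Fin n) (f : Fin k → G.edgeSet)
    (j : Fin (k + 1)) :
    Hits k inT j (some (List.ofFn (vtx u f))) ↔ inT (vtx u f j) = true := by
  simp [Hits, Nat.lt_succ_iff.1 j.2, -List.ofFn_succ]

variable {μ : PMF (Option (List (Fin n)))}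

omit [NeZero n] in
/-- The law of a walk, conditional on success. -/
theorem exists_conditional {q : ℝ} (hq : 0 < q)
    (h : expect μ (fun o => o.elim 0 fun _ => 1) = ENNReal.ofReal q) :
    ∃ ν : PMF (List (Fin n)), ∀ w, μ (some w) = ENNReal.ofReal q * ν w := by
  have h' : ∑' w, μ (some w) = ENNReal.ofReal q := by
    rw [← h, expect_option]
    simp
  have hq0 : ENNReal.ofReal q ≠ 0 := by simpa using hq
  refine ⟨PMF.normalize (fun w => μ (some w)) (h' ▸ hq0) (h' ▸ ENNReal.ofReal_ne_top), fun w => ?_⟩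
  rw [PMF.normalize_apply, h', mul_left_comm, ENNReal.mul_inv_cancel hq0 ENNReal.ofReal_ne_top,
    mul_one]

/-- Indices beyond `k` never hit, so the geometric average is a finite sum, which equals `hitWeight`
on each walk. Conditioning on success then divides one collected sum by another. -/
theorem expect_hits (hη : 0 < η) {α : ℝ} (h₀ : 0 < α) (h₁ : α < 1) (inT : Fin n → Bool)
    (ℓ : G.edgeSet → Fin (k + 1)) (hX : 0 < collectedSum η (fun _ _ => 1) ℓ)
    (ν : PMF (List (Fin n)))
    (hν : ∀ w, runLaw (stamp η ℓ) η k (some w) = ENNReal.ofReal (η ^ k / k.factorial *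
      collectedSum η (fun _ _ => 1) ℓ) * ν w) :
    (expect (geom α h₀ h₁) fun j => expect ν fun w => if Hits k inT j (some w) then 1 else 0) =
      ENNReal.ofReal (collectedSum η (hitWeight k α inT) ℓ / collectedSum η (fun _ _ => 1) ℓ) := by
  have h₂ : 0 ≤ 1 - α := by linarith
  set q := η ^ k / k.factorial * collectedSum η (fun _ _ => 1) ℓ with hq
  have hq0 : 0 < q := by positivity
  have hexp : ∀ ψ : List (Fin n) → ℝ≥0∞, ENNReal.ofReal q * expect ν ψ =
      expect (runLaw (stamp η ℓ) η k) fun o => o.elim 0 ψ := by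
    intro ψ
    rw [expect_option]
    simp only [Option.elim_none, mul_zero, zero_add, Option.elim_some, hν, mul_assoc]
    rw [ENNReal.tsum_mul_left]
    rfl
  have hmain : ENNReal.ofReal q * (expect (geom α h₀ h₁) fun j => expect ν fun w =>
      if Hits k inT j (some w) then 1 else 0) =
      ENNReal.ofReal (η ^ k / k.factorial * collectedSum η (hitWeight k α inT) ℓ) := by
    have e1 : (expect (geom α h₀ h₁) fun j => expect ν fun w =>
        if Hits k inT j (some w) then 1 else 0) =
        expect ν fun w => ∑ j ∈ Finset.range (k + 1), ENNReal.ofReal (α * (1 - α) ^ j) *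
          if Hits k inT j (some w) then 1 else 0 := by
      rw [expect_finset_sum]
      simp_rw [expect_const_mul]
      conv_lhs => rw [expect]
      rw [tsum_eq_sum (s := Finset.range (k + 1))]
      · rfl
      · intro j hj
        have : ∀ w, ¬ Hits k inT j (some w) := fun w hw =>
          hj (Finset.mem_range.2 (Nat.lt_succ_of_le hw.1))
        simp [this, expect_const]
    have e2 : ∀ w : List (Fin n), (∑ j ∈ Finset.range (k + 1), ENNReal.ofReal (α * (1 - α) ^ j) *
          if Hits k inT j (some w) then 1 else 0) = ENNReal.ofReal
        (∑ j : Fin (k + 1), α * (1 - α) ^ (j : ℕ) * if Hits k inT j (some w) then 1 else 0) := by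
      intro w
      rw [Fin.sum_univ_eq_sum_range (fun j => α * (1 - α) ^ j *
        if Hits k inT j (some w) then (1 : ℝ) else 0), ENNReal.ofReal_sum_of_nonneg]
      · refine Finset.sum_congr rfl fun j _ => ?_
        split_ifs <;> simp
      · intro j _
        exact mul_nonneg (by positivity) (by split_ifs <;> norm_num)
    rw [e1, hexp]
    simp_rw [e2]
    rw [expect_runLaw_eq hη ℓ (fun w => ∑ j : Fin (k + 1), α * (1 - α) ^ (j : ℕ) *
      if Hits k inT j (some w) then (1 : ℝ) else 0)]
    · simp_rw [hits_ofFn_vtx]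
      rfl
    · intro w
      exact Finset.sum_nonneg fun j _ => mul_nonneg (by positivity) (by split_ifs <;> norm_num)
  have hne : ENNReal.ofReal q ≠ 0 := by simpa using hq0
  rw [← ENNReal.mul_right_inj hne ENNReal.ofReal_ne_top, hmain, ← ENNReal.ofReal_mul hq0.le, hq]
  congr 1
  field_simp

omit [NeZero n] in
theorem isSome_indicator (o : Option (List (Fin n))) :
    (o.elim 0 fun _ => (1 : ℝ≥0∞)) = if o.isSome then 1 else 0 := by
  cases o <;> simp

/-- The algorithm fails with small probability on a fixed realization of the stream for which the
sampling probabilities are right. -/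
theorem expect_estimate_failure_le (hη : 0 < η) (hη1 : η ≤ 1) (hk : η * k ≤ 1) {α : ℝ} (h₀ : 0 < α)
    (h₁ : α < 1) {D ε τ y : ℝ} (hkα : walkLength α ε = k) (hb : 0 < ⌈D / ε ^ 2⌉₊) (hτ0 : 0 < τ)
    (hτ1 : τ ≤ 1) (inT : Fin n → Bool) (ℓ : G.edgeSet → Fin (k + 1))
    (hX : 0 < collectedSum η (fun _ _ => 1) ℓ)
    (hy : |collectedSum η (hitWeight k α inT) ℓ / collectedSum η (fun _ _ => 1) ℓ - y| ≤ ε - τ)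
    (s : ℕ) :
    (expect (iid (runLaw (stamp η ℓ) η k) s) fun l => expect (estimate D α ε h₀ h₁ inT l) fun o =>
      if ∃ x, o = some x ∧ |x - y| ≤ ε then 0 else 1) ≤
      ENNReal.ofReal (2 ^ (⌈D / ε ^ 2⌉₊ * (k + 1)) *
        Real.exp (-(s * (η ^ k / k.factorial * collectedSum η (fun _ _ => 1) ℓ) / 2))) +
      ENNReal.ofReal (2 * Real.exp (-(⌈D / ε ^ 2⌉₊ * τ ^ 2 / 4))) := by
  have hq0 : 0 < η ^ k / k.factorial * collectedSum η (fun _ _ => 1) ℓ := by positivity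
  have hsome : expect (runLaw (stamp η ℓ) η k) (fun o => o.elim 0 fun _ => 1) =
      ENNReal.ofReal (η ^ k / k.factorial * collectedSum η (fun _ _ => 1) ℓ) := by
    have := expect_runLaw_eq hη ℓ (fun _ => 1) fun _ => zero_le_one
    simpa using this
  obtain ⟨ν, hν⟩ := exists_conditional hq0 hsome
  set b := ⌈D / ε ^ 2⌉₊ with hbdef
  set θ := collectedSum η (hitWeight k α inT) ℓ / collectedSum η (fun _ _ => 1) ℓ with hθ
  have hq1 : η ^ k / k.factorial * collectedSum η (fun _ _ => 1) ℓ ≤ 1 := by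
    rw [← ENNReal.ofReal_le_ofReal_iff zero_le_one, ← hsome, ENNReal.ofReal_one]
    refine le_of_le_of_eq (expect_mono (ψ := fun _ => 1) fun o => ?_) (expect_const _ 1)
    cases o <;> simp
  have hcb := collectedSum_bounds hη hη1 hk (hitWeight k α inT) (hitWeight_nonneg h₀ h₁ inT)
    (hitWeight_le_one h₀ h₁ inT) ℓ
  have hθ0 : 0 ≤ θ := by
    refine div_nonneg (le_trans ?_ (sub_nonneg.1 hcb.1)) hX.le
    exact walkSum_nonneg fun u f => mul_nonneg (hitWeight_nonneg h₀ h₁ inT u f)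
      (matchWeight_nonneg hη.le f ℓ)
  have hθ1 : θ ≤ 1 := (div_le_one hX).2 hcb.2.2
  have hsamp := expect_sampling_error_le ν (geom α h₀ h₁) k hb (Hits k inT)
    (fun j hj o ho => absurd ho.1 (not_le.2 hj)) hθ0 hθ1 hτ0 hτ1
    (expect_hits hη h₀ h₁ inT ℓ hX ν hν)
  have hfew := expect_few_successes_le (runLaw (stamp η ℓ) η k) s (b * (k + 1)) hq1 hq0.le
    (le_of_eq (by rw [← hsome]; simp_rw [isSome_indicator]))
  have hfirst := (expect_first_successes_le (runLaw (stamp η ℓ) η k) ν _ hν s (b * (k + 1)) _).trans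
    hsamp
  -- Failure has two causes: too few successful runs, or a sampling error above `τ` around `θ`; `hy`
  -- leaves exactly `τ` of the total error `ε`.
  refine le_trans ?_ (add_le_add hfew hfirst)
  rw [← expect_add]
  refine expect_mono fun l => ?_
  unfold estimate
  simp only [hkα, ← hbdef]
  split_ifs with hl
  · rw [zero_add, expect_bind]
    refine expect_mono fun Js => ?_
    rw [expect_pure]
    simp only [Option.some.injEq, exists_eq_left']
    have hS : (Js.zipIdx.map fun (Ji : ℕ × ℕ) =>
        if Ji.1 ≤ k ∧ ∃ v, (l.reduceOption.take (b * (k + 1)))[b * Ji.1 + Ji.2]?.bind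
          (fun w => w[Ji.1]?) = some v ∧ inT v = true
        then 1 / (b : ℝ) else 0) = Js.zipIdx.map fun Ji : ℕ × ℕ => if Hits k inT Ji.1
      (l.reduceOption.take (b * (k + 1)))[b * Ji.1 + Ji.2]? then 1 / (b : ℝ) else 0 := by
      refine List.map_congr_left fun Ji _ => ?_
      unfold Hits
      congr
    rw [hS]
    by_cases hs : |(Js.zipIdx.map fun Ji : ℕ × ℕ => if Hits k inT Ji.1
      (l.reduceOption.take (b * (k + 1)))[b * Ji.1 + Ji.2]? then 1 / (b : ℝ) else 0).sum - y| ≤ ε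
    · rw [if_pos hs]; exact zero_le
    · rw [if_neg hs, if_pos]
      by_contra hcon
      push Not at hcon
      refine hs ((abs_sub_le _ θ _).trans ?_)
      linarith
  · rw [add_zero]
    refine le_of_le_of_eq (expect_mono (ψ := fun _ => 1) fun o => ?_) (expect_const _ 1)
    split_ifs <;> simp

end Success

/-! ### The success probability -/

section SuccessProbability

theorem labelExpect_ofReal {E L : Type} [Fintype E] [Fintype L] {wt : L → ℝ} (hwt : ∀ c, 0 ≤ wt c)
    {φ : (E → L) → ℝ} (hφ : ∀ ℓ, 0 ≤ φ ℓ) :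
    labelExpect wt (fun ℓ => ENNReal.ofReal (φ ℓ)) = ENNReal.ofReal (labelSum wt φ) := by
  unfold labelExpect labelSum
  rw [ENNReal.ofReal_sum_of_nonneg fun ℓ _ =>
    mul_nonneg (Finset.prod_nonneg fun _ _ => hwt _) (hφ ℓ)]
  exact Finset.sum_congr rfl fun ℓ _ =>
    (ENNReal.ofReal_mul (Finset.prod_nonneg fun _ _ => hwt _)).symm

theorem labelExpect_mono {E L : Type} [Fintype E] [Fintype L] {wt : L → ℝ}
    {F F' : (E → L) → ℝ≥0∞} (h : ∀ ℓ, F ℓ ≤ F' ℓ) : labelExpect wt F ≤ labelExpect wt F' :=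
  Finset.sum_le_sum fun ℓ _ => mul_le_mul_right (h ℓ) _

theorem exp_neg_le_inv {x : ℝ} (hx : 0 ≤ x) : Real.exp (-x) ≤ 1 / (1 + x) := by
  rw [Real.exp_neg, ← one_div]
  exact one_div_le_one_div_of_le (by linarith) (by linarith [Real.add_one_le_exp x])

variable {n : ℕ} [NeZero n] {G : SimpleGraph (Fin n)}

/-- The sampling probabilities are right for most realizations of the stream. -/
theorem labelSum_good_ge {k : ℕ} {η κ τ : ℝ} (hG : ∀ v, ∃ w, G.Adj v w) (hη : 0 < η) (hη1 : η ≤ 1)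
    (hk : η * k ≤ 1) (hk0 : 0 < k) (hκ0 : 0 < κ) (hκ1 : κ ≤ 1)
    (hz : η * k * (2 ^ (k + 1) / κ) ^ 2 ≤ 1) (hτ : 0 < τ)
    (hδ : k * (2 ^ (k + 1) * (η * k) + κ) ≤ τ / 100)
    (hV : (η ^ k)⁻¹ * (2 * k ^ 2 / n) ≤ τ ^ 2 / 1000)
    (a : Fin n → (Fin k → G.edgeSet) → ℝ) (ha0 : ∀ u f, 0 ≤ a u f) (ha1 : ∀ u f, a u f ≤ 1) :
    1 - 12 / 1000 ≤ labelSum (labelWeight η k) (fun ℓ : G.edgeSet → Fin (k + 1) =>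
      if |matchedSum η a ℓ - walkSum k a| < τ ∧ |matchedSum η (fun _ _ => 1) ℓ - 1| < τ ∧
        overestimate η ℓ - matchedSum η (fun _ _ => 1) ℓ < τ then 1 else 0) := by
  have hwt := labelWeight_nonneg hη.le hk
  -- Chebyshev's inequality; it is used for `a` and for the constant 1, which governs the success
  -- probability.
  have hv : ∀ a : Fin n → (Fin k → G.edgeSet) → ℝ, (∀ u f, 0 ≤ a u f) → (∀ u f, a u f ≤ 1) →
      labelSum (labelWeight η k) (fun ℓ =>
        if τ ^ 2 ≤ (matchedSum η a ℓ - walkSum k a) ^ 2 then 1 else 0) ≤ 1 / 1000 := by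
    intro a h0 h1
    refine (labelSum_markov hwt (fun ℓ => sq_nonneg _) (by positivity)).trans ?_
    rw [div_le_iff₀ (by positivity)]
    have := labelSum_matchedSum_variance_le hη hη1 hk hG a h0 h1
    linarith
  have h1 := hv a ha0 ha1
  have h2 := hv (fun _ _ => 1) (fun _ _ => zero_le_one) fun _ _ => le_rfl
  rw [walkSum_one hG] at h2
  -- Markov's inequality applies because the difference is nonnegative, and its mean is at most `τ /
  -- 100` by `hδ`. The three exceptional probabilities add up to `12 / 1000`.
  have h3 : labelSum (labelWeight η k) (fun ℓ : G.edgeSet → Fin (k + 1) =>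
      if τ ≤ overestimate η ℓ - matchedSum η (fun _ _ => 1) ℓ then 1 else 0) ≤ 1 / 100 := by
    refine (labelSum_markov hwt (fun ℓ => ?_) hτ).trans ?_
    · have h := collectedSum_bounds hη hη1 hk (fun _ _ => 1) (fun _ _ => zero_le_one)
        (fun _ _ => le_rfl) ℓ
      exact h.1.trans h.2.1
    · rw [labelSum_sub, div_le_iff₀ hτ,
        show labelSum (labelWeight η k) (fun ℓ => matchedSum (G := G) η (fun _ _ => 1) ℓ) = 1 from
          (labelSum_matchedSum hη _).trans (walkSum_one hG k)]
      have := labelSum_overestimate_le (G := G) hη hk hG hk0 hκ0 hκ1 hz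
      linarith
  have h4 : labelSum (labelWeight η k) (fun ℓ : G.edgeSet → Fin (k + 1) => (1 : ℝ) -
      ((if τ ^ 2 ≤ (matchedSum η a ℓ - walkSum k a) ^ 2 then 1 else 0) +
      ((if τ ^ 2 ≤ (matchedSum η (fun _ _ => 1) ℓ - 1) ^ 2 then 1 else 0) +
      if τ ≤ overestimate η ℓ - matchedSum η (fun _ _ => 1) ℓ then 1 else 0))) ≤
      labelSum (labelWeight η k) (fun ℓ : G.edgeSet → Fin (k + 1) =>
      if |matchedSum η a ℓ - walkSum k a| < τ ∧ |matchedSum η (fun _ _ => 1) ℓ - 1| < τ ∧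
        overestimate η ℓ - matchedSum η (fun _ _ => 1) ℓ < τ then 1 else 0) := by
    refine labelSum_mono hwt fun ℓ => ?_
    have hab : ∀ x : ℝ, τ ^ 2 ≤ x ^ 2 ↔ ¬ |x| < τ := fun x => by
      rw [not_lt, ← sq_abs x, pow_le_pow_iff_left₀ hτ.le (abs_nonneg x) two_ne_zero]
    simp only [hab, ← not_lt (b := τ)]
    by_cases c1 : |matchedSum η a ℓ - walkSum k a| < τ <;>
    by_cases c2 : |matchedSum η (fun _ _ => 1) ℓ - 1| < τ <;>
    by_cases c3 : overestimate η ℓ - matchedSum η (fun _ _ => 1) ℓ < τ <;>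
    simp [c1, c2, c3]
  rw [labelSum_sub, labelSum_const (sum_labelWeight η k), labelSum_add, labelSum_add] at h4
  linarith

/-- The factor 100 in the number of runs puts the exponent above `49 N`, which absorbs the
union-type factor `2 ^ N ≤ exp N`. -/
theorem two_pow_mul_exp_le {N s q X : ℝ} {M : ℕ} (hM : (M : ℝ) = N) (hN : 100000 ≤ N) (hq : 0 < q)
    (hs : N * 100 * q⁻¹ ≤ s) (hX : 98 / 100 ≤ X) :
    (2 : ℝ) ^ M * Real.exp (-(s * (q * X) / 2)) ≤ 1 / 100 := by
  have hs1 : 49 * N ≤ s * (q * X) / 2 := by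
    calc 49 * N ≤ N * 100 * X / 2 := by nlinarith
      _ = N * 100 * q⁻¹ * (q * X) / 2 := by field_simp
      _ ≤ _ := by
          have : 0 ≤ q * X := mul_nonneg hq.le (by linarith)
          gcongr
  have h2 : (2 : ℝ) ^ M ≤ Real.exp N := by
    have h3 : (2 : ℝ) ≤ Real.exp 1 := by linarith [Real.add_one_le_exp 1]
    calc (2 : ℝ) ^ M ≤ Real.exp 1 ^ M := pow_le_pow_left₀ (by norm_num) h3 _
      _ = _ := by rw [← Real.exp_nat_mul, mul_one, hM]
  calc _ ≤ Real.exp N * Real.exp (-(49 * N)) := by gcongr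
    _ = Real.exp (-(48 * N)) := by rw [← Real.exp_add]; ring_nf
    _ ≤ 1 / (1 + 48 * N) := exp_neg_le_inv (by positivity)
    _ ≤ 1 / 100 := one_div_le_one_div_of_le (by norm_num) (by linarith)

/-- The algorithm succeeds with high probability on a fixed realization of the stream for which the
sampling probabilities are right. -/
theorem le_toOuterMeasure_of_good {k s : ℕ} {η D α ε y A : ℝ} (hη : 0 < η) (hη1 : η ≤ 1)
    (hk : η * k ≤ 1) (h₀ : 0 < α) (h₁ : α < 1) (hkα : walkLength α ε = k) (hε0 : 0 < ε)
    (hε1 : ε < 1 / 2) (hD : 100000 ≤ D)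
    (hs : ((⌈D / ε ^ 2⌉₊ * (k + 1) : ℕ) : ℝ) * 100 * (η ^ k)⁻¹ * (k.factorial : ℝ) ≤ s)
    (inT : Fin n → Bool) (ℓ : G.edgeSet → Fin (k + 1)) (hA0 : 0 ≤ A) (hA1 : A ≤ 1)
    (hA : |A - y| ≤ ε / 2)
    (g1 : |matchedSum η (hitWeight k α inT) ℓ - A| < ε / 64)
    (g2 : |matchedSum (G := G) η (fun _ _ => 1) ℓ - 1| < ε / 64)
    (g3 : overestimate η ℓ - matchedSum η (fun _ _ => 1) ℓ < ε / 64) :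
    ENNReal.ofReal (98 / 100) ≤ ((iid (runLaw (stamp η ℓ) η k) s).bind
        (estimate D α ε h₀ h₁ inT)).toOuterMeasure {o | ∃ x, o = some x ∧ |x - y| ≤ ε} := by
  have hbD : 100000 / ε ^ 2 ≤ (⌈D / ε ^ 2⌉₊ : ℝ) :=
    (div_le_div_of_nonneg_right hD (by positivity)).trans (Nat.le_ceil _)
  have hbε : 100000 ≤ (⌈D / ε ^ 2⌉₊ : ℝ) * ε ^ 2 := by rwa [div_le_iff₀ (by positivity)] at hbD
  have hb1 : (100000 : ℝ) ≤ ⌈D / ε ^ 2⌉₊ :=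
    hbε.trans (mul_le_of_le_one_right (Nat.cast_nonneg _) (by nlinarith))
  have hbpos : 0 < ⌈D / ε ^ 2⌉₊ := by
    have : (0 : ℝ) < ⌈D / ε ^ 2⌉₊ := by linarith
    exact_mod_cast this
  obtain ⟨b1, b2, -⟩ := collectedSum_bounds hη hη1 hk (hitWeight k α inT)
    (hitWeight_nonneg h₀ h₁ inT) (hitWeight_le_one h₀ h₁ inT) ℓ
  obtain ⟨b1', b2', -⟩ := collectedSum_bounds (G := G) hη hη1 hk (fun _ _ => 1)
    (fun _ _ => zero_le_one) (fun _ _ => le_rfl) ℓ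
  rw [abs_lt] at g1 g2
  have hX : 98 / 100 ≤ collectedSum (G := G) η (fun _ _ => 1) ℓ := by linarith
  have hX0 : 0 < collectedSum (G := G) η (fun _ _ => 1) ℓ := by linarith
  have hy : |collectedSum η (hitWeight k α inT) ℓ / collectedSum η (fun _ _ => 1) ℓ - y| ≤
      ε - ε / 8 := by
    -- Numerator and denominator are within `ε / 32` of `A` and 1, and the denominator is at least
    -- `0.98`. The error budget is `ε / 2` for truncation, `ε / 8` for this quotient and `ε / 8` for
    -- sampling.
    have hθ : |collectedSum η (hitWeight k α inT) ℓ / collectedSum η (fun _ _ => 1) ℓ - A| ≤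
        ε / 8 := by
      generalize collectedSum η (hitWeight k α inT) ℓ = Xa at *
      generalize collectedSum (G := G) η (fun _ _ => 1) ℓ = X at *
      rw [div_sub' hX0.ne', abs_div, abs_of_pos hX0, div_le_iff₀ hX0, abs_le]
      have e1 : |X - 1| ≤ ε / 32 := abs_le.2 ⟨by linarith, by linarith⟩
      have e2 := abs_le.1 ((abs_mul (X - 1) A).le.trans
        ((mul_le_of_le_one_right (abs_nonneg _) (abs_le.2 ⟨by linarith, hA1⟩)).trans e1))
      have e3 : ε / 8 * (98 / 100) ≤ ε / 8 * X := mul_le_mul_of_nonneg_left hX (by linarith)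
      constructor <;> linarith
    have := abs_sub_le (collectedSum η (hitWeight k α inT) ℓ / collectedSum η (fun _ _ => 1) ℓ)
      A y
    linarith
  have hfail := expect_estimate_failure_le hη hη1 hk h₀ h₁ hkα hbpos
    (show 0 < ε / 8 by linarith) (by linarith) inT ℓ hX0 hy s
  have hf1 := two_pow_mul_exp_le (M := ⌈D / ε ^ 2⌉₊ * (k + 1)) (s := s)
    (q := η ^ k / k.factorial) rfl (by
      push_cast
      exact hb1.trans (le_mul_of_one_le_right (Nat.cast_nonneg _)
        (by linarith [show (0 : ℝ) ≤ k from Nat.cast_nonneg k]))) (by positivity)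
      (le_of_eq_of_le (by field_simp) hs) hX
  have hf2 : 2 * Real.exp (-(⌈D / ε ^ 2⌉₊ * (ε / 8) ^ 2 / 4)) ≤ 1 / 100 := by
    -- The exponent is `b ε ^ 2 / 256`, and `100000 / 256 > 390`.
    have h3 : 390 ≤ ⌈D / ε ^ 2⌉₊ * (ε / 8) ^ 2 / 4 := by linarith
    have h4 := exp_neg_le_inv (show 0 ≤ ⌈D / ε ^ 2⌉₊ * (ε / 8) ^ 2 / 4 by positivity)
    have h5 : 1 / (1 + ⌈D / ε ^ 2⌉₊ * (ε / 8) ^ 2 / 4) ≤ 1 / 391 :=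
      one_div_le_one_div_of_le (by norm_num) (by linarith)
    linarith
  rw [← ENNReal.ofReal_add (by positivity) (by positivity)] at hfail
  have hfail' := hfail.trans (ENNReal.ofReal_le_ofReal (add_le_add hf1 hf2))
  rw [toOuterMeasure_eq_expect, expect_ite_not, expect_bind]
  calc ENNReal.ofReal (98 / 100) = 1 - ENNReal.ofReal (1 / 100 + 1 / 100) := by
        rw [← ENNReal.ofReal_one, ← ENNReal.ofReal_sub _ (by norm_num)]
        norm_num
    _ ≤ _ := by
        refine tsub_le_tsub_left (le_of_eq_of_le ?_ hfail') _
        refine congrArg _ (funext fun l => congrArg _ (funext fun o => ?_))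
        congr

/-- `ApproxPageRank` is accurate with probability at least `9 / 10`, if its parameters are in the
right range. -/
theorem nine_tenths_le_approxPageRankProb {C D α ε κ : ℝ} (h₀ : 0 < α) (h₁ : α < 1)
    (hG : ∀ v, ∃ w, G.Adj v w) (hε0 : 0 < ε) (hε1 : ε < 1 / 2)
    (hk0 : 0 < walkLength α ε) (hη : 0 < stepFraction C ε (walkLength α ε))
    (hk : stepFraction C ε (walkLength α ε) * walkLength α ε ≤ 1)
    (hκ0 : 0 < κ) (hκ1 : κ ≤ 1) (hz : stepFraction C ε (walkLength α ε) * walkLength α ε *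
      (2 ^ (walkLength α ε + 1) / κ) ^ 2 ≤ 1)
    (hδ : walkLength α ε * (2 ^ (walkLength α ε + 1) *
      (stepFraction C ε (walkLength α ε) * walkLength α ε) + κ) ≤ ε / 64 / 100)
    (hV : (stepFraction C ε (walkLength α ε) ^ walkLength α ε)⁻¹ *
      (2 * walkLength α ε ^ 2 / n) ≤ (ε / 64) ^ 2 / 1000)
    (hD : 100000 ≤ D) (htail : (1 - α) ^ (walkLength α ε + 1) ≤ ε / 2)
    (T : Finset (Fin n)) {p : Fin n → ℝ} (hp : IsPageRank G α p) :
    9 / 10 ≤ approxPageRankProb C D α ε h₀ h₁ G (fun v => decide (v ∈ T))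
      {o | ∃ y, o = some y ∧ |y - ∑ u ∈ T, p u| ≤ ε} := by
  rw [approxPageRankProb_eq h₀ h₁ _ _ hη hk]
  simp_rw [approxPageRank_eq]
  have hs := Nat.le_ceil (((⌈D / ε ^ 2⌉₊ * (walkLength α ε + 1) : ℕ) : ℝ) * 100 *
    (stepFraction C ε (walkLength α ε) ^ walkLength α ε)⁻¹ * ((walkLength α ε).factorial : ℝ))
  rw [runCount]
  generalize ⌈((⌈D / ε ^ 2⌉₊ * (walkLength α ε + 1) : ℕ) : ℝ) * 100 *
    (stepFraction C ε (walkLength α ε) ^ walkLength α ε)⁻¹ * ((walkLength α ε).factorial : ℝ)⌉₊ = s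
    at *
  generalize stepFraction C ε (walkLength α ε) = η at *
  generalize hkα : walkLength α ε = k at *
  have hk1 : (1 : ℝ) ≤ k := by exact_mod_cast hk0
  have hη1 : η ≤ 1 := (le_mul_of_one_le_right hη.le hk1).trans hk
  have hwt := labelWeight_nonneg hη.le hk
  have hA0 : 0 ≤ walkSum k (hitWeight (G := G) k α fun v => decide (v ∈ T)) :=
    walkSum_nonneg (hitWeight_nonneg h₀ h₁ _)
  have hA1 : walkSum k (hitWeight (G := G) k α fun v => decide (v ∈ T)) ≤ 1 := by
    rw [← walkSum_one hG k]
    exact walkSum_mono (hitWeight_le_one h₀ h₁ _)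
  have hA := hp.abs_truncation_le hG h₀ h₁ (k + 1) T
  rw [← walkSum_hitWeight hG k α T] at hA
  replace hA := hA.trans htail
  have hmain := labelSum_good_ge hG hη hη1 hk hk0 hκ0 hκ1 hz (show 0 < ε / 64 by linarith) hδ hV
    (hitWeight (G := G) k α fun v => decide (v ∈ T)) (hitWeight_nonneg h₀ h₁ _)
    (hitWeight_le_one h₀ h₁ _)
  have hgood := fun ℓ : G.edgeSet → Fin (k + 1) => le_toOuterMeasure_of_good (G := G) hη hη1 hk h₀ h₁
    hkα hε0 hε1 hD hs (fun v => decide (v ∈ T)) ℓ hA0 hA1 hA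
  generalize walkSum k (hitWeight (G := G) k α fun v => decide (v ∈ T)) = A at *
  calc (9 / 10 : ℝ≥0∞) = ENNReal.ofReal (9 / 10) := by
        rw [ENNReal.ofReal_div_of_pos (by norm_num)]; simp
    _ ≤ ENNReal.ofReal (labelSum (labelWeight η k) (fun ℓ : G.edgeSet → Fin (k + 1) => 98 / 100 *
        if |matchedSum η (hitWeight k α fun v => decide (v ∈ T)) ℓ - A| < ε / 64 ∧
          |matchedSum (G := G) η (fun _ _ => 1) ℓ - 1| < ε / 64 ∧
          overestimate η ℓ - matchedSum η (fun _ _ => 1) ℓ < ε / 64 then 1 else 0)) := by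
        rw [labelSum_const_mul]
        -- Numerically, `0.98 * (1 - 0.012)` exceeds `0.9`.
        exact ENNReal.ofReal_le_ofReal (by linarith)
    _ ≤ _ := by
        rw [← labelExpect_ofReal hwt fun ℓ => by split_ifs <;> norm_num]
        refine labelExpect_mono fun ℓ => ?_
        split_ifs with h
        · rw [mul_one]
          exact hgood ℓ h.1 h.2.1 h.2.2
        · simp

end SuccessProbability

/-! ### Parallel composition of random processes -/

section Parallel

theorem pmf_ext_expect {β : Type} {μ ν : PMF β} (h : ∀ φ, expect μ φ = expect ν φ) : μ = ν :=
  PMF.ext fun y => by rw [apply_eq_expect, apply_eq_expect, h]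

variable {β γ : Type}

/-- Independent samples from a family of laws. -/
def parallel {β : Type} : (s : ℕ) → (Fin s → PMF β) → PMF (Fin s → β)
  | 0, _ => PMF.pure Fin.elim0
  | s + 1, p => (p 0).bind fun x => (parallel s fun i => p i.succ).bind fun g =>
      PMF.pure (Fin.cons x g)

/-- Advancing all processes together, one step at a time, is the same as advancing each one
separately. This passes from the streaming order of computation to independent runs. -/
theorem parallel_bind (s : ℕ) (p : Fin s → PMF β) (K : β → PMF γ) :
    ((parallel s p).bind fun g => parallel s fun i => K (g i)) =
      parallel s fun i => (p i).bind K := by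
  induction s with
  | zero => simp [parallel]
  | succ s ih =>
    simp only [parallel, PMF.bind_bind, PMF.pure_bind, Fin.cons_zero, Fin.cons_succ]
    congr 1
    funext x
    rw [PMF.bind_comm]
    congr 1
    funext y
    rw [← ih, PMF.bind_bind]

theorem parallel_const (s : ℕ) (μ : PMF β) {δ : Type} (F : List β → PMF δ) :
    ((parallel s fun _ => μ).bind fun g => F (List.ofFn g)) = (iid μ s).bind F := by
  induction s generalizing F with
  | zero => simp [parallel, iid]
  | succ s ih =>
    simp only [parallel, iid, PMF.bind_bind, PMF.pure_bind]
    congr 1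
    funext x
    rw [← ih fun l => F (x :: l)]
    congr 1
    funext g
    rw [List.ofFn_succ]
    simp only [Fin.cons_zero, Fin.cons_succ]

end Parallel

/-! ### Reservoir sampling -/

section Reservoir

/-- A counter that stops at `m`. -/
def incr {m : ℕ} (c : Fin (m + 1)) : Fin (m + 1) :=
  ⟨min (c + 1) m, Nat.lt_succ_of_le (min_le_right _ _)⟩

variable {β γ : Type} {m : ℕ}

/-- One step of reservoir sampling. -/
def reservoirStep (e : γ) (p : γ × Fin (m + 1)) : PMF (γ × Fin (m + 1)) :=
  (coin (1 / ((p.2 : ℕ) + 1))).bind fun b => PMF.pure (if b then e else p.1, incr p.2)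

/-- Reservoir sampling from a list. -/
def reservoir : List γ → γ × Fin (m + 1) → PMF (γ × Fin (m + 1))
  | [], p => PMF.pure p
  | e :: l, p => (reservoirStep e p).bind (reservoir l)

theorem reservoir_append (l l' : List γ) (p : γ × Fin (m + 1)) :
    reservoir (l ++ l') p = (reservoir l p).bind (reservoir l') := by
  induction l generalizing p with
  | nil => simp [reservoir]
  | cons e l ih =>
    simp only [List.cons_append, reservoir, PMF.bind_bind]
    congr 1
    funext q
    exact ih q

theorem expect_coin_eq {a : ℝ} (h0 : 0 ≤ a) (h1 : a ≤ 1) (φ : Bool → ℝ≥0∞) :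
    expect (coin a) φ = ENNReal.ofReal a * φ true + ENNReal.ofReal (1 - a) * φ false := by
  rw [expect_eq_sum, Fintype.sum_bool]
  simp only [coin, PMF.ofFintype_apply, cond_true, cond_false]
  have h : ENNReal.ofReal a ≤ 1 := by
    rw [← ENNReal.ofReal_one]
    exact ENNReal.ofReal_le_ofReal h1
  rw [min_eq_left h, ENNReal.ofReal_sub _ h0, ENNReal.ofReal_one]

theorem expect_uniformOfFinset_eq (H : Finset β) (h : H.Nonempty) (φ : β → ℝ≥0∞) :
    expect (PMF.uniformOfFinset H h) φ = ENNReal.ofReal (1 / (H.card : ℝ)) * ∑ x ∈ H, φ x := by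
  unfold expect
  rw [tsum_eq_sum (s := H), Finset.mul_sum]
  · refine Finset.sum_congr rfl fun x hx => ?_
    rw [PMF.uniformOfFinset_apply_of_mem h hx, one_div,
      ENNReal.ofReal_inv_of_pos (by exact_mod_cast Finset.card_pos.2 h), ENNReal.ofReal_natCast]
  · intro x hx
    rw [PMF.uniformOfFinset_apply_of_notMem h hx, zero_mul]

/-- Reservoir sampling selects a uniformly random element. -/
theorem reservoir_eq_uniform [DecidableEq β] (g : β → γ) (l : List β) (hl : l.Nodup) (h : l.toFinset.Nonempty)
    (hm : l.length ≤ m) (x : γ) :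
    reservoir (l.map g) (x, (0 : Fin (m + 1))) = (PMF.uniformOfFinset l.toFinset h).bind fun e =>
      PMF.pure (g e, ⟨l.length, Nat.lt_succ_of_le hm⟩) := by
  induction l using List.reverseRecOn with
  | nil => simp at h
  | append_singleton l e ih =>
    rw [List.length_append, List.length_singleton] at hm
    have hincr : ∀ hlt, incr (⟨l.length, hlt⟩ : Fin (m + 1)) =
        ⟨(l ++ [e]).length, by rw [List.length_append, List.length_singleton]; omega⟩ := by
      intro hlt
      simp only [incr, List.length_append, List.length_singleton, Fin.mk.injEq]
      omega
    rw [List.map_append, reservoir_append]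
    simp only [List.map_cons, List.map_nil, reservoir, PMF.bind_pure]
    have hnd := List.nodup_append.1 hl
    -- The first element is accepted with probability `1 / (0 + 1)`, so the initial content `x` of
    -- the slot is irrelevant.
    by_cases hne : l = []
    · subst hne
      simp only [List.map_nil, reservoir, PMF.pure_bind, reservoirStep]
      refine pmf_ext_expect fun φ => ?_
      simp only [expect_bind, expect_pure]
      rw [expect_coin_eq (by positivity) (by simp), expect_uniformOfFinset_eq]
      have h0 : incr (0 : Fin (m + 1)) = ⟨1, by simp at hm; omega⟩ := by
        simp only [incr, Fin.mk.injEq]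
        simp at hm ⊢
        omega
      simp [h0]
    · have h' : l.toFinset.Nonempty := by simpa using hne
      rw [ih hnd.1 h' (by omega), PMF.bind_bind]
      refine pmf_ext_expect fun φ => ?_
      simp only [expect_bind, expect_pure, reservoirStep, expect_uniformOfFinset_eq, PMF.pure_bind,
        hincr]
      have hpos : (0 : ℝ) < l.length := by exact_mod_cast List.length_pos_iff.2 hne
      have hc : (l.toFinset.card : ℝ) = l.length := by
        rw [List.toFinset_card_of_nodup hnd.1]
      have hc' : ((l ++ [e]).toFinset.card : ℝ) = l.length + 1 := by
        rw [List.toFinset_card_of_nodup hl]; simp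
      have he : e ∉ l.toFinset := by
        have := hnd.2.2
        simp only [List.mem_toFinset]
        intro hmem
        exact this e hmem e (by simp) rfl
      have h1 : (1 : ℝ) / (l.length + 1) ≤ 1 := by
        rw [div_le_one (by positivity)]; linarith
      have e2 : (l ++ [e]).toFinset = insert e l.toFinset := by
        ext; simp
      simp_rw [expect_coin_eq (show (0 : ℝ) ≤ 1 / (l.length + 1) by positivity) h1]
      simp only [if_true, Bool.false_eq_true, if_false]
      rw [hc, hc', e2, Finset.sum_insert he, Finset.sum_add_distrib, Finset.sum_const,
        ← Finset.mul_sum, nsmul_eq_mul, mul_add, mul_add]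
      congr 1
      -- The new element has probability `1 / (len + 1)`; in the other summand an old one keeps `1 /
      -- len * (len / (len + 1))`, which is the same.
      · rw [← mul_assoc, ← mul_assoc, ← ENNReal.ofReal_natCast, ← ENNReal.ofReal_mul (by positivity),
          ← ENNReal.ofReal_mul (by positivity), List.toFinset_card_of_nodup hnd.1]
        congr 2
        field_simp
      · rw [← mul_assoc, ← ENNReal.ofReal_mul (by positivity)]
        congr 2
        field_simp
        ring

end Reservoir

/-! ### Simulating a run of `WalkFromTemplate` in small memory -/

/-- The memory of a run: the starting vertex, the template, for every round the state of
reservoir sampling, and for every vertex of the walk the number of its edges in the last part of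
the stream that are not on the walk. -/
structure RunState (n k m : ℕ) where
  start : Fin n
  template : Template k
  slots : Fin k → Sym2 (Fin n) × Fin (m + 1)
  tail : Fin k → Fin (m + 1)

/-- A step of a partial walk, without reference to the graph. -/
structure BareStep (n : ℕ) where
  vertex : Fin n
  edge : Sym2 (Fin n)
  gamma : ℝ

/-- A partial walk, without reference to the graph. -/
structure BareTrace (n : ℕ) where
  steps : List (BareStep n)
  current : Fin n

section Bare

variable {n : ℕ} {G : SimpleGraph (Fin n)}

/-- Append an edge to a partial walk. -/
def BareTrace.push (w : BareTrace n) (f : Sym2 (Fin n)) (γ : ℝ) : BareTrace n :=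
  { steps := w.steps ++ [⟨w.current, f, γ⟩], current := otherEnd f w.current }

/-- Forget that the edge of a step belongs to a graph. -/
def WalkStep.bare (s : WalkStep G) : BareStep n := ⟨s.vertex, s.edge, s.gamma⟩

/-- Forget that the edges of a partial walk belong to a graph. -/
def Trace.bare (w : Trace G) : BareTrace n := ⟨w.steps.map WalkStep.bare, w.current⟩

theorem Trace.bare_push (w : Trace G) (f : G.edgeSet) (γ : ℝ) :
    (w.push f γ).bare = w.bare.push f γ := by
  simp [Trace.bare, Trace.push, BareTrace.push, WalkStep.bare]

theorem Trace.map_edge_bare (w : Trace G) :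
    w.bare.steps.map BareStep.edge = (w.steps.map WalkStep.edge).map Subtype.val := by
  simp [Trace.bare, Function.comp_def, WalkStep.bare]

theorem Trace.map_vertex_bare (w : Trace G) :
    w.bare.steps.map BareStep.vertex = w.steps.map WalkStep.vertex := by
  simp [Trace.bare, Function.comp_def, WalkStep.bare]

theorem conforms_map {E F : Type} {g : E → F} (hg : Function.Injective g) {k : ℕ}
    (π : Template k) (f : List E) : Conforms π (f.map g) ↔ Conforms π f := by
  unfold Conforms
  simp only [List.getElem?_map, ne_eq, (Option.map_injective hg).eq_iff]

end Bare

/-! ### The recorded walk and its update rule. -/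

section Simulation

variable {n k m : ℕ} (η : ℝ)

/-- The state of reservoir sampling in round `j`. -/
def RunState.slotAt (st : RunState n k m) (j : ℕ) : Sym2 (Fin n) × Fin (m + 1) :=
  if h : j < k then st.slots ⟨j, h⟩ else (s(st.start, st.start), 0)

/-- The number of edges counted at the `j`-th vertex of the walk. -/
def RunState.tailAt (st : RunState n k m) (j : ℕ) : ℕ :=
  if h : j < k then st.tail ⟨j, h⟩ else 0

/-- Round `j` of the walk, as recorded in the memory. -/
def replayRound (st : RunState n k m) (j : ℕ) (w : BareTrace n) : Option (BareTrace n) :=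
  if templateEntry st.template j = j then
    if (st.slotAt j).2 = 0 then none
    else some (w.push (st.slotAt j).1 (1 / (((st.slotAt j).2 : ℕ) : ℝ) * η))
  else
    match w.steps[templateEntry st.template j]? with
    | none => none
    | some s => if w.current ∈ s.edge then some (w.push s.edge 1) else none

/-- The first `j` rounds of the walk, as recorded in the memory. -/
def replay (st : RunState n k m) : ℕ → Option (BareTrace n)
  | 0 => some ⟨[], st.start⟩
  | j + 1 => (replay st j).bind (replayRound η st j)

theorem replay_succ (st : RunState n k m) (j : ℕ) :
    replay η st (j + 1) = (replay η st j).bind (replayRound η st j) := rfl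

/-- The first `j` rounds read only earlier slots. Updating slot `j` while part `j` passes, or the
tail counters at the end, therefore does not disturb the walk being followed. -/
theorem replay_congr {st st' : RunState n k m} (h1 : st.start = st'.start)
    (h2 : st.template = st'.template) (j : ℕ)
    (h3 : ∀ i : Fin k, i.val < j → st.slots i = st'.slots i) :
    replay η st j = replay η st' j := by
  induction j with
  | zero => simp [replay, h1]
  | succ j ih =>
    rw [replay_succ, replay_succ, ih fun i hi => h3 i (by omega)]
    congr 1
    funext w
    have : st.slotAt j = st'.slotAt j := by
      unfold RunState.slotAt
      split_ifs with h
      · exact h3 _ (by simp)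
      · rw [h1]
    unfold replayRound
    rw [this, h2]

theorem length_of_replay (st : RunState n k m) (j : ℕ) (w : BareTrace n)
    (h : replay η st j = some w) : w.steps.length = j := by
  induction j generalizing w with
  | zero =>
    simp only [replay, Option.some.injEq] at h
    subst h
    rfl
  | succ j ih =>
    rw [replay_succ, Option.bind_eq_some_iff] at h
    obtain ⟨w', h1, h2⟩ := h
    have := ih w' h1
    have key : ∀ f γ, w'.push f γ = w → w.steps.length = j + 1 := by
      rintro f γ rfl
      simp [BareTrace.push, this]
    unfold replayRound at h2
    split_ifs at h2 with h3 h4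
    · exact key _ _ (Option.some.inj h2)
    · cases hs : w'.steps[templateEntry st.template j]? with
      | none => rw [hs] at h2; simp at h2
      | some s =>
        rw [hs] at h2
        simp only at h2
        split_ifs at h2
        exact key _ _ (Option.some.inj h2)

/-- Whether an edge of the last part of the stream counts for the `i`-th vertex of a walk. -/
def CountsFor (w : BareTrace n) (i : ℕ) (e : Sym2 (Fin n)) : Prop :=
  ∃ s, w.steps[i]? = some s ∧ s.vertex ∈ e ∧ e ∉ w.steps.map BareStep.edge

/-- The reaction of a run to an edge with label `c`. -/
def runStep (e : Sym2 (Fin n)) (c : Fin (k + 1)) (st : RunState n k m) : PMF (RunState n k m) :=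
  match replay η st c with
  | none => PMF.pure st
  | some w =>
    if h : c.val < k then
      if templateEntry st.template c = c ∧ w.current ∈ e then
        (reservoirStep e (st.slots ⟨c, h⟩)).bind fun p =>
          PMF.pure { st with slots := Function.update st.slots ⟨c, h⟩ p }
      else PMF.pure st
    else PMF.pure { st with
      tail := fun i => if CountsFor w i e then incr (st.tail i) else st.tail i }

/-- The reaction of a run to a list of labelled edges. -/
def runFold : List (Sym2 (Fin n) × Fin (k + 1)) → RunState n k m → PMF (RunState n k m)
  | [], st => PMF.pure st
  | x :: l, st => (runStep η x.1 x.2 st).bind (runFold l)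

theorem runFold_append (l l' : List (Sym2 (Fin n) × Fin (k + 1))) (st : RunState n k m) :
    runFold η (l ++ l') st = (runFold η l st).bind (runFold η l') := by
  induction l generalizing st with
  | nil => simp [runFold]
  | cons x l ih =>
    simp only [List.cons_append, runFold, PMF.bind_bind]
    congr 1
    funext st'
    exact ih st'

/-- The estimate for the degree of the `i`-th vertex of the recorded walk. -/
def bareDegree (st : RunState n k m) (w : BareTrace n) (u : Fin n) (i : ℕ) : ℕ :=
  ((w.steps.map BareStep.edge).toFinset.filter fun e => u ∈ e).card + st.tailAt i

/-- The probability with which the recorded walk is kept. -/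
def bareAccept (st : RunState n k m) (w : BareTrace n) : ℝ :=
  (w.steps.zipIdx.map fun x =>
    min (η / (x.1.gamma * bareDegree st w x.1.vertex x.2)) 1).prod

/-- The walk returned at the end of a run. -/
def runOut (st : RunState n k m) : PMF (Option (List (Fin n))) :=
  match replay η st k with
  | none => PMF.pure none
  | some w =>
      if Conforms st.template (w.steps.map BareStep.edge) then
        (coin (bareAccept η st w)).bind fun keep =>
          PMF.pure (if keep then some (w.steps.map BareStep.vertex ++ [w.current]) else none)
      else PMF.pure none

theorem runFold_last_none (l : List (Sym2 (Fin n))) (c : Fin (k + 1)) (st : RunState n k m)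
    (h : replay η st c = none) : runFold η (l.map fun e => (e, c)) st = PMF.pure st := by
  induction l with
  | nil => rfl
  | cons e l ih =>
    simp only [List.map_cons, runFold]
    rw [runStep, h, PMF.pure_bind, ih]

theorem runFold_repeat (l : List (Sym2 (Fin n))) (j : Fin k) (st : RunState n k m)
    (h : templateEntry st.template j ≠ j) :
    runFold η (l.map fun e => (e, j.castSucc)) st = PMF.pure st := by
  have hs : ∀ e, runStep η e j.castSucc st = PMF.pure st := by
    intro e
    unfold runStep
    cases replay η st (j.castSucc : Fin (k + 1)) with
    | none => rfl
    | some w => simp [h]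
  induction l with
  | nil => rfl
  | cons e l ih =>
    simp only [List.map_cons, runFold]
    rw [hs, PMF.pure_bind, ih]

/-- While part `j` passes, only slot `j` changes, and the current vertex does not depend on it. The
updates are therefore plain reservoir sampling among the edges at a fixed vertex. -/
theorem runFold_choose (l : List (Sym2 (Fin n))) (j : Fin k) (st : RunState n k m)
    (h : templateEntry st.template j = j) (w : BareTrace n) (hw : replay η st j = some w) :
    runFold η (l.map fun e => (e, j.castSucc)) st =
      (reservoir (l.filter fun e => w.current ∈ e) (st.slots j)).bind fun p =>
        PMF.pure { st with slots := Function.update st.slots j p } := by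
  induction l generalizing st with
  | nil => simp [runFold, reservoir]
  | cons e l ih =>
    simp only [List.map_cons, runFold]
    have hlt : (j.castSucc : Fin (k + 1)).val < k := j.2
    by_cases he : w.current ∈ e
    · rw [List.filter_cons_of_pos (by simpa using he)]
      have : runStep η e j.castSucc st = (reservoirStep e (st.slots j)).bind fun p =>
          PMF.pure { st with slots := Function.update st.slots j p } := by
        unfold runStep
        rw [Fin.val_castSucc, hw]
        simp [h, he]
      rw [this]
      simp only [reservoir, PMF.bind_bind, PMF.pure_bind]
      congr 1
      funext p
      rw [ih]
      · simp
      · exact h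
      · rw [← hw]
        refine replay_congr η (by rfl) (by rfl) _ fun i hi => ?_
        exact Function.update_of_ne (Fin.ne_of_lt hi) _ _
    · rw [List.filter_cons_of_neg (by simpa using he)]
      have : runStep η e j.castSucc st = PMF.pure st := by
        unfold runStep
        rw [Fin.val_castSucc, hw]
        simp [he]
      rw [this, PMF.pure_bind, ih st h hw]

/-- Once the walk is complete the last part is processed deterministically; `hm` keeps the counters
from saturating, so they are exact. -/
theorem runFold_tail (l : List (Sym2 (Fin n))) (st : RunState n k m) (w : BareTrace n)
    (hw : replay η st k = some w) (hm : ∀ i, (st.tail i : ℕ) + l.length ≤ m) :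
    ∃ tl : Fin k → Fin (m + 1),
      runFold η (l.map fun e => (e, Fin.last k)) st = PMF.pure { st with tail := tl } ∧
      ∀ i, (tl i : ℕ) = st.tail i + l.countP fun e => CountsFor w i e := by
  induction l generalizing st with
  | nil => exact ⟨st.tail, rfl, fun i => by simp⟩
  | cons e l ih =>
    simp only [List.map_cons, runFold]
    have : runStep η e (Fin.last k) st = PMF.pure { st with
        tail := fun i => if CountsFor w i e then incr (st.tail i) else st.tail i } := by
      unfold runStep
      rw [Fin.val_last, hw]
      simp
    rw [this, PMF.pure_bind]
    have hin : ∀ i : Fin k, ((if CountsFor w i e then incr (st.tail i) else st.tail i : Fin (m + 1)) : ℕ) =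
        st.tail i + if CountsFor w i e then 1 else 0 := by
      intro i
      have := hm i
      rw [List.length_cons] at this
      split_ifs
      · simp only [incr]; omega
      · rfl
    obtain ⟨tl, h1, h2⟩ := ih { st with
        tail := fun i => if CountsFor w i e then incr (st.tail i) else st.tail i }
      (by rw [← hw]; exact replay_congr η (by rfl) (by rfl) _ fun _ _ => by rfl) (by
        intro i
        have := hm i
        rw [List.length_cons] at this
        have h2 := hin i
        dsimp only
        split_ifs at h2 ⊢ <;> omega)
    refine ⟨tl, h1, fun i => ?_⟩
    rw [h2, List.countP_cons, hin]
    simp only [decide_eq_true_eq]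
    omega

end Simulation

/-! ### Faithfulness of the simulation. -/

section Law

variable {n k m : ℕ} {G : SimpleGraph (Fin n)} (t : G.edgeSet → unitInterval) (η : ℝ)

/-- What remains of `WalkFromTemplate` after `j` rounds if `d` more rounds follow. -/
def finishFrom (π : Template k) : ℕ → ℕ → Option (Trace G) → PMF (Option (List (Fin n)))
  | _, 0, o => finishWalk t η π o
  | j, d + 1, o => (optionRound t η j (templateEntry π j) o).bind (finishFrom π (j + 1) d)

theorem roundsLaw_bind_finishFrom (π : Template k) (u : Fin n) (j d : ℕ) :
    (roundsLaw t η (templateEntry π) u j).bind (finishFrom t η π j d) =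
      (roundsLaw t η (templateEntry π) u (j + d)).bind (finishWalk t η π) := by
  induction d generalizing j with
  | zero => rfl
  | succ d ih =>
    rw [show j + (d + 1) = j + 1 + d by omega, ← ih, roundsLaw_succ, PMF.bind_bind]
    rfl

/-- On a stream sorted by label, part `j` is an initial segment of what remains from part `j` on.
This drives the induction over rounds. -/
theorem filter_le_eq_append {β : Type} (f : β → ℕ) (l : List β)
    (hl : l.Pairwise fun a b => f a ≤ f b) (j : ℕ) :
    l.filter (fun e => j ≤ f e) =
      l.filter (fun e => f e = j) ++ l.filter fun e => j + 1 ≤ f e := by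
  induction l with
  | nil => rfl
  | cons a l ih =>
    rw [List.pairwise_cons] at hl
    have ih := ih hl.2
    rcases lt_trichotomy (f a) j with h | h | h
    · simp only [List.filter_cons, decide_eq_true_eq]
      rw [if_neg (by omega), if_neg (by omega), if_neg (by omega), ih]
    · simp only [List.filter_cons, decide_eq_true_eq]
      rw [if_pos (by omega), if_pos (by omega), if_neg (by omega), ih, List.cons_append]
    · have hnil : l.filter (fun e => f e = j) = [] := by
        rw [List.filter_eq_nil_iff]
        intro b hb
        have := hl.1 b hb
        simp only [decide_eq_true_eq]
        omega
      rw [hnil, List.nil_append] at ih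
      simp only [List.filter_cons, decide_eq_true_eq]
      rw [if_pos (by omega), if_neg (by omega), if_pos (by omega), hnil, ih, List.nil_append]

variable {t η}

theorem HasLabels.incidentEdges_eq {ℓ : G.edgeSet → Fin (k + 1)} (h : HasLabels η t ℓ)
    (j : Fin k) (u : Fin n) : incidentEdges t u (η * (j : ℕ)) (η * ((j : ℕ) + 1)) =
      Finset.univ.filter fun e : G.edgeSet => u ∈ (e : Sym2 (Fin n)) ∧ ℓ e = j.castSucc := by
  ext e
  simp only [incidentEdges, Finset.mem_filter, Finset.mem_univ, true_and, h.1 e j]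

/-- The edges counted by `d̂` split into walk edges, read off the record, and last-part edges off
the walk, counted by the tail. Excluding walk edges in `CountsFor` prevents double counting. -/
theorem HasLabels.bareDegree_eq {ℓ : G.edgeSet → Fin (k + 1)} (h : HasLabels η t ℓ)
    {l : List G.edgeSet} (hnd : l.Nodup) (hall : ∀ e, e ∈ l) (w : Trace G) (i : Fin k)
    (s : WalkStep G) (hs : w.steps[i.val]? = some s) (st : RunState n k m)
    (hst : (st.tail i : ℕ) = ((l.filter fun e => ℓ e = Fin.last k).map Subtype.val).countP
      fun e => CountsFor w.bare i e) :
    bareDegree st w.bare s.vertex i = degreeEstimate t η k w s.vertex := by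
  have h1 : ((w.bare.steps.map BareStep.edge).toFinset.filter fun e => s.vertex ∈ e) =
      (Finset.univ.filter fun e : G.edgeSet => s.vertex ∈ (e : Sym2 (Fin n)) ∧
        e ∈ w.steps.map WalkStep.edge).image Subtype.val := by
    rw [w.map_edge_bare]
    ext e
    simp only [Finset.mem_filter, List.mem_toFinset, List.mem_map (f := Subtype.val),
      Finset.mem_image, Finset.mem_univ, true_and]
    constructor
    · rintro ⟨⟨a, ha, rfl⟩, he⟩
      exact ⟨a, ⟨he, ha⟩, rfl⟩
    · rintro ⟨a, ⟨he, ha⟩, rfl⟩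
      exact ⟨⟨a, ha, rfl⟩, he⟩
  have hc : ∀ e : G.edgeSet, CountsFor w.bare i e ↔ s.vertex ∈ (e : Sym2 (Fin n)) ∧
      e ∉ w.steps.map WalkStep.edge := by
    intro e
    unfold CountsFor
    rw [w.map_edge_bare, List.mem_map_of_injective Subtype.val_injective]
    have : w.bare.steps[i.val]? = some s.bare := by simp [Trace.bare, hs]
    rw [this]
    simp [WalkStep.bare]
  have h2 : st.tailAt i = (Finset.univ.filter fun e : G.edgeSet => s.vertex ∈ (e : Sym2 (Fin n)) ∧
      e ∉ w.steps.map WalkStep.edge ∧ ℓ e = Fin.last k).card := by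
    unfold RunState.tailAt
    rw [dif_pos i.2]
    change (st.tail i : ℕ) = _
    rw [hst, List.countP_map, List.countP_eq_length_filter, List.filter_filter,
      ← List.toFinset_card_of_nodup (hnd.filter _)]
    congr 1
    ext e
    simp [hall, hc, and_assoc]
  unfold bareDegree degreeEstimate
  rw [h1, h2, Finset.card_image_of_injective _ Subtype.val_injective, ← Finset.card_union_of_disjoint]
  · congr 1
    ext e
    simp only [Finset.mem_union, Finset.mem_filter, Finset.mem_univ, true_and, h.2 e]
    tauto
  · rw [Finset.disjoint_left]
    intro e he he'
    simp only [Finset.mem_filter] at he he'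
    exact he'.2.2.1 he.2.2

theorem HasLabels.bareAccept_eq {ℓ : G.edgeSet → Fin (k + 1)} (h : HasLabels η t ℓ)
    {l : List G.edgeSet} (hnd : l.Nodup) (hall : ∀ e, e ∈ l) (w : Trace G)
    (hw : w.steps.length = k) (st : RunState n k m)
    (hst : ∀ i : Fin k, (st.tail i : ℕ) =
      ((l.filter fun e => ℓ e = Fin.last k).map Subtype.val).countP fun e => CountsFor w.bare i e) :
    bareAccept η st w.bare = acceptProb t η k w := by
  unfold bareAccept acceptProb
  conv_rhs => rw [← List.zipIdx_map_fst 0 w.steps, List.map_map]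
  rw [Trace.bare, List.zipIdx_map, List.map_map]
  congr 1
  refine List.map_congr_left fun x hx => ?_
  have hx' : w.steps[x.2]? = some x.1 := by
    rw [List.mem_zipIdx_iff_getElem?] at hx
    exact hx
  have hi : x.2 < k := by
    rw [← hw]
    exact (List.getElem?_eq_some_iff.1 hx').1
  have := h.bareDegree_eq hnd hall w ⟨x.2, hi⟩ x.1 hx' st (hst _)
  simp only [Function.comp, Prod.map, WalkStep.bare, id]
  rw [← this]
  rfl

/-- Induction on the number `d` of remaining rounds. The invariant is that the record replays to the
partial walk `o`, that the counters of the unused slots are 0, and that the tail counters are 0. -/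
theorem HasLabels.runFold_bind_runOut {ℓ : G.edgeSet → Fin (k + 1)} (h : HasLabels η t ℓ)
    {l : List G.edgeSet} (hnd : l.Nodup) (hall : ∀ e, e ∈ l)
    (hsort : l.Pairwise fun a b => ℓ a ≤ ℓ b) (hm : l.length ≤ m) (d j : ℕ) (hj : j + d = k)
    (st : RunState n k m) (o : Option (Trace G))
    (hslots : ∀ i : Fin k, j ≤ i.val → (st.slots i).2 = 0) (htail : ∀ i, st.tail i = 0)
    (ho : replay η st j = o.map Trace.bare) :
    (runFold η ((l.filter fun e => j ≤ (ℓ e : ℕ)).map fun e : G.edgeSet => ((e : Sym2 (Fin n)), ℓ e))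
      st).bind (runOut η) = finishFrom t η st.template j d o := by
  induction d generalizing j st o with
  | zero =>
    obtain rfl : j = k := hj
    have e1 : (l.filter fun e => j ≤ (ℓ e : ℕ)) = l.filter fun e => ℓ e = Fin.last j := by
      refine List.filter_congr fun e _ => ?_
      simp only [Fin.ext_iff, Fin.val_last, decide_eq_decide]
      have := (ℓ e).2
      omega
    have e2 : ((l.filter fun e => j ≤ (ℓ e : ℕ)).map fun e : G.edgeSet => ((e : Sym2 (Fin n)), ℓ e)) =
        ((l.filter fun e => ℓ e = Fin.last j).map Subtype.val).map fun e => (e, Fin.last j) := by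
      rw [e1, List.map_map]
      refine List.map_congr_left fun e he => ?_
      simp only [List.mem_filter, decide_eq_true_eq] at he
      simp [he.2]
    rw [e2, finishFrom]
    cases o with
    | none =>
      rw [runFold_last_none η _ _ _ (by simpa using ho), PMF.pure_bind, runOut, ho]
      rfl
    | some w =>
      obtain ⟨tl, h1, h2⟩ := runFold_tail η
        ((l.filter fun e => ℓ e = Fin.last j).map Subtype.val) st w.bare ho (by
          intro i
          rw [htail, List.length_map]
          exact (Nat.zero_add _).le.trans ((List.length_filter_le _ _).trans hm))
      rw [h1, PMF.pure_bind]
      have h3 : replay η { st with tail := tl } j = some w.bare := by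
        rw [← show replay η st j = some w.bare from ho]
        exact replay_congr η (by rfl) (by rfl) _ fun _ _ => by rfl
      have hlen : w.steps.length = j := by
        rw [← length_of_replay η _ _ _ h3]
        simp [Trace.bare]
      unfold runOut
      rw [h3]
      simp only [finishWalk]
      rw [h.bareAccept_eq hnd hall w hlen _ fun i => by simp [h2, htail], w.map_edge_bare,
        w.map_vertex_bare, conforms_map Subtype.val_injective]
      rfl
  | succ d ih =>
    have hjk : j < k := by omega
    set jj : Fin k := ⟨j, hjk⟩ with hjj
    have hfilt := filter_le_eq_append (fun e => (ℓ e : ℕ)) l hsort j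
    have e2 : ((l.filter fun e => (ℓ e : ℕ) = j).map fun e : G.edgeSet =>
        ((e : Sym2 (Fin n)), ℓ e)) =
        ((l.filter fun e => (ℓ e : ℕ) = j).map Subtype.val).map fun e => (e, jj.castSucc) := by
      rw [List.map_map]
      refine List.map_congr_left fun e he => ?_
      simp only [List.mem_filter, decide_eq_true_eq] at he
      simp [Fin.ext_iff, he.2, hjj]
    rw [hfilt, List.map_append, runFold_append, PMF.bind_bind, e2, finishFrom]
    have hnext : ∀ o' : Option (Trace G), replay η st (j + 1) = o'.map Trace.bare →
        (runFold η ((l.filter fun e => j + 1 ≤ (ℓ e : ℕ)).map fun e : G.edgeSet =>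
          ((e : Sym2 (Fin n)), ℓ e)) st).bind (runOut η) =
          finishFrom t η st.template (j + 1) d o' := fun o' ho' =>
      ih (j + 1) (by omega) st o' (fun i hi => hslots i (by omega)) htail ho'
    cases o with
    | none =>
      rw [runFold_last_none η _ _ _ (by simpa using ho), PMF.pure_bind, optionRound, PMF.pure_bind]
      exact hnext none (by rw [replay_succ, ho]; rfl)
    | some w =>
      have ho' : replay η st j = some w.bare := ho
      by_cases hr : templateEntry st.template j = j
      -- A new edge: the reservoir ends with a uniform element of `H` and the counter `|H|`, exactly
      -- the data of the round.
      · rw [runFold_choose η _ jj st hr w.bare ho', PMF.bind_bind]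
        have hfm : (((l.filter fun e => (ℓ e : ℕ) = j).map Subtype.val).filter
            fun e => w.bare.current ∈ e) =
            (l.filter fun e : G.edgeSet => w.current ∈ (e : Sym2 (Fin n)) ∧ (ℓ e : ℕ) = j).map
              Subtype.val := by
          rw [List.filter_map, List.filter_filter]
          congr 1
          refine List.filter_congr fun e _ => ?_
          simp [Trace.bare]
          congr
        rw [hfm]
        set L := l.filter fun e : G.edgeSet => w.current ∈ (e : Sym2 (Fin n)) ∧ (ℓ e : ℕ) = j
          with hL
        have hLH : L.toFinset = incidentEdges t w.current (η * j) (η * (j + 1)) := by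
          have := h.incidentEdges_eq jj w.current
          simp only [hjj] at this
          rw [this]
          ext e
          simp [hL, hall, Fin.ext_iff]
        have hcard : (incidentEdges t w.current (η * j) (η * (j + 1))).card = L.length := by
          rw [← hLH, List.toFinset_card_of_nodup (hnd.filter _)]
        have hslot : st.slots jj = ((st.slots jj).1, 0) := by
          rw [← hslots jj le_rfl]
        have hwr : optionRound t η j (templateEntry st.template j) (some w) =
            if h : L.toFinset.Nonempty then (PMF.uniformOfFinset L.toFinset h).bind fun f =>
              PMF.pure (some (w.push f (1 / (L.length : ℝ) * η))) else PMF.pure none := by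
          simp only [optionRound, walkRound, hr, if_true, hcard]
          simp only [hLH]
        rw [hwr]
        by_cases hne : L.toFinset.Nonempty
        · rw [dif_pos hne, hslot, reservoir_eq_uniform _ _ (hnd.filter _) hne
            ((List.length_filter_le _ _).trans hm)]
          simp only [PMF.bind_bind, PMF.pure_bind]
          congr 1
          funext f
          have hL0 : L.length ≠ 0 := by
            intro h0
            rw [List.length_eq_zero_iff] at h0
            simp [h0] at hne
          refine ih (j + 1) (by omega) _ _ (fun i hi => ?_) htail ?_
          · dsimp only
            rw [Function.update_of_ne (by intro h; rw [h] at hi; simp [hjj] at hi)]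
            exact hslots i (by omega)
          · rw [replay_succ, replay_congr η (st' := st) (by rfl) (by rfl) j fun i hi =>
              Function.update_of_ne (Fin.ne_of_lt hi) _ _, ho']
            simp only [Option.bind_some, Option.map_some, Trace.bare_push]
            unfold replayRound RunState.slotAt
            rw [if_pos hr, dif_pos hjk]
            simp only [← hjj, Function.update_self]
            rw [if_neg]
            exact fun h0 => hL0 (Fin.ext_iff.1 h0)
        -- With no candidates the counter stays 0, which the replay reads as failure.
        · have hnil : L = [] := by simpa using hne
          rw [dif_neg hne, hnil]
          simp only [List.map_nil, reservoir, PMF.pure_bind, Function.update_eq_self]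
          refine hnext none ?_
          rw [replay_succ, ho']
          have hsl : (st.slotAt j).2 = 0 := by
            rw [RunState.slotAt, dif_pos hjk]
            exact hslots jj le_rfl
          simp only [Option.bind_some, replayRound]
          rw [if_pos hr, if_pos hsl]
          rfl
      -- A repeated edge: part `j` is ignored, and the outcome is determined by the record so far.
      · rw [runFold_repeat η _ jj st hr, PMF.pure_bind]
        simp only [optionRound, walkRound]
        rw [if_neg hr]
        have hrep : replay η st (j + 1) = replayRound η st j w.bare := by
          rw [replay_succ, ho']
          rfl
        have hget : w.bare.steps[templateEntry st.template j]? =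
            (w.steps[templateEntry st.template j]?).map WalkStep.bare := by
          simp [Trace.bare]
        unfold replayRound at hrep
        rw [if_neg hr, hget] at hrep
        cases hs : w.steps[templateEntry st.template j]? with
        | none =>
          rw [hs] at hrep
          rw [PMF.pure_bind]
          exact hnext none hrep
        | some s =>
          rw [hs] at hrep
          simp only [Option.map_some] at hrep
          by_cases hmem : w.current ∈ (s.edge : Sym2 (Fin n))
          · simp only [hmem, if_true, PMF.pure_bind]
            refine hnext _ (hrep.trans ?_)
            rw [if_pos (by exact hmem), Option.map_some, Trace.bare_push]
            rfl
          · simp only [hmem, if_false, PMF.pure_bind]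
            refine hnext _ (hrep.trans ?_)
            rw [if_neg (by exact hmem)]
            rfl

/-- The initial memory of a run. -/
def initRun [NeZero n] (k m : ℕ) : PMF (RunState n k m) :=
  (PMF.uniformOfFintype (Fin n)).bind fun u =>
    (PMF.uniformOfFintype (Template k)).bind fun π =>
      PMF.pure ⟨u, π, fun _ => (s(u, u), 0), fun _ => 0⟩

/-- The simulation of a run, on a stream sorted by labels, is faithful. -/
theorem HasLabels.initRun_bind [NeZero n] {ℓ : G.edgeSet → Fin (k + 1)} (h : HasLabels η t ℓ)
    {l : List G.edgeSet} (hnd : l.Nodup) (hall : ∀ e, e ∈ l)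
    (hsort : l.Pairwise fun a b => ℓ a ≤ ℓ b) (hm : l.length ≤ m) :
    ((initRun k m).bind (runFold η (l.map fun e : G.edgeSet => ((e : Sym2 (Fin n)), ℓ e)))).bind
      (runOut η) = runLaw t η k := by
  unfold initRun runLaw
  simp only [PMF.bind_bind, PMF.pure_bind]
  congr 1
  funext u
  congr 1
  funext π
  have := h.runFold_bind_runOut hnd hall hsort hm k 0 (by omega)
    ⟨u, π, fun _ => (s(u, u), 0), fun _ => 0⟩ (some ⟨[], u⟩) (fun _ _ => rfl) (fun _ => rfl) rfl
  have hf : (l.filter fun e => 0 ≤ (ℓ e : ℕ)) = l := List.filter_eq_self.2 fun e _ => by simp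
  rw [hf] at this
  rw [this, walkFromTemplate_eq]
  have h2 := roundsLaw_bind_finishFrom t η π u 0 k
  rw [Nat.zero_add] at h2
  rw [← h2, roundsLaw, List.range_zero, List.foldl_nil, PMF.pure_bind]

end Law

/-! ### The streaming algorithm -/

section Algorithm

/-- The memory of a run as a tuple. -/
def RunState.equiv (n k m : ℕ) : RunState n k m ≃
    Fin n × Template k × (Fin k → Sym2 (Fin n) × Fin (m + 1)) × (Fin k → Fin (m + 1)) where
  toFun st := (st.start, st.template, st.slots, st.tail)
  invFun x := ⟨x.1, x.2.1, x.2.2.1, x.2.2.2⟩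
  left_inv _ := rfl
  right_inv _ := rfl

instance (n k m : ℕ) : Fintype (RunState n k m) := Fintype.ofEquiv _ (RunState.equiv n k m).symm

/-- The law of independent labels. -/
def labelLaw {E L : Type} [Fintype E] [Fintype L] (wt : L → ℝ) (h0 : ∀ c, 0 ≤ wt c)
    (h1 : ∑ c, wt c = 1) : PMF (E → L) :=
  PMF.ofFintype (fun ℓ => ENNReal.ofReal (∏ e, wt (ℓ e))) (by
    have := labelSum_const (E := E) h1 1
    unfold labelSum at this
    simp only [mul_one] at this
    rw [← ENNReal.ofReal_sum_of_nonneg fun _ _ => Finset.prod_nonneg fun _ _ => h0 _, this,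
      ENNReal.ofReal_one])

theorem expect_labelLaw {E L : Type} [Fintype E] [Fintype L] (wt : L → ℝ) (h0 : ∀ c, 0 ≤ wt c)
    (h1 : ∑ c, wt c = 1) (φ : (E → L) → ℝ≥0∞) :
    expect (labelLaw wt h0 h1) φ = labelExpect wt φ := expect_eq_sum _ _

variable {n k m s : ℕ}

/-- The label of the edge at a position of the stream. -/
def labelAt (f : Fin m → Fin (k + 1)) (i : ℕ) : Fin (k + 1) :=
  if h : i < m then f ⟨i, h⟩ else Fin.last k

/-- The edges of the stream with their labels, from position `p` on. -/
def withLabels (f : Fin m → Fin (k + 1)) (p : ℕ) (l : List (Sym2 (Fin n))) :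
    List (Sym2 (Fin n) × Fin (k + 1)) :=
  (l.zipIdx p).map fun x => (x.1, labelAt f x.2)

/-- The memory of the streaming algorithm: the position in the stream, the sorted labels, and the
memory of the runs. -/
abbrev AlgState (n k m s : ℕ) : Type :=
  Fin (m + 1) × { f : Fin m → Fin (k + 1) // Monotone f } × (Fin s → RunState n k m)

/-- The reaction of the streaming algorithm to an edge. -/
def algStep (η : ℝ) (e : Sym2 (Fin n)) (x : AlgState n k m s) : PMF (AlgState n k m s) :=
  (parallel s fun i => runStep η e (labelAt x.2.1.val x.1) (x.2.2 i)).bind fun R =>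
    PMF.pure (incr x.1, x.2.1, R)

/-- The streaming algorithm that makes `s` runs of `WalkFromTemplate` and processes the list of
their results with `out`. -/
def walkAlg [NeZero n] (η : ℝ) (k m s : ℕ) (h0 : ∀ c, 0 ≤ labelWeight η k c)
    (h1 : ∑ c, labelWeight η k c = 1)
    (out : (Fin n → Bool) → List (Option (List (Fin n))) → PMF (Option ℝ)) : StreamAlg n where
  State := AlgState n k m s
  fintype := inferInstance
  init := (labelLaw (E := Fin m) (labelWeight η k) h0 h1).bind fun f =>
    (parallel s fun _ => initRun k m).bind fun R =>
      PMF.pure (0, ⟨f ∘ Tuple.sort f, Tuple.monotone_sort f⟩, R)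
  step := algStep η
  output inT x := (parallel s fun i => runOut η (x.2.2 i)).bind fun g => out inT (List.ofFn g)

theorem foldl_bind_eq {α β : Type} (F : α → β → PMF β) (l : List α) (μ : PMF β) :
    l.foldl (fun μ x => μ.bind (F x)) μ =
      μ.bind fun y => l.foldl (fun μ x => μ.bind (F x)) (PMF.pure y) := by
  induction l generalizing μ with
  | nil => simp
  | cons x l ih =>
    simp only [List.foldl_cons, PMF.pure_bind]
    rw [ih, PMF.bind_bind]
    congr 1
    funext y
    exact (ih _).symm

theorem StreamAlg.run_eq (A : StreamAlg n) (l : List (Sym2 (Fin n))) (inT : Fin n → Bool) :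
    A.run l inT = A.init.bind fun x =>
      (l.foldl (fun μ e => μ.bind (A.step e)) (PMF.pure x)).bind (A.output inT) := by
  unfold StreamAlg.run
  rw [foldl_bind_eq A.step, PMF.bind_bind]

/-- Given the labels, the runs evolve independently, so the loop over edges outside and runs inside
can be exchanged. The position counter stays exact by `hx`. -/
theorem foldl_algStep (η : ℝ) (l : List (Sym2 (Fin n))) (x : AlgState n k m s)
    (hx : (x.1 : ℕ) + l.length ≤ m) :
    l.foldl (fun μ e => μ.bind (algStep η e)) (PMF.pure x) =
      (parallel s fun i => runFold η (withLabels x.2.1.val x.1 l) (x.2.2 i)).bind fun R =>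
        PMF.pure (⟨x.1 + l.length, Nat.lt_succ_of_le hx⟩, x.2.1, R) := by
  induction l generalizing x with
  | nil =>
    have := parallel_bind s (fun i => PMF.pure (x.2.2 i)) fun r => PMF.pure r
    have hp : ∀ (s : ℕ) (R : Fin s → RunState n k m), parallel s (fun i => PMF.pure (R i)) =
        PMF.pure R := by
      intro s R
      induction s with
      | zero => simp only [parallel]; congr 1; exact Subsingleton.elim _ _
      | succ s ih =>
        simp only [parallel, PMF.pure_bind]
        rw [ih fun i => R i.succ, PMF.pure_bind]
        congr 1
        exact Fin.cons_self_tail R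
    simp [withLabels, runFold, hp]
  | cons e l ih =>
    rw [List.length_cons] at hx
    rw [List.foldl_cons, PMF.pure_bind, foldl_bind_eq]
    simp only [algStep, PMF.bind_bind, PMF.pure_bind]
    have hi : ((incr x.1 : Fin (m + 1)) : ℕ) = x.1 + 1 := by
      simp only [incr]
      omega
    simp only [withLabels, List.zipIdx_cons, List.map_cons, runFold]
    rw [← parallel_bind s (fun i => runStep η e (labelAt x.2.1.val x.1) (x.2.2 i)), PMF.bind_bind]
    congr 1
    funext R
    change l.foldl (fun μ e => μ.bind (algStep η e)) (PMF.pure (incr x.1, x.2.1, R)) = _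
    rw [ih (incr x.1, x.2.1, R) (by dsimp only; omega)]
    simp only [withLabels, hi]
    congr 1
    funext R'
    congr 2
    simp only [Fin.mk.injEq, List.length_cons]
    omega

theorem walkAlg_run [NeZero n] (η : ℝ) (h0 : ∀ c, 0 ≤ labelWeight η k c)
    (h1 : ∑ c, labelWeight η k c = 1)
    (out : (Fin n → Bool) → List (Option (List (Fin n))) → PMF (Option ℝ))
    (l : List (Sym2 (Fin n))) (hl : l.length ≤ m) (inT : Fin n → Bool) :
    (walkAlg η k m s h0 h1 out).run l inT =
      (labelLaw (E := Fin m) (labelWeight η k) h0 h1).bind fun f =>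
        (iid (((initRun k m).bind (runFold η (withLabels (f ∘ Tuple.sort f) 0 l))).bind
          (runOut η)) s).bind (out inT) := by
  rw [StreamAlg.run_eq]
  change ((labelLaw (E := Fin m) (labelWeight η k) h0 h1).bind fun f =>
    (parallel s fun _ => initRun k m).bind fun R =>
      PMF.pure ((0, ⟨f ∘ Tuple.sort f, Tuple.monotone_sort f⟩, R) : AlgState n k m s)).bind
    (fun x => (l.foldl (fun μ e => μ.bind (algStep η e)) (PMF.pure x)).bind fun y =>
      (parallel s fun i => runOut η (y.2.2 i)).bind fun g => out inT (List.ofFn g)) = _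
  simp only [PMF.bind_bind, PMF.pure_bind]
  congr 1
  funext f
  rw [← parallel_const, ← parallel_bind, PMF.bind_bind]
  congr 1
  funext R
  rw [← parallel_bind, foldl_algStep η l _ (by simpa using hl)]
  simp only [PMF.bind_bind, PMF.pure_bind]
  rfl

theorem labelExpect_comp_equiv {E F L : Type} [Fintype E] [Fintype F] [Fintype L] (wt : L → ℝ)
    (e : E ≃ F) (H : (E → L) → ℝ≥0∞) :
    labelExpect wt (fun f : F → L => H (f ∘ e)) = labelExpect wt H := by
  unfold labelExpect
  refine Fintype.sum_equiv (e.symm.arrowCongr (Equiv.refl L)) _ _ fun f => ?_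
  have : (e.symm.arrowCongr (Equiv.refl L)) f = f ∘ e := by
    ext x
    simp [Equiv.arrowCongr]
  rw [this]
  congr 2
  exact (e.prod_comp fun x => wt (f x)).symm

/-- Sorting independent labels and assigning them in a uniformly random order gives independent
labels. -/
theorem expect_sorted_labels {E : Type} [Fintype E] [Fintype (Equiv.Perm E)] (en : E ≃ Fin m) (wt : Fin (k + 1) → ℝ)
    (H : (E → Fin (k + 1)) → ℝ≥0∞) :
    expect (PMF.uniformOfFintype (Equiv.Perm E)) (fun σ =>
      labelExpect wt fun f : Fin m → Fin (k + 1) => H fun e => f (Tuple.sort f (en (σ.symm e)))) =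
    labelExpect wt H := by
  -- For fixed `f`, inverting `σ` and composing with the sorting permutation, transported to `E`, is
  -- a bijection of the permutations of `E`. The sorting is thus absorbed by the random order; what
  -- remains is an arbitrary bijective assignment of independent labels.
  have h1 : ∀ f : Fin m → Fin (k + 1),
      ∑ σ : Equiv.Perm E, H (fun e => f (Tuple.sort f (en (σ.symm e)))) =
        ∑ τ : Equiv.Perm E, H (f ∘ (τ.trans en)) := by
    intro f
    refine Fintype.sum_equiv ((Equiv.inv (Equiv.Perm E)).trans
      (Equiv.mulLeft ((en.trans (Tuple.sort f)).trans en.symm : Equiv.Perm E))) _ _ fun σ => ?_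
    congr 1
    funext e
    simp
  have h2 : ∑ σ : Equiv.Perm E, labelExpect wt (fun f : Fin m → Fin (k + 1) =>
      H fun e => f (Tuple.sort f (en (σ.symm e)))) =
      ∑ τ : Equiv.Perm E, labelExpect wt fun f : Fin m → Fin (k + 1) => H (f ∘ (τ.trans en)) := by
    unfold labelExpect
    rw [Finset.sum_comm]
    conv_rhs => rw [Finset.sum_comm]
    refine Finset.sum_congr rfl fun f _ => ?_
    rw [← Finset.mul_sum, ← Finset.mul_sum, h1]
  rw [expect_uniformOfFintype, h2]
  simp_rw [labelExpect_comp_equiv]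
  rw [Finset.sum_const, Finset.card_univ, nsmul_eq_mul, ← mul_assoc, ← ENNReal.ofReal_natCast,
    ← ENNReal.ofReal_mul (by positivity), one_div_mul_cancel, ENNReal.ofReal_one, one_mul]
  exact_mod_cast Fintype.card_ne_zero

/-- For a fixed order `σ`, the edge at position `i` receives the `i`-th smallest label. The stream
is then sorted by a labeling of the edges, and the simulation of a run is faithful for it. -/
theorem walkAlg_run_sorted [NeZero n] {η : ℝ} (hη : 0 < η) (hk : η * k ≤ 1)
    {G : SimpleGraph (Fin n)} {E : List G.edgeSet} (hnd : E.Nodup) (hall : ∀ e, e ∈ E)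
    (hlen : E.length = m) (en : G.edgeSet ≃ Fin m)
    (hen : ∀ (i : ℕ) (h : i < E.length), (en E[i] : ℕ) = i) (σ : Equiv.Perm G.edgeSet)
    (f : Fin m → Fin (k + 1)) :
    ((initRun k m).bind (runFold η (withLabels (f ∘ Tuple.sort f) 0
      (E.map fun e => (σ e : Sym2 (Fin n)))))).bind (runOut η) =
    runLaw (stamp η fun e : G.edgeSet => f (Tuple.sort f (en (σ.symm e)))) η k := by
  have hlab : withLabels (f ∘ Tuple.sort f) 0 (E.map fun e => (σ e : Sym2 (Fin n))) =
      (E.map σ).map fun e : G.edgeSet =>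
        ((e : Sym2 (Fin n)), f (Tuple.sort f (en (σ.symm e)))) := by
    unfold withLabels
    rw [List.zipIdx_map, List.map_map, List.map_map]
    conv_rhs => rw [← List.zipIdx_map_fst 0 E, List.map_map]
    refine List.map_congr_left fun x hx => ?_
    rw [List.mem_zipIdx_iff_getElem?, List.getElem?_eq_some_iff] at hx
    obtain ⟨hi, hx⟩ := hx
    have h3 := hen _ hi
    rw [hx] at h3
    have h4 : x.2 < m := by rw [← hlen]; exact hi
    simp only [Function.comp, Prod.map, Equiv.symm_apply_apply, labelAt, id]
    rw [dif_pos h4]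
    congr 3
    exact Fin.ext h3.symm
  have hsort : (E.map σ).Pairwise fun a b =>
      f (Tuple.sort f (en (σ.symm a))) ≤ f (Tuple.sort f (en (σ.symm b))) := by
    rw [List.pairwise_map, List.pairwise_iff_getElem]
    intro i j hi hj hij
    simp only [Equiv.symm_apply_apply]
    refine Tuple.monotone_sort f ?_
    rw [Fin.le_def, hen, hen]
    exact hij.le
  rw [hlab]
  exact (hasLabels_stamp hη hk _).initRun_bind (m := m) (hnd.map σ.injective)
    (fun e => List.mem_map.2 ⟨σ.symm e, hall _, by simp⟩) hsort (by rw [List.length_map, hlen])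

theorem exists_enumeration {E : Type} (l : List E) (hnd : l.Nodup) (hall : ∀ e, e ∈ l)
    (hlen : l.length = m) :
    ∃ en : E ≃ Fin m, ∀ (i : ℕ) (h : i < l.length), (en l[i] : ℕ) = i := by
  subst hlen
  refine ⟨(List.Nodup.getEquivOfForallMemList l hnd hall).symm, fun i h => ?_⟩
  have : (List.Nodup.getEquivOfForallMemList l hnd hall).symm l[i] = ⟨i, h⟩ := by
    rw [Equiv.symm_apply_eq]
    rfl
  rw [this]

theorem walkAlg_expect_run [NeZero n] {η : ℝ} (hη : 0 < η) (hk : η * k ≤ 1)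
    (h0 : ∀ c, 0 ≤ labelWeight η k c) (h1 : ∑ c, labelWeight η k c = 1)
    (out : (Fin n → Bool) → List (Option (List (Fin n))) → PMF (Option ℝ))
    {G : SimpleGraph (Fin n)} [Fintype (Equiv.Perm G.edgeSet)] {E : List G.edgeSet}
    (hnd : E.Nodup) (hall : ∀ e, e ∈ E) (hlen : E.length = m) (inT : Fin n → Bool)
    (S : Set (Option ℝ)) :
    ((PMF.uniformOfFintype (Equiv.Perm G.edgeSet)).bind fun σ =>
      (walkAlg η k m s h0 h1 out).run (E.map fun e => (σ e : Sym2 (Fin n))) inT).toOuterMeasure S =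
      labelExpect (labelWeight η k) fun ℓ : G.edgeSet → Fin (k + 1) =>
        ((iid (runLaw (stamp η ℓ) η k) s).bind (out inT)).toOuterMeasure S := by
  obtain ⟨en, hen⟩ := exists_enumeration _ hnd hall hlen
  rw [toOuterMeasure_eq_expect, expect_bind, ← expect_sorted_labels en]
  congr 1
  funext σ
  rw [walkAlg_run (m := m) η h0 h1 out _ (by
    rw [List.length_map]
    exact hlen.le), expect_bind, expect_labelLaw]
  congr 1
  funext f
  rw [← toOuterMeasure_eq_expect, walkAlg_run_sorted hη hk hnd hall hlen en hen σ f]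

theorem walkAlg_runRandomOrder [NeZero n] {η : ℝ} (hη : 0 < η) (hk : η * k ≤ 1)
    (h0 : ∀ c, 0 ≤ labelWeight η k c) (h1 : ∑ c, labelWeight η k c = 1)
    (out : (Fin n → Bool) → List (Option (List (Fin n))) → PMF (Option ℝ))
    (G : SimpleGraph (Fin n)) (hm : Nat.card G.edgeSet = m) (inT : Fin n → Bool)
    (S : Set (Option ℝ)) :
    ((walkAlg η k m s h0 h1 out).runRandomOrder G inT).toOuterMeasure S =
      labelExpect (labelWeight η k) fun ℓ : G.edgeSet → Fin (k + 1) =>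
        ((iid (runLaw (stamp η ℓ) η k) s).bind (out inT)).toOuterMeasure S := by
  unfold StreamAlg.runRandomOrder
  exact walkAlg_expect_run hη hk h0 h1 out (Finset.nodup_toList _) (fun e => by simp)
    (by rw [Finset.length_toList, Finset.card_univ, ← hm, Nat.card_eq_fintype_card]) inT S

end Algorithm

/-! ### The memory of the streaming algorithm -/

section Memory

variable {n k m s : ℕ}

theorem le_iff_lt_card_of_monotone {f : Fin m → Fin (k + 1)} (hf : Monotone f) (i : Fin m)
    (c : Fin (k + 1)) : f i ≤ c ↔ (i : ℕ) < (Finset.univ.filter fun i' => f i' ≤ c).card := by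
  constructor
  · intro h
    have : Finset.Iic i ⊆ Finset.univ.filter fun i' => f i' ≤ c := by
      intro i' hi'
      simp only [Finset.mem_filter, Finset.mem_univ, true_and]
      exact (hf (Finset.mem_Iic.1 hi')).trans h
    have h2 := Finset.card_le_card this
    rw [Fin.card_Iic] at h2
    omega
  · intro h
    by_contra hc
    have : (Finset.univ.filter fun i' => f i' ≤ c) ⊆ Finset.Iio i := by
      intro i' hi'
      simp only [Finset.mem_filter, Finset.mem_univ, true_and] at hi'
      rw [Finset.mem_Iio]
      by_contra hlt
      exact hc ((hf (not_lt.1 hlt)).trans hi')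
    have h2 := Finset.card_le_card this
    rw [Fin.card_Iio] at h2
    omega

/-- A sorted label sequence is determined by its `k` cut points, the numbers of labels at most `j`
for `j < k`. -/
theorem card_monotone_le :
    Fintype.card { f : Fin m → Fin (k + 1) // Monotone f } ≤ (m + 1) ^ k := by
  have hinj : Function.Injective fun (f : { f : Fin m → Fin (k + 1) // Monotone f }) (j : Fin k) =>
      (⟨(Finset.univ.filter fun i => f.val i ≤ j.castSucc).card, Nat.lt_succ_of_le (by
        simpa using Finset.card_filter_le (Finset.univ : Finset (Fin m))
          fun i => f.val i ≤ j.castSucc)⟩ : Fin (m + 1)) := by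
    intro f g hfg
    have h : ∀ (i : Fin m) (j : Fin k), f.val i ≤ j.castSucc ↔ g.val i ≤ j.castSucc := by
      intro i j
      have := congrArg Fin.val (congrFun hfg j)
      simp only at this
      rw [le_iff_lt_card_of_monotone f.2, le_iff_lt_card_of_monotone g.2, this]
    refine Subtype.ext (funext fun i => ?_)
    have key : ∀ a b : Fin (k + 1), (∀ j : Fin k, a ≤ j.castSucc → b ≤ j.castSucc) → b ≤ a := by
      intro a b hab
      by_contra hlt
      rw [not_le, Fin.lt_def] at hlt
      have := hab ⟨a, by omega⟩ (by simp)
      rw [Fin.le_def] at this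
      simp at this
      omega
    exact le_antisymm (key _ _ fun j => (h i j).2) (key _ _ fun j => (h i j).1)
  simpa using Fintype.card_le_of_injective _ hinj

theorem card_sym2_le : Fintype.card (Sym2 (Fin n)) ≤ n ^ 2 := by
  have := Fintype.card_le_of_surjective (fun p : Fin n × Fin n => s(p.1, p.2)) (by
    intro e
    induction e with
    | _ a b => exact ⟨(a, b), rfl⟩)
  simpa [sq] using this

theorem factorial_le_two_pow (k : ℕ) : k.factorial ≤ 2 ^ (k ^ 2) := by
  rw [sq, pow_mul]
  exact (Nat.factorial_le_pow k).trans (Nat.pow_le_pow_left Nat.lt_two_pow_self.le k)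

/-- In the exponent, 1 is the start, `k ^ 2` the template, `4 k` the slots (an edge and a counter
each) and `2 k` the tail counters. -/
theorem card_runState_le (hn : 2 ≤ n) (hm : m + 1 ≤ n ^ 2) :
    Fintype.card (RunState n k m) ≤ n ^ (1 + k ^ 2 + 6 * k) := by
  rw [Fintype.card_congr (RunState.equiv n k m)]
  simp only [Fintype.card_prod, card_template, Fintype.card_fun, Fintype.card_fin]
  calc n * (k.factorial * ((Fintype.card (Sym2 (Fin n)) * (m + 1)) ^ k * (m + 1) ^ k))
      ≤ n * (n ^ (k ^ 2) * ((n ^ 2 * n ^ 2) ^ k * (n ^ 2) ^ k)) := by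
        gcongr
        · exact (factorial_le_two_pow k).trans (Nat.pow_le_pow_left hn _)
        · exact card_sym2_le
    _ = n ^ (1 + k ^ 2 + 6 * k) := by ring

theorem walkAlg_bits_le [NeZero n] (η : ℝ) (h0 : ∀ c, 0 ≤ labelWeight η k c)
    (h1 : ∑ c, labelWeight η k c = 1)
    (out : (Fin n → Bool) → List (Option (List (Fin n))) → PMF (Option ℝ)) (hn : 2 ≤ n)
    (hm : m + 1 ≤ n ^ 2) : (walkAlg η k m s h0 h1 out).bits ≤
      (2 + 2 * k + s * (1 + k ^ 2 + 6 * k)) * Nat.clog 2 n := by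
  refine (Nat.clog_le_iff_le_pow one_lt_two).2 ?_
  rw [mul_comm, pow_mul]
  refine le_trans ?_ (Nat.pow_le_pow_left (Nat.le_pow_clog one_lt_two n) _)
  change Fintype.card (AlgState n k m s) ≤ _
  simp only [Fintype.card_prod, Fintype.card_fun, Fintype.card_fin]
  calc (m + 1) * (Fintype.card { f : Fin m → Fin (k + 1) // Monotone f } *
        Fintype.card (RunState n k m) ^ s)
      ≤ n ^ 2 * ((n ^ 2) ^ k * (n ^ (1 + k ^ 2 + 6 * k)) ^ s) := by
        gcongr
        · exact card_monotone_le.trans (Nat.pow_le_pow_left hm k)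
        · exact card_runState_le hn hm
    _ = n ^ (2 + 2 * k + s * (1 + k ^ 2 + 6 * k)) := by ring

end Memory

/-! ### The choice of the parameters -/

section Parameters

variable {α ε : ℝ}

theorem half_lt_log_inv (hε0 : 0 < ε) (hε1 : ε < 1 / 2) : 1 / 2 < Real.log (1 / ε) := by
  have h1 : Real.log 2 ≤ Real.log (1 / ε) := by
    refine Real.log_le_log two_pos ?_
    rw [le_div_iff₀ hε0]
    linarith
  have := Real.log_two_gt_d9
  linarith

theorem log_inv_le (h₀ : 0 < α) (h₁ : α < 1) (hε0 : 0 < ε) (hε1 : ε < 1 / 2) :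
    Real.log (1 / ε) ≤ 1 / α * Real.log (1 / ε) := by
  have := half_lt_log_inv hε0 hε1
  refine le_mul_of_one_le_left (by linarith) ?_
  rw [le_div_iff₀ h₀]
  linarith

theorem le_walkLength (α ε : ℝ) : 2 * (1 / α * Real.log (1 / ε)) ≤ walkLength α ε := by
  refine le_trans (le_of_eq ?_) (Nat.le_ceil _)
  ring

/-- The rounding up is absorbed because `1 / α * log (1 / ε)` exceeds `1 / 2`. -/
theorem walkLength_le (h₀ : 0 < α) (h₁ : α < 1) (hε0 : 0 < ε) (hε1 : ε < 1 / 2) :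
    (walkLength α ε : ℝ) ≤ 4 * (1 / α * Real.log (1 / ε)) := by
  have h1 := half_lt_log_inv hε0 hε1
  have h2 := log_inv_le h₀ h₁ hε0 hε1
  have h3 : 0 ≤ 2 / α * Real.log (1 / ε) := by positivity
  have h4 := Nat.ceil_lt_add_one h3
  have h5 : 2 / α * Real.log (1 / ε) = 2 * (1 / α * Real.log (1 / ε)) := by ring
  unfold walkLength
  linarith

theorem two_le_walkLength (h₀ : 0 < α) (h₁ : α < 1) (hε0 : 0 < ε) (hε1 : ε < 1 / 2) :
    2 ≤ walkLength α ε := by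
  have h1 := half_lt_log_inv hε0 hε1
  have h2 := log_inv_le h₀ h₁ hε0 hε1
  have h3 := le_walkLength α ε
  have h4 : (1 : ℝ) < walkLength α ε := by linarith
  exact_mod_cast h4

theorem natCast_le_two_pow (k : ℕ) : (k : ℝ) ≤ 2 ^ k := by
  exact_mod_cast Nat.lt_two_pow_self.le

theorem stepFraction_pos (C : ℝ) (hε0 : 0 < ε) (k : ℕ) : 0 < stepFraction C ε k := by
  unfold stepFraction
  positivity

/-- A large `C` leaves spare powers of `2 ^ k` in `η`, which pay for all polynomial and exponential
factors in `k` in the error terms. -/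
theorem stepFraction_le {C : ℝ} (hC : 20 ≤ C) (hε0 : 0 < ε) (k : ℕ) :
    stepFraction C ε k ≤ ε ^ 8 / (2 ^ k) ^ 20 := by
  unfold stepFraction
  rw [div_eq_mul_inv]
  refine mul_le_mul_of_nonneg_left ?_ (by positivity)
  rw [Real.rpow_neg two_pos.le, ← pow_mul]
  refine inv_anti₀ (by positivity) ?_
  rw [← Real.rpow_natCast]
  refine Real.rpow_le_rpow_of_exponent_le one_le_two ?_
  push_cast
  nlinarith [(Nat.cast_nonneg k : (0 : ℝ) ≤ k)]

theorem inv_stepFraction_pow (C : ℝ) (hε0 : 0 < ε) (k : ℕ) :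
    (stepFraction C ε k ^ k)⁻¹ =
      Real.exp (8 * Real.log (1 / ε) * k + C * Real.log 2 * k ^ 2) := by
  have h1 : ε = Real.exp (-Real.log (1 / ε)) := by
    rw [one_div, Real.log_inv, neg_neg, Real.exp_log hε0]
  unfold stepFraction
  rw [Real.rpow_def_of_pos two_pos]
  nth_rewrite 1 [h1]
  rw [← Real.exp_nat_mul, ← Real.exp_add, ← Real.exp_nat_mul, ← Real.exp_neg]
  congr 1
  push_cast
  ring

/-- With `1 - α ≤ exp (-α)`, the walk length gives `ε ^ 2`, and `ε < 1 / 2` turns this into `ε / 2`.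
-/
theorem pow_walkLength_succ_le (h₀ : 0 < α) (h₁ : α < 1) (hε0 : 0 < ε) (hε1 : ε < 1 / 2) :
    (1 - α) ^ (walkLength α ε + 1) ≤ ε / 2 := by
  have hkx := le_walkLength α ε
  have h1 : (1 - α) ^ (walkLength α ε + 1) ≤ Real.exp (-α) ^ (walkLength α ε + 1) :=
    pow_le_pow_left₀ (by linarith) (by linarith [Real.add_one_le_exp (-α)]) _
  rw [← Real.exp_nat_mul] at h1
  have h2 : Real.exp (((walkLength α ε + 1 : ℕ) : ℝ) * -α) ≤
      Real.exp (2 * Real.log ε) := by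
    refine Real.exp_le_exp.2 ?_
    rw [one_div ε, Real.log_inv] at hkx
    have h3 := mul_le_mul_of_nonneg_left hkx h₀.le
    have h4 : α * (2 * (1 / α * -Real.log ε)) = -(2 * Real.log ε) := by field_simp
    push_cast
    linarith
  have h5 : Real.exp (2 * Real.log ε) = ε ^ 2 := by
    rw [two_mul, Real.exp_add, Real.exp_log hε0, sq]
  rw [h5] at h2
  nlinarith

/-- Put `L = log (1 / ε)` and `Y = log n / (C + 10)`. The hypothesis gives `k ^ 2 ≤ Y` and `L k ≤ Y
/ 4`. After clearing denominators, the logarithm of the left side is at most `2 Y + (C + 7) Y + Y /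
4`, which is below `(C + 10) Y = log n`; this is the reason for the constant `C + 10`. -/
theorem inv_stepFraction_mul_le {n : ℕ} [NeZero n] {C : ℝ} (hC : 20 ≤ C)
    (h₀ : 0 < α) (h₁ : α < 1) (hε0 : 0 < ε) (hε1 : ε < 1 / 2)
    (hn : 1 / α ≤ √(1 / (C + 10) * Real.log n) / (4 * Real.log (1 / ε))) :
    (stepFraction C ε (walkLength α ε) ^ walkLength α ε)⁻¹ *
      (2 * (walkLength α ε : ℝ) ^ 2 / n) ≤ (ε / 64) ^ 2 / 1000 := by
  have hL := half_lt_log_inv hε0 hε1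
  have hLx := log_inv_le h₀ h₁ hε0 hε1
  have hk4 := walkLength_le h₀ h₁ hε0 hε1
  have hk2 := two_le_walkLength h₀ h₁ hε0 hε1
  have hkP := natCast_le_two_pow (walkLength α ε)
  have hinv := inv_stepFraction_pow C hε0 (walkLength α ε)
  rw [hinv]
  have hn0 : (0 : ℝ) < n := by exact_mod_cast Nat.pos_of_ne_zero (NeZero.ne n)
  set L := Real.log (1 / ε) with hLdef
  set k := walkLength α ε with hkdef
  have hk2' : (2 : ℝ) ≤ k := by exact_mod_cast hk2
  have hεL : ε ^ 2 = Real.exp (-(2 * L)) := by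
    rw [hLdef, one_div, Real.log_inv, mul_neg, neg_neg, two_mul, Real.exp_add,
      Real.exp_log hε0, sq]
  have hy : 4 * (1 / α * L) ≤ √(1 / (C + 10) * Real.log n) := by
    rw [le_div_iff₀ (by linarith)] at hn
    linarith
  have hlogn : 0 ≤ Real.log n :=
    Real.log_nonneg (by exact_mod_cast Nat.pos_of_ne_zero (NeZero.ne n))
  have hky : (k : ℝ) ^ 2 ≤ 1 / (C + 10) * Real.log n := by
    rw [← Real.sq_sqrt (show 0 ≤ 1 / (C + 10) * Real.log n by positivity)]
    exact pow_le_pow_left₀ (by positivity) (hk4.trans hy) 2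
  have hLky : L * k ≤ 1 / (C + 10) * Real.log n / 4 := by
    have h1 : L ≤ √(1 / (C + 10) * Real.log n) / 4 := by linarith
    have h2 := mul_le_mul h1 (hk4.trans hy) (by positivity) (by positivity)
    have h3 := Real.mul_self_sqrt (show 0 ≤ 1 / (C + 10) * Real.log n by positivity)
    linarith
  set Y := 1 / (C + 10) * Real.log n with hY
  have hYn : (C + 10) * Y = Real.log n := by
    rw [hY]
    field_simp
  have hl2 : Real.log 2 < 1 := by linarith [Real.log_two_lt_d9]
  have hl0 : 0 < Real.log 2 := Real.log_pos one_lt_two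
  have hpow : ∀ a : ℕ, (2 : ℝ) ^ a = Real.exp (Real.log 2 * a) := by
    intro a
    rw [mul_comm, Real.exp_nat_mul, Real.exp_log two_pos]
  -- Here `8192000 = 2 * 64 ^ 2 * 1000` collects the numerical factors of the goal, and it is below
  -- `2 ^ 23`.
  have hbig : 8192000 * (k : ℝ) ^ 2 ≤ Real.exp (Real.log 2 * (23 + 2 * k)) := by
    have h1 : (k : ℝ) ^ 2 ≤ (2 ^ k) ^ 2 := pow_le_pow_left₀ (by positivity) hkP 2
    have h2 : (2 : ℝ) ^ (23 + 2 * k) = 8388608 * (2 ^ k) ^ 2 := by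
      rw [pow_add, mul_comm 2 k, pow_mul]
      norm_num
    have h3 := hpow (23 + 2 * k)
    push_cast at h3
    rw [← h3, h2]
    nlinarith [sq_nonneg (k : ℝ)]
  have hexp : Real.exp (8 * L * k + C * Real.log 2 * k ^ 2) *
      Real.exp (Real.log 2 * (23 + 2 * k)) * Real.exp (2 * L) ≤ n := by
    rw [← Real.exp_add, ← Real.exp_add]
    refine le_trans (Real.exp_le_exp.2 ?_) (Real.exp_log hn0).le
    rw [← hYn]
    have h1 : Real.log 2 * (C * k ^ 2 + 23 + 2 * k) ≤ C * k ^ 2 + 23 + 2 * k :=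
      mul_le_of_le_one_left (by positivity) hl2.le
    have h2 : (23 : ℝ) + 2 * k ≤ 7 * k ^ 2 := by nlinarith
    have h3 : 2 * L ≤ L * k := by nlinarith
    have h4 : (C + 7) * (k : ℝ) ^ 2 ≤ (C + 7) * Y := mul_le_mul_of_nonneg_left hky (by linarith)
    have h5 : 0 ≤ Y := by positivity
    nlinarith
  have hεε : ε ^ 2 * Real.exp (2 * L) = 1 := by
    rw [hεL, ← Real.exp_add]
    simp
  have h6 : Real.exp (8 * L * k + C * Real.log 2 * k ^ 2) * (8192000 * (k : ℝ) ^ 2) *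
      Real.exp (2 * L) ≤ n := by
    refine le_trans ?_ hexp
    gcongr
  have h7 : Real.exp (8 * L * k + C * Real.log 2 * k ^ 2) * (8192000 * (k : ℝ) ^ 2) ≤
      ε ^ 2 * n := by
    have := mul_le_mul_of_nonneg_left h6 (sq_nonneg ε)
    calc _ = Real.exp (8 * L * k + C * Real.log 2 * k ^ 2) * (8192000 * (k : ℝ) ^ 2) *
          (ε ^ 2 * Real.exp (2 * L)) := by rw [hεε, mul_one]
      _ ≤ _ := by linarith
  rw [← mul_div_assoc, div_le_iff₀ hn0]
  linarith

/-- The parameters are such that `ApproxPageRank` is accurate. -/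
theorem nine_tenths_le_of_sqrt_log {n : ℕ} [NeZero n] {C D : ℝ} (hC : 20 ≤ C) (hD : 100000 ≤ D)
    (h₀ : 0 < α) (h₁ : α < 1) (hε0 : 0 < ε) (hε1 : ε < 1 / 2)
    (hn : 1 / α ≤ √(1 / (C + 10) * Real.log n) / (4 * Real.log (1 / ε)))
    {G : SimpleGraph (Fin n)} (hG : ∀ v, ∃ w, G.Adj v w) (T : Finset (Fin n)) {p : Fin n → ℝ}
    (hp : IsPageRank G α p) :
    9 / 10 ≤ approxPageRankProb C D α ε h₀ h₁ G (fun v => decide (v ∈ T))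
      {o | ∃ y, o = some y ∧ |y - ∑ u ∈ T, p u| ≤ ε} := by
  have hk2 := two_le_walkLength h₀ h₁ hε0 hε1
  have hη := stepFraction_pos C hε0 (walkLength α ε)
  have hη1 := stepFraction_le hC hε0 (walkLength α ε)
  have hkP := natCast_le_two_pow (walkLength α ε)
  have hk0 : (0 : ℝ) < walkLength α ε := by exact_mod_cast (by omega : 0 < walkLength α ε)
  have hk1 : (1 : ℝ) ≤ walkLength α ε := by exact_mod_cast (by omega : 1 ≤ walkLength α ε)
  have hP4 : (4 : ℝ) ≤ 2 ^ walkLength α ε := by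
    calc (4 : ℝ) = 2 ^ 2 := by norm_num
      _ ≤ 2 ^ walkLength α ε := pow_le_pow_right₀ one_le_two hk2
  have hε2 : ε ≤ 1 := by linarith
  -- Of the 20 powers of `2 ^ k` available in `η`, `a` are spent, and each of the others still gives
  -- a factor 4, since `k ≥ 2`.
  have hηP : ∀ a : ℕ, a ≤ 20 → stepFraction C ε (walkLength α ε) * (2 ^ walkLength α ε) ^ a ≤
      ε ^ 8 / 4 ^ (20 - a) := by
    intro a ha
    refine (mul_le_mul_of_nonneg_right hη1 (by positivity)).trans ?_
    have : ((2 : ℝ) ^ walkLength α ε) ^ 20 =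
        (2 ^ walkLength α ε) ^ (20 - a) * (2 ^ walkLength α ε) ^ a := by
      rw [← pow_add]
      congr 1
      omega
    rw [this, div_mul_eq_mul_div, mul_div_mul_right _ _ (by positivity)]
    gcongr
  -- Makes `k κ = ε / 12800`, half of the permitted `ε / 6400`; the other half is left for the mean
  -- loss of edges.
  set κ := ε / (12800 * walkLength α ε) with hκ
  have hκ0 : 0 < κ := by positivity
  have hκ1 : κ ≤ 1 := by
    rw [hκ, div_le_one (by positivity)]
    linarith
  generalize hkk : (walkLength α ε : ℝ) = x at *
  generalize hPP : (2 : ℝ) ^ walkLength α ε = P at *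
  generalize hηη : stepFraction C ε (walkLength α ε) = η at *
  have hε8 : ε ^ 8 ≤ ε := by
    calc ε ^ 8 ≤ ε ^ 1 := pow_le_pow_of_le_one hε0.le hε2 (by norm_num)
      _ = ε := pow_one ε
  have hε82 : ε ^ 8 ≤ ε ^ 2 := pow_le_pow_of_le_one hε0.le hε2 (by norm_num)
  refine nine_tenths_le_approxPageRankProb (κ := κ) h₀ h₁ hG hε0 hε1 (by omega)
    (hηη ▸ hη) ?_ hκ0 hκ1 ?_ ?_
    (inv_stepFraction_mul_le hC h₀ h₁ hε0 hε1 hn) hD (pow_walkLength_succ_le h₀ h₁ hε0 hε1) T hp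
  · rw [hηη, hkk]
    have := hηP 1 (by norm_num)
    rw [pow_one] at this
    calc η * x ≤ η * P := mul_le_mul_of_nonneg_left hkP hη.le
      _ ≤ ε ^ 8 / 4 ^ (20 - 1) := this
      _ ≤ 1 := by norm_num; linarith
  · rw [hηη, hkk, pow_succ (2 : ℝ) (walkLength α ε), hPP]
    have h1 : P * 2 / κ = 25600 * P * x / ε := by
      rw [hκ]
      field_simp
      ring
    have h2 := hηP 5 (by norm_num)
    rw [h1, div_pow, ← mul_div_assoc, div_le_one (by positivity)]
    calc η * x * (25600 * P * x) ^ 2 = 25600 ^ 2 * (η * (P ^ 2 * x ^ 3)) := by ring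
      _ ≤ 25600 ^ 2 * (η * (P ^ 2 * P ^ 3)) := by gcongr
      _ = 25600 ^ 2 * (η * P ^ 5) := by ring
      _ ≤ 25600 ^ 2 * (ε ^ 8 / 4 ^ (20 - 5)) := by gcongr
      _ ≤ ε ^ 2 := by norm_num; linarith [sq_nonneg ε]
  · rw [hηη, hkk, pow_succ (2 : ℝ) (walkLength α ε), hPP]
    have h2 := hηP 3 (by norm_num)
    have h3 : x * κ = ε / 12800 := by
      rw [hκ]
      field_simp
    calc x * (P * 2 * (η * x) + κ) = 2 * (η * (P * x ^ 2)) + x * κ := by ring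
      _ ≤ 2 * (η * (P * P ^ 2)) + x * κ := by gcongr
      _ = 2 * (η * P ^ 3) + x * κ := by ring
      _ ≤ 2 * (ε ^ 8 / 4 ^ (20 - 3)) + ε / 12800 := by rw [h3]; gcongr
      _ ≤ ε / 64 / 100 := by norm_num; linarith

end Parameters

/-! ### The space bound in words. -/

section Words

variable {α ε : ℝ}

/-- The constant in the exponent of the space bound. -/
def spaceConstant (C D : ℝ) : ℝ := 36 + 16 * (C + 4) + 4 * (Real.log (6464 * D) / Real.log 2)

theorem spaceConstant_pos {C D : ℝ} (hC : 0 ≤ C) (hD : 1 ≤ D) : 0 < spaceConstant C D := by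
  have h1 : 0 ≤ Real.log (6464 * D) := Real.log_nonneg (by linarith)
  have h2 : 0 < Real.log 2 := Real.log_pos one_lt_two
  unfold spaceConstant
  positivity

/-- All factors are put into one exponential, with `k! ≤ 2 ^ (k ^ 2)` and `k + 1 ≤ 2 * 2 ^ k`. The
numerical factors are `2 * 2 * 100`, and 404 leaves room for rounding up. -/
theorem runCount_le {C D : ℝ} (hC : 0 ≤ C) (hD : 1 ≤ D) (h₀ : 0 < α) (h₁ : α < 1) (hε0 : 0 < ε)
    (hε1 : ε < 1 / 2) :
    (runCount C D α ε : ℝ) ≤ 404 * D * Real.exp (2 * Real.log (1 / ε) +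
      8 * Real.log (1 / ε) * walkLength α ε +
      Real.log 2 * ((C + 1) * (walkLength α ε : ℝ) ^ 2 + walkLength α ε)) := by
  have hinv := inv_stepFraction_pow C hε0 (walkLength α ε)
  have hL := half_lt_log_inv hε0 hε1
  have hk2 := two_le_walkLength h₀ h₁ hε0 hε1
  have hkP := natCast_le_two_pow (walkLength α ε)
  set L := Real.log (1 / ε) with hLdef
  unfold runCount
  set k := walkLength α ε with hkdef
  have hk1 : (1 : ℝ) ≤ k := by exact_mod_cast (by omega : 1 ≤ k)
  have hl0 : 0 < Real.log 2 := Real.log_pos one_lt_two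
  have hpow : ∀ a : ℕ, (2 : ℝ) ^ a = Real.exp (Real.log 2 * a) := by
    intro a
    rw [mul_comm, Real.exp_nat_mul, Real.exp_log two_pos]
  have hεL : (ε ^ 2)⁻¹ = Real.exp (2 * L) := by
    rw [hLdef, one_div, Real.log_inv, two_mul, Real.exp_add, Real.exp_neg, Real.exp_log hε0, sq,
      mul_inv]
  have hε2 : (1 : ℝ) ≤ (ε ^ 2)⁻¹ := by
    rw [hεL]
    exact Real.one_le_exp (by linarith)
  have hb : (⌈D / ε ^ 2⌉₊ : ℝ) ≤ 2 * D * Real.exp (2 * L) := by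
    have h1 : (0 : ℝ) ≤ D / ε ^ 2 := by positivity
    have h2 := (Nat.ceil_lt_add_one h1).le
    rw [div_eq_mul_inv, hεL] at *
    nlinarith
  have hb1 : (1 : ℝ) ≤ ⌈D / ε ^ 2⌉₊ := by
    have : 0 < ⌈D / ε ^ 2⌉₊ := Nat.ceil_pos.2 (by positivity)
    exact_mod_cast this
  have hfac : (k.factorial : ℝ) ≤ Real.exp (Real.log 2 * k ^ 2) := by
    have := hpow (k ^ 2)
    push_cast at this
    rw [← this]
    exact_mod_cast factorial_le_two_pow k
  have hfac1 : (1 : ℝ) ≤ k.factorial := by exact_mod_cast Nat.factorial_pos k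
  have hk' : (k : ℝ) + 1 ≤ 2 * Real.exp (Real.log 2 * k) := by
    rw [← hpow]
    linarith
  rw [hinv]
  push_cast
  have hE1 : 1 ≤ Real.exp (8 * L * k + C * Real.log 2 * k ^ 2) := Real.one_le_exp (by positivity)
  set X := (⌈D / ε ^ 2⌉₊ : ℝ) * (k + 1) * 100 * Real.exp (8 * L * k + C * Real.log 2 * k ^ 2) *
    k.factorial with hX
  have hX1 : 1 ≤ X := by
    have h1 : (1 : ℝ) ≤ ⌈D / ε ^ 2⌉₊ * (k + 1) := one_le_mul_of_one_le_of_one_le hb1 (by linarith)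
    have h2 : (1 : ℝ) ≤ ⌈D / ε ^ 2⌉₊ * (k + 1) * 100 :=
      one_le_mul_of_one_le_of_one_le h1 (by norm_num)
    exact one_le_mul_of_one_le_of_one_le (one_le_mul_of_one_le_of_one_le h2 hE1) hfac1
  have hceil := (Nat.ceil_lt_add_one (zero_le_one.trans hX1)).le
  have hX2 : X ≤ 400 * D * Real.exp (2 * L + 8 * L * k + Real.log 2 * ((C + 1) * k ^ 2 + k)) := by
    calc X ≤ 2 * D * Real.exp (2 * L) * (2 * Real.exp (Real.log 2 * k)) * 100 *
          Real.exp (8 * L * k + C * Real.log 2 * k ^ 2) * Real.exp (Real.log 2 * k ^ 2) := by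
          rw [hX]
          gcongr
      _ = 400 * D * (Real.exp (2 * L) * Real.exp (Real.log 2 * k) *
          Real.exp (8 * L * k + C * Real.log 2 * k ^ 2) * Real.exp (Real.log 2 * k ^ 2)) := by ring
      _ = _ := by
          rw [← Real.exp_add, ← Real.exp_add, ← Real.exp_add]
          congr 2
          ring
  have hE2 : 1 ≤ D * Real.exp (2 * L + 8 * L * k + Real.log 2 * ((C + 1) * k ^ 2 + k)) :=
    one_le_mul_of_one_le_of_one_le hD (Real.one_le_exp (by positivity))
  linarith

theorem words_le {C D : ℝ} (hC : 0 ≤ C) (hD : 1 ≤ D) (h₀ : 0 < α) (h₁ : α < 1) (hε0 : 0 < ε)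
    (hε1 : ε < 1 / 2) :
    ((2 + 2 * walkLength α ε + runCount C D α ε *
      (1 + walkLength α ε ^ 2 + 6 * walkLength α ε) : ℕ) : ℝ) ≤
      (1 / ε) ^ (spaceConstant C D * (1 / α * Real.log (1 / ε))) *
        (2 : ℝ) ^ (spaceConstant C D * (1 / α ^ 2 * Real.log (1 / ε) ^ 2)) := by
  have hs := runCount_le hC hD h₀ h₁ hε0 hε1
  have hL := half_lt_log_inv hε0 hε1
  have hLx := log_inv_le h₀ h₁ hε0 hε1
  have hk4 := walkLength_le h₀ h₁ hε0 hε1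
  have hk2 := two_le_walkLength h₀ h₁ hε0 hε1
  have hkP := natCast_le_two_pow (walkLength α ε)
  have hs1 : (1 : ℝ) ≤ runCount C D α ε := by
    have : 0 < runCount C D α ε := by
      unfold runCount
      refine Nat.ceil_pos.2 ?_
      have h1 := stepFraction_pos C hε0 (walkLength α ε)
      have h2 : 0 < ⌈D / ε ^ 2⌉₊ := Nat.ceil_pos.2 (by positivity)
      positivity
    exact_mod_cast this
  rw [Real.rpow_def_of_pos (by positivity), Real.rpow_def_of_pos two_pos, ← Real.exp_add]
  have hx2 : 1 / α ^ 2 * Real.log (1 / ε) ^ 2 = (1 / α * Real.log (1 / ε)) ^ 2 := by ring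
  rw [hx2]
  push_cast
  generalize Real.log (1 / ε) = L at *
  generalize hxx : 1 / α * L = x at *
  generalize (runCount C D α ε : ℝ) = s at *
  have hk2' : (2 : ℝ) ≤ walkLength α ε := by exact_mod_cast hk2
  have hpow : (2 : ℝ) ^ walkLength α ε = Real.exp (Real.log 2 * walkLength α ε) := by
    rw [mul_comm, Real.exp_nat_mul, Real.exp_log two_pos]
  rw [hpow] at hkP
  generalize (walkLength α ε : ℝ) = k at *
  have hl0 : 0 < Real.log 2 := Real.log_pos one_lt_two
  have hA : 0 ≤ Real.log (6464 * D) := Real.log_nonneg (by linarith)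
  have h1 : 2 + 2 * k + s * (1 + k ^ 2 + 6 * k) ≤ 16 * k ^ 2 * s := by
    have h2 : 2 + 2 * k ≤ s * (2 + 2 * k) := le_mul_of_one_le_left (by linarith) hs1
    have h3 : 3 + 8 * k + k ^ 2 ≤ 16 * k ^ 2 := by nlinarith
    nlinarith [mul_le_mul_of_nonneg_left h3 (zero_le_one.trans hs1)]
  have h4 : 16 * k ^ 2 * s ≤ 16 * Real.exp (Real.log 2 * k) ^ 2 * (404 * D *
      Real.exp (2 * L + 8 * L * k + Real.log 2 * ((C + 1) * k ^ 2 + k))) := by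
    gcongr
  refine (h1.trans h4).trans ?_
  have h5 : 16 * Real.exp (Real.log 2 * k) ^ 2 * (404 * D *
      Real.exp (2 * L + 8 * L * k + Real.log 2 * ((C + 1) * k ^ 2 + k))) =
      Real.exp (Real.log (6464 * D) + (Real.log 2 * k + Real.log 2 * k) +
        (2 * L + 8 * L * k + Real.log 2 * ((C + 1) * k ^ 2 + k))) := by
    rw [Real.exp_add (_ + _) (2 * L + _ + _), Real.exp_add (Real.log (6464 * D)),
      Real.exp_add (Real.log 2 * k), Real.exp_log (by positivity)]
    ring
  rw [h5]
  refine Real.exp_le_exp.2 ?_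
  have hx0 : 0 < x := by linarith
  -- From `k ≤ 4 x` and `1 ≤ 2 x` come 32 and 4; these terms go into the power of `1 / ε`.
  have h6 : 2 * L + 8 * L * k ≤ L * (36 * x) := by
    have h7 : 1 ≤ 2 * x := by linarith
    nlinarith [mul_le_mul_of_nonneg_left hk4 (by linarith : 0 ≤ L),
      mul_le_mul_of_nonneg_left h7 (by linarith : 0 ≤ L)]
  have hkx2 : k ^ 2 ≤ 16 * x ^ 2 := by
    calc k ^ 2 ≤ (4 * x) ^ 2 := pow_le_pow_left₀ (by linarith) hk4 2
      _ = 16 * x ^ 2 := by ring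
  -- The three linear terms are at most `3 k ^ 2`, and `k ^ 2 ≤ 16 x ^ 2`; these terms go into the
  -- power of 2.
  have h8 : Real.log 2 * k + Real.log 2 * k + Real.log 2 * ((C + 1) * k ^ 2 + k) ≤
      Real.log 2 * (16 * (C + 4) * x ^ 2) := by
    have h9 : k + k + ((C + 1) * k ^ 2 + k) ≤ 16 * (C + 4) * x ^ 2 := by
      nlinarith [mul_le_mul_of_nonneg_left hkx2 (by linarith : 0 ≤ C + 4)]
    linarith [mul_le_mul_of_nonneg_left h9 hl0.le]
  -- The constant prefactor `6464 D`, where `6464 = 16 * 404`, also goes into the power of 2,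
  -- because `4 x ^ 2 ≥ 1`.
  have h10 : Real.log (6464 * D) ≤
      Real.log 2 * (4 * (Real.log (6464 * D) / Real.log 2) * x ^ 2) := by
    have e : Real.log 2 * (4 * (Real.log (6464 * D) / Real.log 2) * x ^ 2) =
        Real.log (6464 * D) * (4 * x ^ 2) := by field_simp
    rw [e]
    exact le_mul_of_one_le_right hA (by nlinarith)
  have hq : 0 ≤ Real.log (6464 * D) / Real.log 2 := by positivity
  have h11 : L * (36 * x) ≤ L * (spaceConstant C D * x) := by
    refine mul_le_mul_of_nonneg_left (mul_le_mul_of_nonneg_right ?_ hx0.le) (by linarith)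
    unfold spaceConstant
    linarith
  have h12 : Real.log 2 * (16 * (C + 4) * x ^ 2) +
      Real.log 2 * (4 * (Real.log (6464 * D) / Real.log 2) * x ^ 2) ≤
      Real.log 2 * (spaceConstant C D * x ^ 2) := by
    unfold spaceConstant
    nlinarith [mul_nonneg hl0.le (sq_nonneg x)]
  linarith

end Words

/-! ### The guarantee -/

section Guarantee

/-- An algorithm without memory. -/
def trivialAlg (n : ℕ) : StreamAlg n where
  State := Unit
  fintype := inferInstance
  init := PMF.pure ()
  step _ _ := PMF.pure ()
  output _ _ := PMF.pure none

theorem card_edgeSet_lt {n : ℕ} (hn : 1 ≤ n) (G : SimpleGraph (Fin n)) :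
    Nat.card G.edgeSet + 1 ≤ n ^ 2 := by
  have h1 := G.card_edgeFinset_le_card_choose_two
  rw [Fintype.card_fin, ← SimpleGraph.coe_edgeFinset, Nat.card_coe_set_eq, Set.ncard_coe_finset] at *
  rw [Nat.choose_two_right] at h1
  have h2 : n * (n - 1) / 2 ≤ n * (n - 1) := Nat.div_le_self _ _
  obtain ⟨r, rfl⟩ : ∃ r, n = r + 1 := ⟨n - 1, by omega⟩
  rw [Nat.add_sub_cancel] at h1 h2
  nlinarith

theorem guarantee_of_sqrt_log {n : ℕ} [NeZero n] {C D α ε : ℝ} (hC : 20 ≤ C) (hD : 100000 ≤ D)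
    (h₀ : 0 < α) (h₁ : α < 1) (hε0 : 0 < ε) (hε1 : ε < 1 / 2)
    (hn : 1 / α ≤ √(1 / (C + 10) * Real.log n) / (4 * Real.log (1 / ε))) :
    Guarantee C D (spaceConstant C D) n α ε h₀ h₁ := by
  intro m
  by_cases hnm : 2 ≤ n ∧ m + 1 ≤ n ^ 2
  · have hη := stepFraction_pos C hε0 (walkLength α ε)
    have hk : stepFraction C ε (walkLength α ε) * walkLength α ε ≤ 1 := by
      have h1 := stepFraction_le hC hε0 (walkLength α ε)
      have hkP := natCast_le_two_pow (walkLength α ε)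
      have hP : (1 : ℝ) ≤ 2 ^ walkLength α ε := one_le_pow₀ one_le_two
      calc stepFraction C ε (walkLength α ε) * walkLength α ε
          ≤ ε ^ 8 / (2 ^ walkLength α ε) ^ 20 * 2 ^ walkLength α ε := by gcongr
        _ ≤ 1 / (2 ^ walkLength α ε) ^ 20 * 2 ^ walkLength α ε := by
            gcongr
            exact pow_le_one₀ hε0.le (by linarith)
        _ ≤ 1 := by
            rw [one_div_mul_eq_div, div_le_one (by positivity)]
            exact le_self_pow₀ hP (by norm_num)
    have hw0 := fun c => labelWeight_nonneg (k := walkLength α ε) hη.le hk c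
    refine ⟨walkAlg _ _ m (runCount C D α ε) hw0 (sum_labelWeight _ _) (estimate D α ε h₀ h₁),
      ?_, fun G hG hm T => ⟨fun S => ?_, fun p hp =>
        nine_tenths_le_of_sqrt_log hC hD h₀ h₁ hε0 hε1 hn hG T hp⟩⟩
    · have h1 := walkAlg_bits_le (s := runCount C D α ε) _ hw0 (sum_labelWeight _ _)
        (estimate D α ε h₀ h₁) hnm.1 hnm.2
      have h2 := words_le (by linarith : (0 : ℝ) ≤ C) (by linarith : (1 : ℝ) ≤ D) h₀ h₁ hε0 hε1
      refine le_trans (Nat.cast_le.2 h1) ?_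
      rw [Nat.cast_mul]
      exact mul_le_mul_of_nonneg_right h2 (Nat.cast_nonneg _)
    · rw [walkAlg_runRandomOrder hη hk hw0 _ _ G hm, approxPageRankProb_eq h₀ h₁ _ S hη hk]
      simp only [approxPageRank_eq]
  -- No graph without isolated vertices has these `n` and `m`: such a graph needs two vertices, and
  -- a simple graph has fewer than `n ^ 2` edges.
  · refine ⟨trivialAlg n, ?_, fun G hG hm T => absurd ?_ hnm⟩
    · have hb : (trivialAlg n).bits = 0 := by
        unfold StreamAlg.bits
        refine Nat.clog_of_right_le_one ?_ 2
        change Fintype.card Unit ≤ 1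
        simp
      unfold StreamAlg.UsesAtMostWords
      rw [hb, Nat.cast_zero]
      positivity
    · have hn0 : 0 < n := Nat.pos_of_ne_zero (NeZero.ne n)
      refine ⟨?_, hm ▸ card_edgeSet_lt hn0 G⟩
      obtain ⟨w, hw⟩ := hG ⟨0, hn0⟩
      have := hw.ne
      by_contra hlt
      exact this (Fin.ext (by simp only; omega))

/-- Since `log (1 / ε) ≤ |g n|` and `g = o(√(log n))` with `α` fixed, the condition of case (a)
holds eventually for any prescribed constant `c`. Case (b) thus reduces to case (a). -/
theorem eventually_sqrt_log {g : ℕ → ℝ} (hg : g =o[atTop] fun n : ℕ => √(Real.log n)) {α c : ℝ}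
    (h₀ : 0 < α) (hc : 0 < c) : ∃ n₀ : ℕ, ∀ n : ℕ, n₀ ≤ n → ∀ ε : ℝ, (2 : ℝ) ^ (-g n) < ε →
      ε < 1 / 2 → 1 / α ≤ √(c * Real.log n) / (4 * Real.log (1 / ε)) := by
  have h1 := hg.bound (show 0 < α * √c / 4 by positivity)
  obtain ⟨n₀, hn₀⟩ := eventually_atTop.1 h1
  refine ⟨n₀, fun n hn ε hε hε1 => ?_⟩
  have h2 := hn₀ n hn
  rw [Real.norm_eq_abs, Real.norm_of_nonneg (Real.sqrt_nonneg _)] at h2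
  have hε0 : 0 < ε := lt_trans (by positivity) hε
  have hL := half_lt_log_inv hε0 hε1
  have h3 : Real.log (1 / ε) ≤ |g n| := by
    have h4 := Real.log_lt_log (by positivity) hε
    rw [Real.log_rpow two_pos] at h4
    rw [one_div, Real.log_inv]
    have h5 : Real.log 2 ≤ 1 := by linarith [Real.log_two_lt_d9]
    have h6 : 0 < Real.log 2 := Real.log_pos one_lt_two
    calc -Real.log ε ≤ g n * Real.log 2 := by linarith
      _ ≤ |g n| * Real.log 2 := mul_le_mul_of_nonneg_right (le_abs_self _) h6.le
      _ ≤ |g n| := mul_le_of_le_one_right (abs_nonneg _) h5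
  rw [le_div_iff₀ (by linarith), Real.sqrt_mul hc.le, one_div_mul_eq_div, div_le_iff₀ h₀]
  linarith

end Guarantee

end RandomOrderStream

end

open RandomOrderStream
theorem corollary3 :
    ∃ C₀ : ℝ, ∀ C : ℝ, C₀ ≤ C → ∃ D₀ : ℝ, ∀ D : ℝ, D₀ ≤ D →
      ∃ c' : ℝ, 0 < c' ∧ ∃ K : ℝ, 0 < K ∧
        (∀ (n : ℕ) [NeZero n] (α ε : ℝ) (h₀ : 0 < α) (h₁ : α < 1),
          0 < ε → ε < 1 / 2 →
          1 / α ≤ √(c' * Real.log n) / (4 * Real.log (1 / ε)) →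
          Guarantee C D K n α ε h₀ h₁) ∧
        (∀ (α : ℝ) (h₀ : 0 < α) (h₁ : α < 1) (g : ℕ → ℝ),
          g =o[Filter.atTop] (fun n : ℕ => √(Real.log n)) →
          ∃ n₀ : ℕ, ∀ (n : ℕ) [NeZero n], n₀ ≤ n → ∀ ε : ℝ,
            (2 : ℝ) ^ (-g n) < ε → ε < 1 / 2 →
            1 / α ≤ √(Real.log n) / (4 * Real.log (1 / ε)) →
            Guarantee C D K n α ε h₀ h₁) := by
  -- The value 20 serves the error terms in `2 ^ k`, 100000 the sampling error, and `1 / (C + 10)`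
  -- the variance; the exponent constant is common to both cases.
  refine ⟨20, fun C hC => ⟨100000, fun D hD => ⟨1 / (C + 10), by positivity, spaceConstant C D,
    spaceConstant_pos (by linarith) (by linarith), ?_, ?_⟩⟩⟩
  · intro n _ α ε h₀ h₁ hε0 hε1 hn
    exact guarantee_of_sqrt_log hC hD h₀ h₁ hε0 hε1 hn
  · intro α h₀ h₁ g hg
    obtain ⟨n₀, hn₀⟩ := eventually_sqrt_log hg h₀ (show 0 < 1 / (C + 10) by positivity)
    refine ⟨n₀, fun n _ hn ε hε hε1 _ => ?_⟩
    exact guarantee_of_sqrt_log hC hD h₀ h₁ (lt_trans (by positivity) hε) hε1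
      (hn₀ n hn ε hε hε1)
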